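/- \textbf{Setting.} For integers $N\ge 2$, $m\ge 1$ and real $\mu,x$, let $$H_0+xV=\sum_{n=1}^{N-1}L^2(n)+\sum_{n=1}^{N}(-1)^n\Big(\frac{\mu}{2}+\frac{\mu}{2}\sigma_3(n)\Big)+x\sum_{n=1}^{N-1}\Big(\sigma^+(n)e^{i\theta(n)}\sigma^-(n+1)+\mathrm{h.c.}\Big)$$ be the single-flavour lattice Schwinger Hamiltonian with $N$ sites (one qubit each) and $N-1$ gauge links of $m$ qubits each, where on a link with computational basis $|l\rangle$, $0\le l<2^m$ (written in binary), $L^2=\sum_l (l-2^{m-1})^2|l\rangle\langle l|$ and $e^{i\theta}=\sum_l|l+1 \bmod 2^m\rangle\langle l|$. Let $H=\sum_i\alpha_iP_i$ be the Pauli expansion of this Hamiltonian divided by the sum of the absolute values of its Pauli coefficients, so that $\sum_i|\alpha_i|=1$. Each Pauli operator is labelled by $|i\rangle=|\vec x,\vec z\rangle$, where $P(\vec x,\vec z)=\bigotimes_j i^{x_jz_j}X^{x_j}Z^{z_j}$, in an auxiliary register of two qubits per system qubit. Put $$|G\rangle=\sum_i\sqrt{|\alpha_i|}\,|i\rangle,\quad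 |\tilde G\rangle=\sum_i\operatorname{sgn}(\alpha_i)\sqrt{|\alpha_i|}\,|i\rangle,\quad U=\sum_i|i\rangle\langle i|\otimes P_i,\quad \Pi_\varphi=e^{2i\varphi|G\rangle\langle G|},\quad \tilde\Pi_\varphi=e^{2i\varphi|\tilde G\rangle\langle\tilde G|}.$$ Circuits are sequences of CNOT gates, $T^{\pm1}$ gates, $R_z(\theta)$ gates ($\theta\in\mathbb R$) and the single-qubit Clifford gates $X,H,S^{\pm1}$, acting on the system, the auxiliary register, one rotation qubit and further ancillas that start and end in $|0\rangle$. The gate cost is the total number of gates. \textbf{Theorem.} For every integer $c\ge0$ there is a constant $C$ such that for all $N\ge2$, $\mu,x\in\mathbb R$ and $m\ge1$ with $m\le\log_2N+c$ (that is, for $m=\log N$ up to rounding or an additive constant) there are circuits for the two preparations $|0\rangle\mapsto|G\rangle$ and $|0\rangle\mapsto|\tilde G\rangle$, for $U$ and, for each $\varphi\in\mathbb R$, for $\Pi_\varphi$ and for $\tilde\Pi_\varphi$ (the last two applied with angle $\varphi$ if the rotation qubit is $|0\rangle$ and with $-\varphi$ if it is $|1\rangle$), none depending on $k$, with the following properties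 for every $k\ge1$. For angles $\varphi_1,\dots,\varphi_k$ let the shot circuit consist of the preparation of $|G\rangle$; then $k$ steps, alternately $U$ followed by a rotation $\tilde\Pi_{\varphi_j}$, and $U^\dagger$ followed by a rotation $\Pi_{\varphi_j}$, beginning with $U$; and finally the inverse of the preparation of $|G\rangle$ if $k$ is even, or of $|\tilde G\rangle$ if $k$ is odd. If $k$ is even, a Hadamard gate is also applied to the rotation qubit at the beginning and at the end. Thus it uses two preparation circuits ($G$, $\tilde G$ or their inverses), $k$ applications of $U$ or $U^\dagger$ and $k$ applications of $\Pi_\varphi$ or $\tilde\Pi_\varphi$. \begin{itemize} \item There are angles $\varphi_1,\dots,\varphi_k$ such that for every state $|\psi_0\rangle$ of the system, the amplitude for the shot circuit to take $|\psi_0\rangle$, with all other qubits in $|0\rangle$, back to that same state is exactly $\langle\psi_0|H^k|\psi_0\rangle$. \item For all angles, the gate cost of the shot circuit (not counting the preparation of $|\psi_0\rangle$) is at most $C\,k\,N\log N$. \end{itemize} -/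

import Mathlib

open scoped Matrix Kronecker

/-! ### Gates and circuits

A register with wire set `ι` has computational basis `ι → Bool` (`false` is the basis vector 0 and
`true` is the basis vector 1), its states are functions `(ι → Bool) → ℂ`, and operators are
matrices. -/

/-- The Pauli matrix `σ₁`. -/
def sigma1 : Matrix Bool Bool ℂ := Matrix.of fun a b => if a = b then 0 else 1

/-- The Pauli matrix `σ₂`: it sends basis vector 0 to `i` times basis vector 1. -/
noncomputable def sigma2 : Matrix Bool Bool ℂ :=
  Matrix.of fun a b => if a = b then 0 else if a then Complex.I else -Complex.I

/-- The Pauli matrix `σ₃`. -/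
def sigma3 : Matrix Bool Bool ℂ := Matrix.diagonal fun b => if b then -1 else 1

/-- `σ⁺ = (σ₁ + i σ₂) / 2`. -/
noncomputable def sigmaPlus : Matrix Bool Bool ℂ := (1 / 2 : ℂ) • (sigma1 + Complex.I • sigma2)

/-- `σ⁻ = (σ₁ - i σ₂) / 2`. -/
noncomputable def sigmaMinus : Matrix Bool Bool ℂ := (1 / 2 : ℂ) • (sigma1 - Complex.I • sigma2)

/-- The one-qubit operator `A` acting on wire `q`, tensored with the identity elsewhere. -/
def onWire {ι : Type} [Fintype ι] [DecidableEq ι] (q : ι) (A : Matrix Bool Bool ℂ) :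
    Matrix (ι → Bool) (ι → Bool) ℂ :=
  Matrix.of fun a b => if a = Function.update b q (a q) then A (a q) (b q) else 0

/-- The gate set: CNOT, T and its inverse, `R_z(θ)`, and one-qubit Clifford gates. -/
inductive Gate (ι : Type) : Type
  | x (q : ι) : Gate ι
  | h (q : ι) : Gate ι
  | s (q : ι) : Gate ι
  | sdg (q : ι) : Gate ι
  | t (q : ι) : Gate ι
  | tdg (q : ι) : Gate ι
  | rz (θ : ℝ) (q : ι) : Gate ι
  | cnot (c q : ι) (hne : c ≠ q) : Gate ι

/-- The phase gate `diag(1, e^{iθ})`. -/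
noncomputable def phaseMat (θ : ℝ) : Matrix Bool Bool ℂ :=
  Matrix.diagonal fun b => if b then Complex.exp (θ * Complex.I) else 1

/-- The unitary matrix of a gate. -/
noncomputable def Gate.mat {ι : Type} [Fintype ι] [DecidableEq ι] :
    Gate ι → Matrix (ι → Bool) (ι → Bool) ℂ
  | .x q => onWire q sigma1
  | .h q => onWire q (((1 / Real.sqrt 2 : ℝ) : ℂ) • (sigma1 + sigma3))
  | .s q => onWire q (phaseMat (Real.pi / 2))
  | .sdg q => onWire q (phaseMat (-(Real.pi / 2)))
  | .t q => onWire q (phaseMat (Real.pi / 4))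
  | .tdg q => onWire q (phaseMat (-(Real.pi / 4)))
  | .rz θ q => onWire q (Matrix.diagonal fun b =>
      if b then Complex.exp ((θ / 2 : ℝ) * Complex.I) else Complex.exp (-(θ / 2 : ℝ) * Complex.I))
  | .cnot c q _ => Matrix.of fun a b => if a = Function.update b q (xor (b q) (b c)) then 1 else 0

/-- The inverse gate. -/
def Gate.dagger {ι : Type} : Gate ι → Gate ι
  | .x q => .x q
  | .h q => .h q
  | .s q => .sdg q
  | .sdg q => .s q
  | .t q => .tdg q
  | .tdg q => .t q
  | .rz θ q => .rz (-θ) q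
  | .cnot c q hne => .cnot c q hne

/-- A circuit is a list of gates, in the order in which they are applied. Its gate cost is the
length of the list: every gate is counted. -/
abbrev Circuit (ι : Type) : Type := List (Gate ι)

/-- The unitary matrix of a circuit. -/
noncomputable def Circuit.mat {ι : Type} [Fintype ι] [DecidableEq ι] :
    Circuit ι → Matrix (ι → Bool) (ι → Bool) ℂ
  | [] => 1
  | g :: c => Circuit.mat c * g.mat

/-- The inverse circuit, with the same number of gates. -/
def Circuit.inv {ι : Type} (c : Circuit ι) : Circuit ι := (c.map Gate.dagger).reverse

/-! ### The lattice Schwinger model with truncated gauge fields -/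

/-- The system qubits for `N` sites and `N - 1` links: one qubit for each site and `m` qubits for
each link. The site numbered `n` in `1, …, N` is the element `n - 1` of `Fin N`, and the link
between the sites `n` and `n + 1` is the element `n - 1` of `Fin (N - 1)`. -/
abbrev Qubit (N m : ℕ) : Type := Fin N ⊕ (Fin (N - 1) × Fin m)

/-- Computational basis of the system. -/
abbrev Conf (N m : ℕ) : Type := Qubit N m → Bool

/-- The integer `l` in `0, …, 2 ^ m - 1` whose binary digits are stored on link `n`; it stands for
the field value `l - 2 ^ m / 2`. -/
def linkValue {N m : ℕ} (b : Conf N m) (n : Fin (N - 1)) : ℕ :=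
  ∑ j : Fin m, if b (Sum.inr (n, j)) then 2 ^ (j : ℕ) else 0

/-- The truncated operator `L(n)²`. -/
noncomputable def fieldSq (N m : ℕ) (n : Fin (N - 1)) : Matrix (Conf N m) (Conf N m) ℂ :=
  Matrix.diagonal fun b => ((linkValue b n : ℂ) - 2 ^ m / 2) ^ 2

/-- The truncated (cyclic) raising operator `e^{iθ(n)}` of link `n`. -/
def raise (N m : ℕ) (n : Fin (N - 1)) : Matrix (Conf N m) (Conf N m) ℂ :=
  Matrix.of fun a b =>
    if (∀ q : Qubit N m, (∀ j : Fin m, q ≠ Sum.inr (n, j)) → a q = b q) ∧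
        linkValue a n = (linkValue b n + 1) % 2 ^ m then 1 else 0

/-- The left end of a link. -/
def leftSite {N : ℕ} (n : Fin (N - 1)) : Fin N := ⟨n, by omega⟩

/-- The right end of a link. -/
def rightSite {N : ℕ} (n : Fin (N - 1)) : Fin N := ⟨n + 1, by omega⟩

/-- `σ⁺(n) e^{iθ(n)} σ⁻(n+1)`. -/
noncomputable def hop (N m : ℕ) (n : Fin (N - 1)) : Matrix (Conf N m) (Conf N m) ℂ :=
  onWire (Sum.inl (leftSite n)) sigmaPlus * raise N m n * onWire (Sum.inl (rightSite n)) sigmaMinus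

/-- The lattice Schwinger Hamiltonian `H₀ + x V`, where
`H₀ = ∑ L(n)² + ∑ (-1)ⁿ (μ/2 + (μ/2) σ₃(n))` and `V = ∑ (σ⁺(n) e^{iθ(n)} σ⁻(n+1) + h.c.)`. -/
noncomputable def schwinger (N m : ℕ) (μ x : ℝ) : Matrix (Conf N m) (Conf N m) ℂ :=
  (∑ n : Fin (N - 1), fieldSq N m n)
    + (∑ n : Fin N, ((-1 : ℂ) ^ ((n : ℕ) + 1)) •
        (((μ / 2 : ℝ) : ℂ) • (1 : Matrix (Conf N m) (Conf N m) ℂ)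
          + ((μ / 2 : ℝ) : ℂ) • onWire (Sum.inl n) sigma3))
    + (x : ℂ) • ∑ n : Fin (N - 1), (hop N m n + (hop N m n)ᴴ)

/-! ### Pauli expansion and block encoding -/

/-- Labels `(x, z)` of Pauli operators: the computational basis of the auxiliary register. -/
abbrev Aux (N m : ℕ) : Type := Conf N m × Conf N m

/-- The Pauli operator `⨂_j i^{x_j z_j} X^{x_j} Z^{z_j}`. -/
noncomputable def pauli {N m : ℕ} (p : Aux N m) : Matrix (Conf N m) (Conf N m) ℂ :=
  Matrix.of fun a b => ∏ j : Qubit N m,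
    ((if p.1 j && p.2 j then Complex.I else 1) •
      ((if p.1 j then sigma1 else 1) * (if p.2 j then sigma3 else 1))) (a j) (b j)

/-- The coefficient of a Pauli operator in the Pauli expansion of `A`. It is the real number
`2^{-n} tr (P A)`, for a Hermitian operator `A` on `n` qubits. -/
noncomputable def pauliCoeff {N m : ℕ} (A : Matrix (Conf N m) (Conf N m) ℂ) (p : Aux N m) : ℝ :=
  (Matrix.trace (pauli p * A)).re / 2 ^ Fintype.card (Qubit N m)

/-- The sum of the absolute values of the Pauli coefficients of the Schwinger Hamiltonian. -/
noncomputable def pauliNorm (N m : ℕ) (μ x : ℝ) : ℝ :=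
  ∑ p : Aux N m, |pauliCoeff (schwinger N m μ x) p|

/-- The Hamiltonian, rescaled so that the absolute values of its Pauli coefficients sum to 1. -/
noncomputable def normHam (N m : ℕ) (μ x : ℝ) : Matrix (Conf N m) (Conf N m) ℂ :=
  (((pauliNorm N m μ x)⁻¹ : ℝ) : ℂ) • schwinger N m μ x

/-- The block encoding state `∑ √|α_i| |i⟩`, where the `α_i` are the Pauli coefficients of the
rescaled Hamiltonian. -/
noncomputable def stateG (N m : ℕ) (μ x : ℝ) : Aux N m → ℂ := fun p =>
  ((Real.sqrt |pauliCoeff (normHam N m μ x) p| : ℝ) : ℂ)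

/-- The block encoding state `∑ sgn(α_i) √|α_i| |i⟩`. -/
noncomputable def stateGt (N m : ℕ) (μ x : ℝ) : Aux N m → ℂ := fun p =>
  ((Real.sign (pauliCoeff (normHam N m μ x) p) *
    Real.sqrt |pauliCoeff (normHam N m μ x) p| : ℝ) : ℂ)

/-- The block encoding unitary `∑ |i⟩⟨i| ⊗ P_i` on system and auxiliary register. -/
noncomputable def blockU (N m : ℕ) :
    Matrix (Conf N m × Aux N m) (Conf N m × Aux N m) ℂ :=
  Matrix.of fun a b => if a.2 = b.2 then pauli b.2 a.1 b.1 else 0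

/-- `e^{2iφΠ}` for `Π = |v⟩⟨v|` on the auxiliary register, tensored with the identity on the
system. -/
noncomputable def auxRotation {N m : ℕ} (v : Aux N m → ℂ) (φ : ℝ) :
    Matrix (Conf N m × Aux N m) (Conf N m × Aux N m) ℂ :=
  (1 : Matrix (Conf N m) (Conf N m) ℂ) ⊗ₖ
    NormedSpace.exp ((2 * Complex.I * (φ : ℂ)) • Matrix.vecMulVec v (star v))

/-! ### The registers and the measurement circuit -/

/-- All wires: the system, the two halves `x` and `z` of the auxiliary register, `w` ancillas and
one qubit for the rotations `Π_φ`. -/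
abbrev Wire (N m w : ℕ) : Type := Qubit N m ⊕ Qubit N m ⊕ Qubit N m ⊕ Fin w ⊕ Unit

/-- The rotation qubit. -/
def rotWire (N m w : ℕ) : Wire N m w := Sum.inr (Sum.inr (Sum.inr (Sum.inr ())))

/-- The state of all wires in which system and auxiliary register are in the joint state `Ψ`, all
ancillas are 0 and the rotation qubit is in the basis state `b`. -/
def embed {N m w : ℕ} (b : Bool) (Ψ : Conf N m × Aux N m → ℂ) : (Wire N m w → Bool) → ℂ := fun c =>
  if (∀ i : Fin w, c (Sum.inr (Sum.inr (Sum.inr (Sum.inl i)))) = false) ∧ c (rotWire N m w) = b then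
    Ψ (fun q => c (Sum.inl q),
      (fun q => c (Sum.inr (Sum.inl q)), fun q => c (Sum.inr (Sum.inr (Sum.inl q)))))
  else 0

/-- The product state `ψ ⊗ v` of system and auxiliary register. -/
def tensor {N m : ℕ} (ψ : Conf N m → ℂ) (v : Aux N m → ℂ) : Conf N m × Aux N m → ℂ :=
  fun a => ψ a.1 * v a.2

/-- The all-zero state of the auxiliary register. -/
def auxZero (N m : ℕ) : Aux N m → ℂ := Pi.single (fun _ => false, fun _ => false) 1

/-- The circuit `c` prepares the auxiliary state `v` from the all-zero state. The ancillas are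
returned to 0, and nothing happens to the system and the rotation qubit. -/
def Prepares {N m w : ℕ} (c : Circuit (Wire N m w)) (v : Aux N m → ℂ) : Prop :=
  ∀ (b : Bool) (ψ : Conf N m → ℂ),
    c.mat *ᵥ embed b (tensor ψ (auxZero N m)) = embed b (tensor ψ v)

/-- With clean ancillas, which it returns clean, and with the rotation qubit in the basis state
`b`, the circuit `c` applies the operator `A b` to system and auxiliary register. -/
def Implements {N m w : ℕ} (c : Circuit (Wire N m w))
    (A : Bool → Matrix (Conf N m × Aux N m) (Conf N m × Aux N m) ℂ) : Prop :=
  ∀ (b : Bool) (Ψ : Conf N m × Aux N m → ℂ), c.mat *ᵥ embed b Ψ = embed b (A b *ᵥ Ψ)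

/-- The first `k` steps of the QSVT sequence: alternately `U` followed by a rotation about the
second block encoding state, and the inverse of `U` followed by a rotation about the first one.
The angles are listed in the order of application. -/
def qsvtSteps {ι : Type} (U : Circuit ι) (R Rt : ℝ → Circuit ι) (φ : ℕ → ℝ) : ℕ → Circuit ι
  | 0 => []
  | k + 1 => qsvtSteps U R Rt φ k ++ (if Even k then U ++ Rt (φ k) else U.inv ++ R (φ k))

/-- The circuit of one measurement shot, between the preparation of the reference state on the
system and the final measurement: prepare `G`, run `k` QSVT steps, and undo `G` (for `k` even) or
the second preparation `Gt` (for `k` odd). For `k` even the rotation qubit `p` is put into the state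
`(|0⟩ + |1⟩)/√2` at the start, and this is undone at the end. -/
def shot {ι : Type} (p : ι) (G Gt U : Circuit ι) (R Rt : ℝ → Circuit ι) (φ : ℕ → ℝ) (k : ℕ) :
    Circuit ι :=
  (if Even k then [Gate.h p] else []) ++ G ++ qsvtSteps U R Rt φ k ++
    (if Even k then G.inv ++ [Gate.h p] else Gt.inv)

/-! Pauli operators square to the identity, so `blockU` is a self-inverse unitary. The entrywise
product of `stateG` and `stateGt` is the list of signed coefficients α_i, so contracting `blockU`
between these states, in either order, gives the normalised Hamiltonian H (`blockU_contract`).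
Alternating `blockU` with rotations about the two states is then a quantum singular value
transformation: with ω_j = e^{2iφ_j}, the amplitude after k steps is ⟨ψ|F(H)ψ⟩ for the polynomial F
= `(qspPair 1 ω k).1` (`qsvtSteps_run`, `qsvtSteps_amplitude`).

It remains to choose phases that produce X^k. A polynomial F of the right degree and parity is
reachable whenever some G satisfies |F|² + (1 − x²)|G|² = 1: the phases are peeled off one at a
time, each lowering the degrees by one (`exists_qspPair_eq`). For odd k, F = X^k works: 1 − X^{2k}
is 1 − X² times a product over conjugate pairs of roots of unity in the variable X², and one half of
each pair gives G. For even k this fails, since G would be odd, hence zero at 0, where |G|² has to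
be 1. Instead F = X^k + iB with B real, where 1 − X^{2k} = B² + (1 − X²)D²; forms of this shape are
closed under multiplication and contain all real factors of 1 − X^{2k} (`exists_phases_even`). The
rotation qubit in (|0⟩ + |1⟩)/√2 averages the runs with angles φ and −φ, that is F and its
conjugate, which leaves X^k.

For the circuits, `blockU` costs a bounded number of gates per qubit. The preparations rest on the
structure of the Pauli expansion. A hopping term splits according to the digit r at which the carry
stops; for each link and r its Pauli operators have coefficients of equal modulus, indexed by the
even subsets of the qubits involved. The digit pairs in L² have weights in geometric progression.
Hence only O(Nm) selectors need individually computed amplitudes (`exists_selectCirc`), and every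
link is finished by O(m) gates with the fixed angle π/4 for the branching (`linkCirc_run_digit`,
`linkCirc_run_hop`). The match of amplitudes with coefficients is `termAmp_eq`.

A rotation about a prepared state is a phase on the zero state, conjugated by the preparation
(`rotCirc_implements`). Each building block thus has O(Nm) gates, and m is at most a constant times
log N. -/

/-! ### Action of gates and circuits on states -/

section Circuits

set_option linter.unusedSectionVars false

variable {ι : Type} [Fintype ι] [DecidableEq ι]

/-- The linear action of a gate. -/
noncomputable def Gate.run (g : Gate ι) : ((ι → Bool) → ℂ) →ₗ[ℂ] ((ι → Bool) → ℂ) :=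
  g.mat.mulVecLin

/-- The linear action of a circuit. -/
noncomputable def Circuit.run (C : Circuit ι) : ((ι → Bool) → ℂ) →ₗ[ℂ] ((ι → Bool) → ℂ) :=
  (Circuit.mat C).mulVecLin

/-- The computational basis vectors. -/
noncomputable def ket (c : ι → Bool) : (ι → Bool) → ℂ := Pi.single c 1

theorem Circuit.run_apply (C : Circuit ι) (v : (ι → Bool) → ℂ) : C.run v = C.mat *ᵥ v := rfl

@[simp] theorem Circuit.run_nil (v : (ι → Bool) → ℂ) : Circuit.run ([] : Circuit ι) v = v := by
  simp [Circuit.run, Circuit.mat]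

@[simp] theorem Circuit.run_cons (g : Gate ι) (C : Circuit ι) (v : (ι → Bool) → ℂ) :
    Circuit.run (g :: C) v = Circuit.run C (g.run v) := by
  simp [Circuit.run, Circuit.mat, Gate.run, Matrix.mulVec_mulVec]

@[simp] theorem Circuit.run_append (C D : Circuit ι) (v : (ι → Bool) → ℂ) :
    Circuit.run (C ++ D) v = Circuit.run D (Circuit.run C v) := by
  induction C generalizing v with
  | nil => simp
  | cons g C ih => simp [ih]

theorem ket_apply (c d : ι → Bool) : ket c d = if d = c then 1 else 0 := by
  simp [ket, Pi.single_apply]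

theorem onWire_mulVec (q : ι) (A : Matrix Bool Bool ℂ) (v : (ι → Bool) → ℂ) (c : ι → Bool) :
    (onWire q A *ᵥ v) c = A (c q) false * v (Function.update c q false)
      + A (c q) true * v (Function.update c q true) := by
  have key : ∀ b : ι → Bool, (if c = Function.update b q (c q) then A (c q) (b q) else 0) * v b
      = ∑ t : Bool, if b = Function.update c q t then A (c q) t * v b else 0 := by
    intro b
    by_cases h : c = Function.update b q (c q)
    · have hb : ∀ t, b = Function.update c q t ↔ t = b q := by
        intro t
        constructor
        · intro e; rw [e]; simp
        · rintro rfl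
          rw [h]; simp
      rw [if_pos h]
      simp only [hb]
      simp
    · rw [if_neg h]
      have hb : ∀ t, b ≠ Function.update c q t := by
        intro t e
        apply h
        rw [e]; simp
      simp [hb]
  simp only [Matrix.mulVec, dotProduct, onWire, Matrix.of_apply]
  rw [Finset.sum_congr rfl fun b _ => key b, Finset.sum_comm]
  simp [add_comm]

theorem cnot_run (a q : ι) (h : a ≠ q) (v : (ι → Bool) → ℂ) :
    (Gate.cnot a q h).run v = fun c => v (Function.update c q (xor (c q) (c a))) := by
  funext c
  simp only [Gate.run, Matrix.mulVecLin_apply, Matrix.mulVec, dotProduct, Gate.mat,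
    Matrix.of_apply]
  rw [Finset.sum_eq_single (Function.update c q (xor (c q) (c a)))]
  · rw [if_pos]
    · simp
    · simp [Function.update_of_ne h]
  · intro b _ hb
    rw [if_neg]
    · simp
    · intro e
      apply hb
      rw [e]
      simp [Function.update_of_ne h]
  · simp

theorem onWire_diagonal_mulVec (q : ι) (f : Bool → ℂ) (v : (ι → Bool) → ℂ) :
    onWire q (Matrix.diagonal f) *ᵥ v = fun c => f (c q) * v c := by
  funext c
  rw [onWire_mulVec]
  rcases h : c q
  · rw [← h, Function.update_eq_self, h]; simp
  · rw [← h, Function.update_eq_self, h]; simp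

theorem x_run (q : ι) (v : (ι → Bool) → ℂ) :
    (Gate.x q).run v = fun c => v (Function.update c q (!c q)) := by
  funext c
  simp only [Gate.run, Matrix.mulVecLin_apply, Gate.mat, onWire_mulVec, sigma1, Matrix.of_apply]
  rcases c q <;> simp

theorem phaseMat_mulVec (q : ι) (θ : ℝ) (v : (ι → Bool) → ℂ) :
    onWire q (phaseMat θ) *ᵥ v
      = fun c => (if c q then Complex.exp (θ * Complex.I) else 1) * v c :=
  onWire_diagonal_mulVec q _ v

theorem exp_pi_half : Complex.exp (((Real.pi / 2 : ℝ) : ℂ) * Complex.I) = Complex.I := by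
  push_cast; exact Complex.exp_pi_div_two_mul_I

theorem exp_neg_pi_half :
    Complex.exp (((-(Real.pi / 2) : ℝ) : ℂ) * Complex.I) = -Complex.I := by
  push_cast
  rw [neg_mul, Complex.exp_neg, Complex.exp_pi_div_two_mul_I, Complex.inv_I]

theorem s_run (q : ι) (v : (ι → Bool) → ℂ) :
    (Gate.s q).run v = fun c => (if c q then Complex.I else 1) * v c := by
  rw [← exp_pi_half]; exact phaseMat_mulVec q _ v

theorem sdg_run (q : ι) (v : (ι → Bool) → ℂ) :
    (Gate.sdg q).run v = fun c => (if c q then -Complex.I else 1) * v c := by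
  rw [← exp_neg_pi_half]; exact phaseMat_mulVec q _ v

theorem t_run (q : ι) (v : (ι → Bool) → ℂ) :
    (Gate.t q).run v
      = fun c => (if c q then Complex.exp ((Real.pi / 4 : ℝ) * Complex.I) else 1) * v c :=
  phaseMat_mulVec q _ v

theorem tdg_run (q : ι) (v : (ι → Bool) → ℂ) :
    (Gate.tdg q).run v
      = fun c => (if c q then Complex.exp ((-(Real.pi / 4) : ℝ) * Complex.I) else 1) * v c :=
  phaseMat_mulVec q _ v

theorem rz_run (θ : ℝ) (q : ι) (v : (ι → Bool) → ℂ) :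
    (Gate.rz θ q).run v = fun c => (if c q then Complex.exp ((θ / 2 : ℝ) * Complex.I)
      else Complex.exp (-(θ / 2 : ℝ) * Complex.I)) * v c :=
  onWire_diagonal_mulVec q _ v

theorem h_run (q : ι) (v : (ι → Bool) → ℂ) :
    (Gate.h q).run v = fun c => ((1 / Real.sqrt 2 : ℝ) : ℂ) *
      (v (Function.update c q false)
        + (if c q then -1 else 1) * v (Function.update c q true)) := by
  funext c
  simp only [Gate.run, Matrix.mulVecLin_apply, Gate.mat, onWire_mulVec, sigma1, sigma3,
    Matrix.of_apply, Matrix.smul_apply, Matrix.add_apply, Matrix.diagonal_apply]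
  rcases c q <;> simp <;> ring

/-! ### Unitarity -/

theorem onWire_mul (q : ι) (A B : Matrix Bool Bool ℂ) :
    onWire q A * onWire q B = onWire q (A * B) := by
  apply Matrix.toLin'.injective
  ext1 v
  apply LinearMap.ext
  intro v
  funext c
  simp only [Matrix.toLin'_apply, LinearMap.comp_apply]
  rw [← Matrix.mulVec_mulVec]
  simp only [onWire_mulVec, Matrix.mul_apply, Fintype.sum_bool, Function.update_self,
    Function.update_idem]
  ring

theorem onWire_one (q : ι) : onWire q (1 : Matrix Bool Bool ℂ) = 1 := by
  rw [← Matrix.diagonal_one]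
  apply Matrix.toLin'.injective
  apply LinearMap.ext
  intro v
  funext c
  simp only [Matrix.toLin'_apply, onWire_diagonal_mulVec]
  simp

theorem onWire_conjTranspose (q : ι) (A : Matrix Bool Bool ℂ) :
    (onWire q A)ᴴ = onWire q Aᴴ := by
  ext a b
  simp only [onWire, Matrix.conjTranspose_apply, Matrix.of_apply]
  have : (b = Function.update a q (b q)) ↔ (a = Function.update b q (a q)) := by
    constructor
    · intro h; rw [h]; simp
    · intro h; rw [h]; simp
  simp only [this]
  split_ifs <;> simp

theorem phaseMat_conjTranspose (θ : ℝ) : (phaseMat θ)ᴴ = phaseMat (-θ) := by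
  rw [phaseMat, phaseMat, Matrix.diagonal_conjTranspose]
  congr 1
  funext b
  cases b
  · simp
  · simp [← Complex.exp_conj]

theorem phaseMat_mul_neg (θ : ℝ) : phaseMat θ * phaseMat (-θ) = 1 := by
  rw [phaseMat, phaseMat, Matrix.diagonal_mul_diagonal, ← Matrix.diagonal_one]
  congr 1
  funext b
  cases b
  · simp
  · simp [← Complex.exp_add]

theorem Gate.mat_dagger (g : Gate ι) : g.dagger.mat = g.matᴴ := by
  cases g with
  | x q =>
    simp only [Gate.dagger, Gate.mat, onWire_conjTranspose]
    congr 1; ext a b; cases a <;> cases b <;> simp [sigma1]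
  | h q =>
    simp only [Gate.dagger, Gate.mat, onWire_conjTranspose]
    congr 1; ext a b; cases a <;> cases b <;> simp [sigma1, sigma3]
  | s q => simp only [Gate.dagger, Gate.mat, onWire_conjTranspose, phaseMat_conjTranspose]
  | sdg q => simp only [Gate.dagger, Gate.mat, onWire_conjTranspose, phaseMat_conjTranspose, neg_neg]
  | t q => simp only [Gate.dagger, Gate.mat, onWire_conjTranspose, phaseMat_conjTranspose]
  | tdg q => simp only [Gate.dagger, Gate.mat, onWire_conjTranspose, phaseMat_conjTranspose, neg_neg]
  | rz θ q =>
    simp only [Gate.dagger, Gate.mat, onWire_conjTranspose, Matrix.diagonal_conjTranspose]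
    congr 2; funext b; cases b <;> simp [← Complex.exp_conj, neg_div, map_ofNat]
  | cnot a q h =>
    ext b c
    simp only [Gate.dagger, Gate.mat, Matrix.conjTranspose_apply, Matrix.of_apply]
    have : (c = Function.update b q (xor (b q) (b a))) ↔
        (b = Function.update c q (xor (c q) (c a))) := by
      constructor
      · intro e; rw [e]; simp [Function.update_of_ne h]
      · intro e; rw [e]; simp [Function.update_of_ne h]
    simp only [this]
    split_ifs <;> simp

theorem Gate.mat_mul_dagger (g : Gate ι) : g.mat * g.dagger.mat = 1 := by
  cases g with
  | x q =>
    simp only [Gate.dagger, Gate.mat, onWire_mul]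
    convert onWire_one q using 2
    ext a b; cases a <;> cases b <;> simp [sigma1, Matrix.mul_apply]
  | h q =>
    simp only [Gate.dagger, Gate.mat, onWire_mul]
    convert onWire_one q using 2
    have h2 : ((Real.sqrt 2 : ℝ) : ℂ) * ((Real.sqrt 2 : ℝ) : ℂ) = 2 := by
      rw [← Complex.ofReal_mul, Real.mul_self_sqrt (by norm_num)]; norm_num
    have h0 : ((Real.sqrt 2 : ℝ) : ℂ) ≠ 0 := by
      intro h; rw [h] at h2; norm_num at h2
    ext a b
    cases a <;> cases b <;> simp [sigma1, sigma3, Matrix.mul_apply] <;> field_simp <;>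
      linear_combination -h2
  | s q =>
    simp only [Gate.dagger, Gate.mat, onWire_mul, phaseMat_mul_neg, onWire_one]
  | sdg q =>
    have := phaseMat_mul_neg (-(Real.pi / 2))
    rw [neg_neg] at this
    simp only [Gate.dagger, Gate.mat, onWire_mul, this, onWire_one]
  | t q =>
    simp only [Gate.dagger, Gate.mat, onWire_mul, phaseMat_mul_neg, onWire_one]
  | tdg q =>
    have := phaseMat_mul_neg (-(Real.pi / 4))
    rw [neg_neg] at this
    simp only [Gate.dagger, Gate.mat, onWire_mul, this, onWire_one]
  | rz θ q =>
    simp only [Gate.dagger, Gate.mat, onWire_mul, Matrix.diagonal_mul_diagonal]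
    rw [← onWire_one q, ← Matrix.diagonal_one]
    congr 2; funext b; cases b <;> simp [← Complex.exp_add, neg_div]
  | cnot a q h =>
    apply Matrix.toLin'.injective
    apply LinearMap.ext
    intro v
    have := cnot_run a q h
    simp only [Gate.run, Matrix.mulVecLin_apply] at this
    simp only [Matrix.toLin'_apply, Gate.dagger]
    rw [← Matrix.mulVec_mulVec, this, this]
    funext c
    simp [Function.update_of_ne h]

theorem Circuit.mat_append (C D : Circuit ι) :
    Circuit.mat (C ++ D) = Circuit.mat D * Circuit.mat C := by
  induction C with
  | nil => simp [Circuit.mat]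
  | cons g C ih => simp [Circuit.mat, ih, Matrix.mul_assoc]

theorem Circuit.mat_inv (C : Circuit ι) : (Circuit.inv C).mat = (Circuit.mat C)ᴴ := by
  induction C with
  | nil => simp [Circuit.inv, Circuit.mat]
  | cons g C ih =>
    have : Circuit.inv (g :: C) = Circuit.inv C ++ [g.dagger] := by simp [Circuit.inv]
    rw [this, Circuit.mat_append, ih]
    simp [Circuit.mat, Gate.mat_dagger]

theorem Circuit.mat_mul_inv (C : Circuit ι) : Circuit.mat C * (Circuit.inv C).mat = 1 := by
  rw [Circuit.mat_inv]
  induction C with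
  | nil => simp [Circuit.mat]
  | cons g C ih =>
    have hg := g.mat_mul_dagger
    rw [Gate.mat_dagger] at hg
    rw [Circuit.mat, Matrix.conjTranspose_mul, Matrix.mul_assoc, ← Matrix.mul_assoc g.mat, hg,
      Matrix.one_mul, ih]

theorem Circuit.run_run_inv (C : Circuit ι) (v : (ι → Bool) → ℂ) :
    C.run ((Circuit.inv C).run v) = v := by
  rw [Circuit.run_apply, Circuit.run_apply, Matrix.mulVec_mulVec, Circuit.mat_mul_inv,
    Matrix.one_mulVec]

theorem Circuit.run_inv_run (C : Circuit ι) (v : (ι → Bool) → ℂ) :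
    (Circuit.inv C).run (C.run v) = v := by
  rw [Circuit.run_apply, Circuit.run_apply, Matrix.mulVec_mulVec,
    mul_eq_one_comm.mp (Circuit.mat_mul_inv C), Matrix.one_mulVec]

/-- Moves a final inverse preparation to the other side of an amplitude, so that only the forward
action of the preparation has to be known. -/
theorem Circuit.dotProduct_run_inv (C : Circuit ι) (v w : (ι → Bool) → ℂ) :
    star v ⬝ᵥ (Circuit.inv C).run w = star (C.run v) ⬝ᵥ w := by
  rw [Circuit.run_apply, Circuit.run_apply, Circuit.mat_inv, Matrix.star_mulVec,
    Matrix.dotProduct_mulVec]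

theorem Circuit.length_inv (C : Circuit ι) : (Circuit.inv C).length = C.length := by
  simp [Circuit.inv]

end Circuits

/-! ### Derived gates -/

section DerivedGates

variable {ι : Type} [DecidableEq ι]

/-- The CNOT gate, without a proof that the wires differ. -/
def cx (a b : ι) : Circuit ι := if h : a ≠ b then [Gate.cnot a b h] else []

/-- The controlled phase gate `diag(1, 1, 1, i)`. -/
def cs (a b : ι) : Circuit ι := [Gate.t a, Gate.t b] ++ cx a b ++ [Gate.tdg b] ++ cx a b

/-- The controlled phase gate `diag(1, 1, 1, -i)`. -/
def csdg (a b : ι) : Circuit ι := [Gate.tdg a, Gate.tdg b] ++ cx a b ++ [Gate.t b] ++ cx a b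

/-- The controlled sign gate. -/
def cz (a b : ι) : Circuit ι := cs a b ++ cs a b

/-- The doubly controlled sign gate. -/
def ccz (a b t : ι) : Circuit ι := cs b t ++ cx a b ++ csdg b t ++ cx a b ++ cs a t

/-- The Toffoli gate. -/
def ccx (a b t : ι) : Circuit ι := [Gate.h t] ++ ccz a b t ++ [Gate.h t]

/-- The rotation by `θ / 2` in the real plane. -/
def ry (θ : ℝ) (q : ι) : Circuit ι := [Gate.sdg q, Gate.h q, Gate.rz θ q, Gate.h q, Gate.s q]

/-- The controlled rotation by `θ`, with control `f`, of a wire `q` in the state 0. -/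
def cry (θ : ℝ) (f q : ι) : Circuit ι := ry θ q ++ cx f q ++ ry (-θ) q ++ cx f q

theorem cx_length (a b : ι) : (cx a b).length ≤ 1 := by
  unfold cx; split_ifs <;> simp

theorem cs_length (a b : ι) : (cs a b).length ≤ 5 := by
  have := cx_length a b
  simp only [cs, List.length_append, List.length_cons, List.length_nil]; omega

theorem csdg_length (a b : ι) : (csdg a b).length ≤ 5 := by
  have := cx_length a b
  simp only [csdg, List.length_append, List.length_cons, List.length_nil]; omega

theorem cz_length (a b : ι) : (cz a b).length ≤ 10 := by
  have := cs_length a b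
  simp only [cz, List.length_append]; omega

theorem ccx_length (a b t : ι) : (ccx a b t).length ≤ 19 := by
  have h1 := cx_length a b
  have h2 := cs_length a t
  have h3 := cs_length b t
  have h4 := csdg_length b t
  simp only [ccx, ccz, List.length_append, List.length_cons, List.length_nil]; omega

theorem cry_length (θ : ℝ) (f q : ι) : (cry θ f q).length ≤ 12 := by
  have h1 := cx_length f q
  simp only [cry, ry, List.length_append, List.length_cons, List.length_nil]; omega

variable [Fintype ι]

theorem cx_run {a b : ι} (h : a ≠ b) (v : (ι → Bool) → ℂ) :
    Circuit.run (cx a b) v = fun c => v (Function.update c b (xor (c b) (c a))) := by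
  simp only [cx, dif_pos h, Circuit.run_cons, Circuit.run_nil, cnot_run]

/-- Reversible gates act on functions by precomposition with F, hence on basis vectors by the
inverse of F. For an involution the two agree. -/
theorem run_ket_of_involutive {F : (ι → Bool) → (ι → Bool)} (hF : Function.Involutive F)
    (c : ι → Bool) : (fun d => ket c (F d)) = ket (F c) := by
  funext d
  simp only [ket_apply]
  congr 1
  exact propext hF.eq_iff

theorem cx_run_ket {a b : ι} (h : a ≠ b) (c : ι → Bool) :
    Circuit.run (cx a b) (ket c) = ket (Function.update c b (xor (c b) (c a))) := by
  rw [cx_run h]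
  refine run_ket_of_involutive (F := fun c => Function.update c b (xor (c b) (c a))) ?_ c
  intro d
  simp [Function.update_of_ne h]

theorem x_run_ket (q : ι) (c : ι → Bool) :
    (Gate.x q).run (ket c) = ket (Function.update c q (!c q)) := by
  rw [x_run]
  refine run_ket_of_involutive (F := fun c => Function.update c q (!c q)) ?_ c
  intro d
  simp

theorem diag_ket (ph : (ι → Bool) → ℂ) (c : ι → Bool) :
    (fun d => ph d * ket c d) = ph c • ket c := by
  funext d
  simp only [ket_apply, Pi.smul_apply, smul_eq_mul]
  split_ifs with h
  · rw [h]
  · simp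

theorem exp_pi_four_mul_self : Complex.exp ((Real.pi / 4 : ℝ) * Complex.I) *
    Complex.exp ((Real.pi / 4 : ℝ) * Complex.I) = Complex.I := by
  rw [← Complex.exp_add]
  refine Eq.trans ?_ exp_pi_half
  congr 1
  push_cast
  ring

theorem exp_pi_four_mul_neg : Complex.exp ((Real.pi / 4 : ℝ) * Complex.I) *
    Complex.exp ((-(Real.pi / 4) : ℝ) * Complex.I) = 1 := by
  rw [← Complex.exp_add]
  simp

theorem exp_neg_pi_four_mul_self : Complex.exp ((-(Real.pi / 4) : ℝ) * Complex.I) *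
    Complex.exp ((-(Real.pi / 4) : ℝ) * Complex.I) = -Complex.I := by
  rw [← Complex.exp_add]
  refine Eq.trans ?_ exp_neg_pi_half
  congr 1
  push_cast
  ring

/-- For bits, a + b − (a ⊕ b) = 2ab, so the three T phases e^{±iπ/4} combine to i^{ab}. -/
theorem cs_run {a b : ι} (h : a ≠ b) (v : (ι → Bool) → ℂ) :
    Circuit.run (cs a b) v = fun c => (if c a && c b then Complex.I else 1) * v c := by
  have h1 := exp_pi_four_mul_self
  have h2 := exp_pi_four_mul_neg
  simp only [cs, Circuit.run_append, Circuit.run_cons, Circuit.run_nil, t_run, tdg_run, cx_run h]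
  generalize Complex.exp ((Real.pi / 4 : ℝ) * Complex.I) = E at *
  generalize Complex.exp ((-(Real.pi / 4) : ℝ) * Complex.I) = E' at *
  funext c
  simp only [Function.update_self, Function.update_of_ne h, Function.update_idem]
  rcases hca : c a <;> rcases hcb : c b <;> simp
  · rw [← hcb]; simp
  · rw [← hcb]; simp only [Function.update_eq_self]; linear_combination (v c) * h2
  · rw [← hcb]; simp only [Function.update_eq_self]; linear_combination (v c) * h2
  · rw [← hcb]; simp only [Function.update_eq_self]; linear_combination (v c) * h1

theorem csdg_run {a b : ι} (h : a ≠ b) (v : (ι → Bool) → ℂ) :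
    Circuit.run (csdg a b) v = fun c => (if c a && c b then -Complex.I else 1) * v c := by
  have h1 := exp_neg_pi_four_mul_self
  have h2 := exp_pi_four_mul_neg
  simp only [csdg, Circuit.run_append, Circuit.run_cons, Circuit.run_nil, t_run, tdg_run, cx_run h]
  generalize Complex.exp ((Real.pi / 4 : ℝ) * Complex.I) = E at *
  generalize Complex.exp ((-(Real.pi / 4) : ℝ) * Complex.I) = E' at *
  funext c
  simp only [Function.update_self, Function.update_of_ne h, Function.update_idem]
  rcases hca : c a <;> rcases hcb : c b <;> simp
  · rw [← hcb]; simp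
  · rw [← hcb]; simp only [Function.update_eq_self]; linear_combination (v c) * h2
  · rw [← hcb]; simp only [Function.update_eq_self]; linear_combination (v c) * h2
  · rw [← hcb]; simp only [Function.update_eq_self]; linear_combination (v c) * h1

theorem cz_run {a b : ι} (h : a ≠ b) (v : (ι → Bool) → ℂ) :
    Circuit.run (cz a b) v = fun c => (if c a && c b then -1 else 1) * v c := by
  simp only [cz, Circuit.run_append, cs_run h]
  funext c
  split_ifs
  · rw [← mul_assoc, Complex.I_mul_I]
  · simp

/-- The same identity one level up: the exponent of i is t(a + b − (a ⊕ b)) = 2abt. -/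
theorem ccz_run {a b t : ι} (hab : a ≠ b) (hat : a ≠ t) (hbt : b ≠ t) (v : (ι → Bool) → ℂ) :
    Circuit.run (ccz a b t) v = fun c => (if c a && c b && c t then -1 else 1) * v c := by
  simp only [ccz, Circuit.run_append, cs_run hbt, csdg_run hbt, cs_run hat, cx_run hab]
  funext c
  simp only [Function.update_self, Function.update_of_ne hab, Function.update_idem,
    Function.update_of_ne hbt.symm]
  have hI := Complex.I_mul_I
  rcases hca : c a <;> rcases hcb : c b <;> rcases hct : c t <;> simp <;> rw [← hcb] <;> simp
  · linear_combination (-(v c)) * hI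
  · linear_combination (-(v c)) * hI
  · linear_combination (v c) * hI

theorem ccx_run {a b t : ι} (hab : a ≠ b) (hat : a ≠ t) (hbt : b ≠ t) (v : (ι → Bool) → ℂ) :
    Circuit.run (ccx a b t) v
      = fun c => v (Function.update c t (xor (c t) (c a && c b))) := by
  have h2 : ((1 / Real.sqrt 2 : ℝ) : ℂ) * ((1 / Real.sqrt 2 : ℝ) : ℂ) = 1 / 2 := by
    rw [← Complex.ofReal_mul, div_mul_div_comm, Real.mul_self_sqrt (by norm_num)]; norm_num
  simp only [ccx, Circuit.run_append, Circuit.run_cons, Circuit.run_nil, h_run,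
    ccz_run hab hat hbt]
  generalize ((1 / Real.sqrt 2 : ℝ) : ℂ) = r at *
  funext c
  simp only [Function.update_self, Function.update_of_ne hat, Function.update_of_ne hbt,
    Function.update_idem]
  rcases hca : c a <;> rcases hcb : c b <;> rcases hct : c t <;> simp <;>
    generalize v (Function.update c t true) = p <;> generalize v (Function.update c t false) = q
  · linear_combination 2 * q * h2
  · linear_combination 2 * p * h2
  · linear_combination 2 * q * h2
  · linear_combination 2 * p * h2
  · linear_combination 2 * q * h2
  · linear_combination 2 * p * h2
  · linear_combination 2 * p * h2
  · linear_combination 2 * q * h2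

theorem ccx_run_ket {a b t : ι} (hab : a ≠ b) (hat : a ≠ t) (hbt : b ≠ t) (c : ι → Bool) :
    Circuit.run (ccx a b t) (ket c)
      = ket (Function.update c t (xor (c t) (c a && c b))) := by
  rw [ccx_run hab hat hbt]
  refine run_ket_of_involutive
    (F := fun c => Function.update c t (xor (c t) (c a && c b))) ?_ c
  intro d
  simp [Function.update_of_ne hat, Function.update_of_ne hbt]

theorem ry_run (θ : ℝ) (q : ι) (v : (ι → Bool) → ℂ) :
    Circuit.run (ry θ q) v = fun c =>
      if c q then Real.sin (θ / 2) * v (Function.update c q false)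
          + Real.cos (θ / 2) * v (Function.update c q true)
        else Real.cos (θ / 2) * v (Function.update c q false)
          - Real.sin (θ / 2) * v (Function.update c q true) := by
  have h2 : ((1 / Real.sqrt 2 : ℝ) : ℂ) * ((1 / Real.sqrt 2 : ℝ) : ℂ) = 1 / 2 := by
    rw [← Complex.ofReal_mul, div_mul_div_comm, Real.mul_self_sqrt (by norm_num)]; norm_num
  simp only [ry, Circuit.run_cons, Circuit.run_nil, h_run, s_run, sdg_run, rz_run]
  generalize ((1 / Real.sqrt 2 : ℝ) : ℂ) = r at *
  funext c
  have e1 : Complex.exp ((θ / 2 : ℝ) * Complex.I)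
      = Real.cos (θ / 2) + Real.sin (θ / 2) * Complex.I := by
    rw [Complex.exp_mul_I, Complex.ofReal_cos, Complex.ofReal_sin]
  have e2 : Complex.exp (-(θ / 2 : ℝ) * Complex.I)
      = Real.cos (θ / 2) - Real.sin (θ / 2) * Complex.I := by
    rw [Complex.exp_mul_I, Complex.cos_neg, Complex.sin_neg, Complex.ofReal_cos,
      Complex.ofReal_sin]
    ring
  rw [e1, e2]
  simp only [Function.update_self, Function.update_idem]
  have hI := Complex.I_mul_I
  rcases hct : c q <;> simp <;>
    generalize v (Function.update c q true) = p <;>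
    generalize v (Function.update c q false) = u <;>
    generalize Complex.cos ((θ : ℂ) / 2) = C <;> generalize Complex.sin ((θ : ℂ) / 2) = S
  · linear_combination (2 * C * u + 2 * S * Complex.I * Complex.I * p) * h2 + S * p * hI
  · linear_combination (-2 * C * p * Complex.I * Complex.I - 2 * S * Complex.I * Complex.I * u) * h2
      - (S * u + C * p) * hI

/-- Conjugation by X reverses a rotation of the real plane, so the two half rotations by θ/2 add up
when the CNOTs fire; otherwise they cancel. -/
theorem cry_run_of_control {θ : ℝ} {f q : ι} (h : f ≠ q) {c : ι → Bool} (hf : c f = true)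
    (hq : c q = false) : Circuit.run (cry θ f q) (ket c)
      = (Real.cos θ : ℂ) • ket c + (Real.sin θ : ℂ) • ket (Function.update c q true) := by
  have hc := Real.cos_sq_add_sin_sq (θ / 2)
  have e1 : (Real.cos θ : ℂ) = Real.cos (θ / 2) ^ 2 - Real.sin (θ / 2) ^ 2 := by
    have : Real.cos θ = Real.cos (θ / 2) ^ 2 - Real.sin (θ / 2) ^ 2 := by
      have := Real.cos_two_mul (θ / 2)
      rw [mul_div_cancel₀ _ (two_ne_zero)] at this
      linarith
    rw [this]; push_cast; ring
  have e2 : (Real.sin θ : ℂ) = 2 * Real.sin (θ / 2) * Real.cos (θ / 2) := by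
    have := Real.sin_two_mul (θ / 2)
    rw [mul_div_cancel₀ _ (two_ne_zero)] at this
    rw [this]; push_cast; ring
  rw [e1, e2]
  simp only [cry, Circuit.run_append, cx_run h, ry_run]
  funext d
  simp only [Function.update_self, Function.update_of_ne h, Function.update_idem, neg_div,
    Real.cos_neg, Real.sin_neg, Pi.add_apply, Pi.smul_apply, smul_eq_mul, ket_apply]
  have hcf : Function.update c q false = c := by rw [← hq]; simp
  by_cases hd : ∃ t, d = Function.update c q t
  · obtain ⟨t, rfl⟩ := hd
    have hne : Function.update c q true ≠ c := by
      intro e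
      have := congrFun e q
      simp [hq] at this
    have hne' : c ≠ Function.update c q true := hne.symm
    simp only [Function.update_self, Function.update_idem, Function.update_of_ne h, hf, hcf]
    cases t <;> simp [hcf, hne, hne'] <;> ring
  · have hd' : ∀ t, Function.update d q t ≠ c := by
      intro t e
      apply hd
      exact ⟨d q, by rw [← e]; simp⟩
    have hd2 : d ≠ c := fun e => hd ⟨d q, by rw [e]; simp⟩
    have hd3 : d ≠ Function.update c q true := fun e => hd ⟨_, e⟩
    simp [hd', hd2, hd3]

theorem cry_run_of_not_control {θ : ℝ} {f q : ι} (h : f ≠ q) {c : ι → Bool} (hf : c f = false) :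
    Circuit.run (cry θ f q) (ket c) = ket c := by
  simp only [cry, Circuit.run_append, cx_run h, ry_run]
  funext d
  simp only [Function.update_self, Function.update_of_ne h, Function.update_idem, neg_div,
    Real.cos_neg, Real.sin_neg]
  have hc : ((Real.cos (θ / 2) : ℝ) : ℂ) ^ 2 + ((Real.sin (θ / 2) : ℝ) : ℂ) ^ 2 = 1 := by
    rw [← Complex.ofReal_pow, ← Complex.ofReal_pow, ← Complex.ofReal_add,
      Real.cos_sq_add_sin_sq, Complex.ofReal_one]
  generalize ((Real.cos (θ / 2) : ℝ) : ℂ) = C at *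
  by_cases hdf : d f = false
  · simp only [hdf]
    rcases hdq : d q
    · simp only [Bool.xor_false, Bool.false_eq_true, if_false, if_true, Complex.ofReal_neg]
      have : Function.update d q false = d := by rw [← hdq]; simp
      rw [this]
      linear_combination (ket c d) * hc
    · simp only [Bool.xor_false, Bool.false_eq_true, if_false, if_true, Complex.ofReal_neg]
      have : Function.update d q true = d := by rw [← hdq]; simp
      rw [this]
      linear_combination (ket c d) * hc
  · have hd' : ∀ t, ket c (Function.update d q t) = 0 := by
      intro t
      rw [ket_apply, if_neg]
      intro e
      apply hdf
      rw [← hf, ← e, Function.update_of_ne h]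
    have hd2 : ket c d = 0 := by have := hd' (d q); simpa using this
    simp [hd', hd2]

end DerivedGates

/-! ### Branching circuits -/

section Branching

set_option linter.unusedSectionVars false

variable {ι : Type} [DecidableEq ι]

/-- Sequential choice of one wire of a list: while the flag `f` is set, each wire is rotated by its
angle, and the flag is cleared once a wire has been chosen. -/
def chain (f : ι) (L : List (ι × ℝ)) : Circuit ι :=
  L.flatMap fun p => cry p.2 f p.1 ++ cx p.1 f

/-- Add the parity of a list of wires to the wire `f`. -/
def parityCirc (f : ι) (L : List ι) : Circuit ι := L.flatMap fun q => cx q f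

/-- The wires `q (t - 1), …, q 0`, with the angle `π / 4`. -/
noncomputable def halvingList (q : ℕ → ι) (t : ℕ) : List (ι × ℝ) :=
  (List.range t).reverse.map fun j => (q j, Real.pi / 4)

/-- Copy the wire `q t` to the wires `q (t - 1), …, q 0`, one after the other. -/
def fillDown (q : ℕ → ι) (t : ℕ) : Circuit ι :=
  (List.range t).reverse.flatMap fun j => cx (q (j + 1)) (q j)

/-- For each pair of a control and a target, branch on the target and add it to the wire `zr`. -/
noncomputable def evenBranch (zr : ι) (P : List (ι × ι)) : Circuit ι :=
  P.flatMap fun p => cry (Real.pi / 4) p.1 p.2 ++ ccx p.1 p.2 zr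

theorem length_flatMap_le {α β : Type*} (L : List α) (f : α → List β) (k : ℕ)
    (h : ∀ x ∈ L, (f x).length ≤ k) : (L.flatMap f).length ≤ L.length * k := by
  induction L with
  | nil => simp
  | cons a L ih =>
    have h1 := h a (by simp)
    have h2 := ih fun x hx => h x (by simp [hx])
    simp only [List.flatMap_cons, List.length_append, List.length_cons, Nat.succ_mul]
    omega

theorem chain_length (f : ι) (L : List (ι × ℝ)) : (chain f L).length ≤ L.length * 13 := by
  refine length_flatMap_le _ _ _ fun p _ => ?_
  have h1 := cry_length p.2 f p.1
  have h2 := cx_length p.1 f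
  rw [List.length_append]; omega

theorem parityCirc_length (f : ι) (L : List ι) : (parityCirc f L).length ≤ L.length :=
  (length_flatMap_le L (fun q => cx q f) 1 fun p _ => cx_length p f).trans (by simp)

theorem fillDown_length (q : ℕ → ι) (t : ℕ) : (fillDown q t).length ≤ t :=
  (length_flatMap_le (List.range t).reverse (fun j => cx (q (j + 1)) (q j)) 1
    fun p _ => cx_length _ _).trans (by simp)

theorem evenBranch_length (zr : ι) (P : List (ι × ι)) :
    (evenBranch zr P).length ≤ P.length * 31 := by
  refine length_flatMap_le _ _ _ fun p _ => ?_
  have h1 := cry_length (Real.pi / 4) p.1 p.2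
  have h2 := ccx_length p.1 p.2 zr
  rw [List.length_append]; omega

variable [Fintype ι]

theorem run_flatMap_of_fixed {α : Type*} (L : List α) (g : α → Circuit ι) (v : (ι → Bool) → ℂ)
    (h : ∀ x ∈ L, Circuit.run (g x) v = v) : Circuit.run (L.flatMap g) v = v := by
  induction L with
  | nil => simp
  | cons a L ih =>
    rw [List.flatMap_cons, Circuit.run_append, h a (by simp)]
    exact ih fun x hx => h x (by simp [hx])

/-- For a sequence of blocks of which only one is active: the others must ignore the input as well
as the output of the active block, since they come before and after it. -/
theorem run_flatMap_of_mem {α : Type*} (L : List α) (hL : L.Nodup) (g : α → Circuit ι)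
    (v : (ι → Bool) → ℂ) (a : α) (ha : a ∈ L)
    (h : ∀ x ∈ L, x ≠ a → Circuit.run (g x) v = v)
    (h' : ∀ x ∈ L, x ≠ a → Circuit.run (g x) (Circuit.run (g a) v) = Circuit.run (g a) v) :
    Circuit.run (L.flatMap g) v = Circuit.run (g a) v := by
  induction L with
  | nil => simp at ha
  | cons b L ih =>
    rw [List.flatMap_cons, Circuit.run_append]
    rw [List.nodup_cons] at hL
    by_cases hb : b = a
    · subst hb
      refine run_flatMap_of_fixed _ _ _ fun x hx => h' x (by simp [hx]) ?_
      rintro rfl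
      exact hL.1 hx
    · rw [h b (by simp) hb]
      have : a ∈ L := by simpa [Ne.symm hb] using ha
      exact ih hL.2 this (fun x hx => h x (by simp [hx])) fun x hx => h' x (by simp [hx])

theorem cx_run_ket_of_false {a b : ι} (h : a ≠ b) {c : ι → Bool} (hc : c a = false) :
    Circuit.run (cx a b) (ket c) = ket c := by
  rw [cx_run_ket h, hc]; simp

theorem ccx_run_ket_of_false {a b t : ι} (hab : a ≠ b) (hat : a ≠ t) (hbt : b ≠ t) {c : ι → Bool}
    (hc : c a = false) : Circuit.run (ccx a b t) (ket c) = ket c := by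
  rw [ccx_run_ket hab hat hbt, hc]; simp

theorem chain_run_of_flag_false (f : ι) (L : List (ι × ℝ)) {c : ι → Bool} (hf : c f = false)
    (hL : ∀ p ∈ L, p.1 ≠ f ∧ c p.1 = false) : Circuit.run (chain f L) (ket c) = ket c := by
  refine run_flatMap_of_fixed _ _ _ fun p hp => ?_
  obtain ⟨h1, h2⟩ := hL p hp
  rw [Circuit.run_append, cry_run_of_not_control h1.symm hf, cx_run_ket_of_false h1 h2]

/-- In the branch where q is chosen, the CNOT clears the flag and the rest of the chain is idle; in
the other branch the chain continues. -/
theorem chain_cons_run (f : ι) (q : ι) (θ : ℝ) (L : List (ι × ℝ)) {c : ι → Bool}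
    (hf : c f = true) (hq : q ≠ f) (hcq : c q = false)
    (hL : ∀ p ∈ L, p.1 ≠ f ∧ p.1 ≠ q ∧ c p.1 = false) :
    Circuit.run (chain f ((q, θ) :: L)) (ket c)
      = (Real.cos θ : ℂ) • Circuit.run (chain f L) (ket c)
        + (Real.sin θ : ℂ) • ket (Function.update (Function.update c q true) f false) := by
  have e : chain f ((q, θ) :: L) = cry θ f q ++ cx q f ++ chain f L := by
    simp [chain]
  rw [e, Circuit.run_append, Circuit.run_append, cry_run_of_control hq.symm hf hcq, map_add,
    map_add, map_smul, map_smul, map_smul, map_smul, cx_run_ket_of_false hq hcq, cx_run_ket hq]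
  have e2 : Function.update (Function.update c q true) f
      (xor (Function.update c q true f) (Function.update c q true q))
      = Function.update (Function.update c q true) f false := by
    rw [Function.update_of_ne hq.symm, hf, Function.update_self]; rfl
  rw [e2, chain_run_of_flag_false f L (c := Function.update (Function.update c q true) f false)
    (by rw [Function.update_self])]
  intro p hp
  obtain ⟨h1, h2, h3⟩ := hL p hp
  refine ⟨h1, ?_⟩
  rw [Function.update_of_ne h1, Function.update_of_ne h2, h3]

/-- A chain with suitable angles prepares an arbitrary real superposition of choices. -/
theorem exists_chain (Q : List ι) (hQ : Q.Nodup) (a : ι → ℝ) (a₀ : ℝ) :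
    ∃ (L : List (ι × ℝ)) (ρ : ℝ), L.map Prod.fst = Q ∧
      ρ ^ 2 = a₀ ^ 2 + (Q.map fun q => a q ^ 2).sum ∧ (Q ≠ [] → 0 ≤ ρ) ∧
      ∀ (f : ι) (c : ι → Bool), c f = true → (∀ q ∈ Q, q ≠ f ∧ c q = false) →
        (ρ : ℂ) • Circuit.run (chain f L) (ket c) = (a₀ : ℂ) • ket c
          + (Q.map fun q => (a q : ℂ) •
              ket (Function.update (Function.update c q true) f false)).sum := by
  induction Q with
  -- With no wire left, ρ = a₀ may be negative; every later ρ is a square root, which is why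
  -- nonnegativity is claimed only for nonempty lists.
  | nil => exact ⟨[], a₀, rfl, by simp, by simp, by simp [chain]⟩
  | cons q Q ih =>
    rw [List.nodup_cons] at hQ
    obtain ⟨L, ρ, hL, hρ, -, hrun⟩ := ih hQ.2
    -- θ is the polar angle of the point (ρ, a q): the cosine carries the amplitude left for the
    -- rest of the chain, the sine the amplitude of q.
    obtain ⟨θ, hcos, hsin⟩ : ∃ θ : ℝ, √(ρ ^ 2 + a q ^ 2) * Real.cos θ = ρ ∧
        √(ρ ^ 2 + a q ^ 2) * Real.sin θ = a q := by
      refine ⟨Complex.arg ⟨ρ, a q⟩, ?_, ?_⟩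
      · have := Complex.norm_mul_cos_arg ⟨ρ, a q⟩
        rwa [Complex.norm_def, Complex.normSq_mk, ← pow_two, ← pow_two] at this
      · have := Complex.norm_mul_sin_arg ⟨ρ, a q⟩
        rwa [Complex.norm_def, Complex.normSq_mk, ← pow_two, ← pow_two] at this
    refine ⟨(q, θ) :: L, √(ρ ^ 2 + a q ^ 2), by simp [hL], ?_, fun _ => Real.sqrt_nonneg _, ?_⟩
    · rw [Real.sq_sqrt (by positivity), hρ, List.map_cons, List.sum_cons]; ring
    · intro f c hf hc
      have hL' : ∀ p ∈ L, p.1 ≠ f ∧ p.1 ≠ q ∧ c p.1 = false := by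
        intro p hp
        have hm : p.1 ∈ Q := by rw [← hL]; exact List.mem_map_of_mem hp
        have := hc p.1 (by simp [hm])
        refine ⟨this.1, ?_, this.2⟩
        rintro e
        exact hQ.1 (e ▸ hm)
      rw [chain_cons_run f q θ L hf (hc q (by simp)).1 (hc q (by simp)).2 hL', smul_add, smul_smul,
        smul_smul, ← Complex.ofReal_mul, ← Complex.ofReal_mul, hcos, hsin,
        hrun f c hf fun p hp => hc p (by simp [hp]), List.map_cons, List.sum_cons]
      abel

theorem parityCirc_run (f : ι) (L : List ι) (hL : ∀ q ∈ L, q ≠ f) (c : ι → Bool) :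
    Circuit.run (parityCirc f L) (ket c)
      = ket (Function.update c f (xor (c f) (decide (Odd (L.countP c))))) := by
  induction L generalizing c with
  | nil => simp [parityCirc]
  | cons q L ih =>
    have e : parityCirc f (q :: L) = cx q f ++ parityCirc f L := by simp [parityCirc]
    have hq := hL q (by simp)
    rw [e, Circuit.run_append, cx_run_ket hq, ih fun p hp => hL p (by simp [hp])]
    have hcount : L.countP (Function.update c f (xor (c f) (c q))) = L.countP c := by
      refine List.countP_congr fun p hp => ?_
      rw [Function.update_of_ne (hL p (by simp [hp]))]
    rw [hcount, Function.update_idem, Function.update_self, List.countP_cons]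
    congr 2
    rcases c q
    · simp
    · simp only [if_true, Nat.odd_add_one]
      rcases c f <;> by_cases ho : Odd (L.countP c) <;> simp [ho]

theorem halving_succ (q : ℕ → ι) (t : ℕ) :
    halvingList q (t + 1) = (q t, Real.pi / 4) :: halvingList q t := by
  simp [halvingList, List.range_succ]

/-- Each rotation by π/4 halves the remaining weight, so going down from t − 1 the choices have
probabilities 1/2, 1/4, and so on, and the last probability also remains for choosing nothing. -/
theorem chain_halving_run (f : ι) (q : ℕ → ι) (t : ℕ) (hqf : ∀ j < t, q j ≠ f)
    (hq : ∀ i < t, ∀ j < t, q i = q j → i = j) {c : ι → Bool} (hf : c f = true)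
    (hc : ∀ j < t, c (q j) = false) :
    Circuit.run (chain f (halvingList q t)) (ket c)
      = ((√2 / 2 : ℝ) : ℂ) ^ t • ket c + ∑ j ∈ Finset.range t, ((√2 / 2 : ℝ) : ℂ) ^ (t - j) •
          ket (Function.update (Function.update c (q j) true) f false) := by
  induction t with
  | zero => simp [halvingList, chain]
  | succ t ih =>
    rw [halving_succ, chain_cons_run f (q t) _ _ hf (hqf t (by omega)) (hc t (by omega)),
      ih (fun j hj => hqf j (by omega)) (fun i hi j hj => hq i (by omega) j (by omega))
        (fun j hj => hc j (by omega)), Real.cos_pi_div_four, Real.sin_pi_div_four,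
      Finset.sum_range_succ, smul_add, smul_smul, Finset.smul_sum, ← pow_succ', add_assoc]
    · congr 2
      · refine Finset.sum_congr rfl fun j hj => ?_
        rw [Finset.mem_range] at hj
        rw [smul_smul, ← pow_succ', Nat.sub_add_comm hj.le]
      · simp
    · intro p hp
      simp only [halvingList, List.mem_map, List.mem_reverse, List.mem_range] at hp
      obtain ⟨j, hj, rfl⟩ := hp
      refine ⟨hqf j (by omega), ?_, hc j (by omega)⟩
      intro e
      have := hq j (by omega) t (by omega) e
      omega

/-- When the wire `q i` is the only one that is set, the halving chain sets one of the lower wires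
or none of them. -/
theorem halving_second_run (f : ι) (q : ℕ → ι) (t i : ℕ) (hi : i < t)
    (hqf : ∀ j < t, q j ≠ f) (hq : ∀ i < t, ∀ j < t, q i = q j → i = j) {c : ι → Bool}
    (hf : c f = false) (hc : ∀ j < t, c (q j) = decide (j = i)) :
    Circuit.run (chain f (halvingList q t)) (ket c)
      = ((√2 / 2 : ℝ) : ℂ) ^ i • ket (Function.update c f true)
        + ∑ j ∈ Finset.range i, ((√2 / 2 : ℝ) : ℂ) ^ (i - j) •
          ket (Function.update c (q j) true) := by
  induction t with
  | zero => omega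
  | succ t ih =>
    have e : chain f (halvingList q (t + 1))
        = cry (Real.pi / 4) f (q t) ++ cx (q t) f ++ chain f (halvingList q t) := by
      rw [halving_succ]; simp [chain]
    have ht := hqf t (by omega)
    rw [e, Circuit.run_append, Circuit.run_append, cry_run_of_not_control ht.symm hf]
    -- Wires above i see a cleared flag and are skipped; the wire q i itself sets the flag, and from
    -- there on the chain is that of `chain_halving_run`.
    by_cases h : i = t
    · subst h
      rw [cx_run_ket ht, hf, hc i (by omega)]
      simp only [decide_true, Bool.xor_true, Bool.not_false]
      rw [chain_halving_run f q i (fun j hj => hqf j (by omega))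
        (fun a ha b hb => hq a (by omega) b (by omega)) (by simp)]
      · congr 1
        refine Finset.sum_congr rfl fun j hj => ?_
        rw [Finset.mem_range] at hj
        congr 2
        rw [Function.update_comm (hqf j (by omega)), Function.update_idem, ← hf,
          Function.update_eq_self]
      · intro j hj
        rw [Function.update_of_ne (hqf j (by omega)), hc j (by omega)]
        simp; omega
    · rw [cx_run_ket_of_false ht (by rw [hc t (by omega)]; simp; omega)]
      exact ih (by omega) (fun j hj => hqf j (by omega))
        (fun a ha b hb => hq a (by omega) b (by omega)) (fun j hj => hc j (by omega))

theorem fillDown_run_of_false (q : ℕ → ι) (t : ℕ) (hq : ∀ i ≤ t, ∀ j ≤ t, q i = q j → i = j)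
    {c : ι → Bool} (hc : ∀ j ≤ t, c (q j) = false) :
    Circuit.run (fillDown q t) (ket c) = ket c := by
  refine run_flatMap_of_fixed _ _ _ fun j hj => ?_
  simp only [List.mem_reverse, List.mem_range] at hj
  refine cx_run_ket_of_false (fun e => ?_) (hc _ (by omega))
  have := hq _ (by omega) _ (by omega) e
  omega

theorem fillDown_run (q : ℕ → ι) (t r : ℕ) (hr : r ≤ t)
    (hq : ∀ i ≤ t, ∀ j ≤ t, q i = q j → i = j)
    {c : ι → Bool} (hc : ∀ j ≤ t, c (q j) = decide (j = r)) :
    Circuit.run (fillDown q t) (ket c)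
      = ket fun w => c w || decide (∃ j < r, w = q j) := by
  induction t generalizing r c with
  | zero =>
    obtain rfl : r = 0 := by omega
    simp [fillDown]
  | succ t ih =>
    have e : fillDown q (t + 1) = cx (q (t + 1)) (q t) ++ fillDown q t := by
      simp [fillDown, List.range_succ]
    have ht : q (t + 1) ≠ q t := fun e => by
      have := hq _ (by omega) _ (by omega) e
      omega
    have hne : ∀ j ≤ t, j ≠ t → q j ≠ q t := fun j hj hjt e => by
      have := hq _ (by omega) _ (by omega) e
      omega
    rw [e, Circuit.run_append, cx_run_ket ht, hc t (by omega), hc (t + 1) le_rfl]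
    -- If the top wire is set, the first CNOT sets q t, and among the remaining wires it is then the
    -- only one set: the induction hypothesis applies with r = t.
    by_cases h : r = t + 1
    · subst h
      rw [ih t le_rfl fun i hi j hj => hq i (by omega) j (by omega)]
      · congr 1
        funext w
        by_cases hw : w = q t
        · subst hw
          simp
          right
          exact ⟨t, by omega, rfl⟩
        · rw [Function.update_of_ne hw]
          congr 2
          apply propext
          constructor
          · rintro ⟨j, hj, rfl⟩; exact ⟨j, by omega, rfl⟩
          · rintro ⟨j, hj, rfl⟩
            refine ⟨j, ?_, rfl⟩
            rcases Nat.lt_succ_iff_lt_or_eq.mp hj with h | h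
            · exact h
            · subst h; exact absurd rfl hw
      · intro j hj
        by_cases hjt : j = t
        · subst hjt; simp
        · rw [Function.update_of_ne (hne j hj hjt), hc j (by omega)]
          simp [hjt]; omega
    · have : (Function.update c (q t) (xor (decide (t = r)) (decide (t + 1 = r)))) = c := by
        rw [decide_eq_false (p := t + 1 = r) (fun e => h e.symm), Bool.xor_false, ← hc t (by omega),
          Function.update_eq_self]
      rw [this]
      exact ih r (by omega) (fun i hi j hj => hq i (by omega) j (by omega))
        fun j hj => hc j (by omega)

theorem evenBranch_run_of_false (zr : ι) (P : List (ι × ι)) {c : ι → Bool}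
    (hP : ∀ p ∈ P, p.1 ≠ p.2 ∧ p.1 ≠ zr ∧ p.2 ≠ zr ∧ c p.1 = false) :
    Circuit.run (evenBranch zr P) (ket c) = ket c := by
  refine run_flatMap_of_fixed _ _ _ fun p hp => ?_
  obtain ⟨h1, h2, h3, h4⟩ := hP p hp
  rw [Circuit.run_append, cry_run_of_not_control h1 h4, ccx_run_ket_of_false h1 h2 h3 h4]

/-- The configuration `c` with the wires in `t` set and the parity of `t` added to `zr`. -/
def withParity (c : ι → Bool) (zr : ι) (t : Finset ι) : ι → Bool := fun w =>
  if w = zr then xor (c zr) (decide (Odd t.card)) else c w || decide (w ∈ t)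

/-- Every pair with a set control branches its target with equal weights, and the Toffoli gate adds
the target to `zr`. So `zr` records the parity of the chosen subset; together with `zr`, started at
0, the chosen sets are exactly the even ones. -/
theorem evenBranch_run (zr : ι) (P : List (ι × ι)) (hP : (P.map Prod.snd).Nodup)
    (h1 : ∀ p ∈ P, ∀ p' ∈ P, p.1 ≠ p'.2) (h2 : ∀ p ∈ P, p.1 ≠ zr ∧ p.2 ≠ zr)
    {c : ι → Bool} (hc : ∀ p ∈ P, c p.2 = false) :
    Circuit.run (evenBranch zr P) (ket c)
      = ((√2 / 2 : ℝ) : ℂ) ^ (((P.filter fun p => c p.1).map Prod.snd).toFinset).card •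
        ∑ t ∈ (((P.filter fun p => c p.1).map Prod.snd).toFinset).powerset,
          ket (withParity c zr t) := by
  induction P generalizing c with
  | nil =>
    simp only [evenBranch, List.flatMap_nil, Circuit.run_nil, List.filter_nil, List.map_nil,
      List.toFinset_nil, Finset.card_empty, pow_zero, one_smul, Finset.powerset_empty,
      Finset.sum_singleton]
    congr 1
    funext w
    simp only [withParity]
    split_ifs with h <;> simp [h]
  | cons p P ih =>
    have e : evenBranch zr (p :: P) = cry (Real.pi / 4) p.1 p.2 ++ ccx p.1 p.2 zr
        ++ evenBranch zr P := by simp [evenBranch]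
    rw [List.map_cons, List.nodup_cons] at hP
    have hpp := h1 p (by simp) p (by simp)
    obtain ⟨hp1, hp2⟩ := h2 p (by simp)
    have ih' := @ih hP.2 (fun a ha b hb => h1 a (by simp [ha]) b (by simp [hb]))
      (fun a ha => h2 a (by simp [ha]))
    rw [e, Circuit.run_append, Circuit.run_append]
    rcases hcp : c p.1
    · rw [cry_run_of_not_control hpp hcp, ccx_run_ket_of_false hpp hp1 hp2 hcp,
        ih' fun a ha => hc a (by simp [ha]), List.filter_cons_of_neg (by simp [hcp])]
    · have hz : c p.2 = false := hc p (by simp)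
      have hnz : ∀ a ∈ P, a.2 ≠ p.2 := fun a ha e => hP.1 (e ▸ List.mem_map_of_mem ha)
      set c' := Function.update (Function.update c p.2 true) zr (!c zr) with hc'
      have e1 : Circuit.run (ccx p.1 p.2 zr) (ket c) = ket c := by
        rw [ccx_run_ket hpp hp1 hp2, hz]; simp
      have e2 : Circuit.run (ccx p.1 p.2 zr) (ket (Function.update c p.2 true)) = ket c' := by
        rw [ccx_run_ket hpp hp1 hp2, Function.update_of_ne hpp, hcp, Function.update_self,
          Function.update_of_ne hp2.symm, hc']
        simp
      have hc1 : ∀ a ∈ P, c' a.1 = c a.1 := by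
        intro a ha
        rw [hc', Function.update_of_ne (h2 a (by simp [ha])).1,
          Function.update_of_ne (h1 a (by simp [ha]) p (by simp))]
      have hc2 : ∀ a ∈ P, c' a.2 = false := by
        intro a ha
        rw [hc', Function.update_of_ne (h2 a (by simp [ha])).2, Function.update_of_ne (hnz a ha)]
        exact hc a (by simp [ha])
      have hfil : (P.filter fun a => c' a.1) = P.filter fun a => c a.1 :=
        List.filter_congr fun a ha => hc1 a ha
      have hmem : p.2 ∉ ((P.filter fun a => c a.1).map Prod.snd).toFinset := by
        simp only [List.mem_toFinset, List.mem_map, List.mem_filter, not_exists, not_and, and_imp]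
        intro a ha _
        exact hnz a ha
      rw [cry_run_of_control hpp hcp hz, map_add, map_add, map_smul, map_smul, map_smul, map_smul,
        e1, e2, ih' fun a ha => hc a (by simp [ha]), ih' hc2, hfil,
        List.filter_cons_of_pos (by simp [hcp]), List.map_cons, List.toFinset_cons,
        Finset.card_insert_of_notMem hmem, Finset.sum_powerset_insert hmem, Real.cos_pi_div_four,
        Real.sin_pi_div_four, smul_smul, smul_smul, ← pow_succ', smul_add]
      congr 2
      refine Finset.sum_congr rfl fun t ht => ?_
      rw [Finset.mem_powerset] at ht
      have hpt : p.2 ∉ t := fun h => hmem (ht h)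
      congr 1
      funext w
      simp only [withParity, hc', Finset.card_insert_of_notMem hpt, Nat.odd_add_one,
        Function.update_self]
      by_cases hw : w = zr
      · simp only [hw, if_true]
        by_cases ho : Odd t.card <;> simp [ho]
      · simp only [hw, if_false, ne_eq, not_false_eq_true, Function.update_of_ne, Finset.mem_insert]
        by_cases hw2 : w = p.2
        · simp [hw2]
        · simp [hw2]

end Branching

/-! ### Quantum signal processing for monomials -/

section SignalProcessing

open Polynomial

/-- The pair of polynomials that describes `k` steps of signal processing with phases `ω`. -/
noncomputable def qspPair (c : ℂ) (ω : ℕ → ℂ) : ℕ → ℂ[X] × ℂ[X]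
  | 0 => (C c, 0)
  | k + 1 => (C (ω k) * (X * (qspPair c ω k).1 + (1 - X ^ 2) * (qspPair c ω k).2),
      (qspPair c ω k).1 - X * (qspPair c ω k).2)

/-- The polynomial has degree at most `d`, and the parity of `d`. -/
def HasParity (p : ℂ[X]) (d : ℕ) : Prop := ∀ n, p.coeff n ≠ 0 → n ≤ d ∧ Even (n + d)

/-- Complex conjugation of the coefficients. -/
noncomputable def conjPoly (p : ℂ[X]) : ℂ[X] := p.map (starRingEnd ℂ)

theorem qspPair_congr {c : ℂ} {ω ω' : ℕ → ℂ} {k : ℕ} (h : ∀ j < k, ω j = ω' j) :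
    qspPair c ω k = qspPair c ω' k := by
  induction k with
  | zero => rfl
  | succ k ih =>
    rw [qspPair, qspPair, ih fun j hj => h j (by omega), h k (by omega)]

/-- The recursion is linear in the pair, so the initial constant factors out; it can later be
absorbed into a phase. -/
theorem qspPair_const (c : ℂ) (ω : ℕ → ℂ) (k : ℕ) :
    qspPair c ω k = (C c * (qspPair 1 ω k).1, C c * (qspPair 1 ω k).2) := by
  induction k with
  | zero => simp [qspPair]
  | succ k ih =>
    rw [qspPair, qspPair, ih]
    ext1 <;> ring

/-- The recursion has real coefficients apart from the phases. This describes the run in which the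
rotation qubit is 1 and all angles change sign. -/
theorem qspPair_conj (ω : ℕ → ℂ) (k : ℕ) :
    qspPair 1 (fun j => (starRingEnd ℂ) (ω j)) k
      = (conjPoly (qspPair 1 ω k).1, conjPoly (qspPair 1 ω k).2) := by
  induction k with
  | zero => simp [qspPair, conjPoly]
  | succ k ih => rw [qspPair, qspPair, ih]; simp [conjPoly]

theorem HasParity.natDegree_le {p : ℂ[X]} {d : ℕ} (h : HasParity p d) : p.natDegree ≤ d := by
  rw [natDegree_le_iff_coeff_eq_zero]
  intro n hn
  by_contra h0
  have := (h n h0).1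
  omega

theorem HasParity.add {p q : ℂ[X]} {d : ℕ} (hp : HasParity p d) (hq : HasParity q d) :
    HasParity (p + q) d := by
  intro n hn
  rw [coeff_add] at hn
  by_cases h : p.coeff n = 0
  · exact hq n (by rwa [h, zero_add] at hn)
  · exact hp n h

theorem HasParity.neg {p : ℂ[X]} {d : ℕ} (hp : HasParity p d) : HasParity (-p) d := by
  intro n hn
  exact hp n (by simpa using hn)

theorem HasParity.sub {p q : ℂ[X]} {d : ℕ} (hp : HasParity p d) (hq : HasParity q d) :
    HasParity (p - q) d := by
  rw [sub_eq_add_neg]; exact hp.add hq.neg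

theorem HasParity.mul {p q : ℂ[X]} {d e : ℕ} (hp : HasParity p d) (hq : HasParity q e) :
    HasParity (p * q) (d + e) := by
  intro n hn
  rw [coeff_mul] at hn
  obtain ⟨⟨i, j⟩, hij, h⟩ := Finset.exists_ne_zero_of_sum_ne_zero hn
  rw [Finset.HasAntidiagonal.mem_antidiagonal] at hij
  obtain ⟨h1, h2⟩ := hp i (left_ne_zero_of_mul h)
  obtain ⟨h3, h4⟩ := hq j (right_ne_zero_of_mul h)
  simp only at hij
  refine ⟨by omega, ?_⟩
  obtain ⟨a, ha⟩ := h2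
  obtain ⟨b, hb⟩ := h4
  exact ⟨a + b, by omega⟩

theorem HasParity.add_two {p : ℂ[X]} {d : ℕ} (hp : HasParity p d) : HasParity p (d + 2) := by
  intro n hn
  obtain ⟨h1, h2⟩ := hp n hn
  exact ⟨by omega, h2.add even_two⟩

theorem hasParity_C (c : ℂ) : HasParity (C c) 0 := by
  intro n hn
  rw [coeff_C] at hn
  have : n = 0 := by by_contra h; simp [h] at hn
  simp [this]

theorem hasParity_X_pow (k : ℕ) : HasParity (X ^ k) k := by
  intro n hn
  rw [coeff_X_pow] at hn
  have : n = k := by by_contra h; simp [h] at hn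
  subst this
  exact ⟨le_rfl, ⟨n, rfl⟩⟩

theorem hasParity_X : HasParity X 1 := by
  simpa using hasParity_X_pow 1

theorem HasParity.eq_C {p : ℂ[X]} (hp : HasParity p 0) : p = C (p.coeff 0) :=
  eq_C_of_natDegree_le_zero hp.natDegree_le

theorem coeff_conjPoly (p : ℂ[X]) (n : ℕ) :
    (conjPoly p).coeff n = (starRingEnd ℂ) (p.coeff n) := by
  simp [conjPoly]

theorem conjPoly_natDegree_le (p : ℂ[X]) : (conjPoly p).natDegree ≤ p.natDegree := by
  simp [conjPoly]

/-- Top coefficients of a pair with `|F|² + (1 - x²)|G|² = 1` have the same absolute value. -/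
theorem norm_coeff_eq_of_complementary {k : ℕ} {F G : ℂ[X]} (hF : HasParity F (k + 1))
    (hG : HasParity G k) (h : F * conjPoly F + (1 - X ^ 2) * (G * conjPoly G) = 1) :
    ‖F.coeff (k + 1)‖ = ‖G.coeff k‖ := by
  -- In degree 2k + 2 the identity reads |f|² − |g|² = 0 for the two top coefficients.
  have h1 := congrArg (fun p => p.coeff (2 + (k + k))) h
  simp only [coeff_add] at h1
  rw [coeff_mul_add_eq_of_natDegree_le (f := 1 - X ^ 2) (df := 2) (dg := k + k),
    coeff_mul_add_eq_of_natDegree_le (f := G) (df := k) (dg := k),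
    show 2 + (k + k) = (k + 1) + (k + 1) by ring,
    coeff_mul_add_eq_of_natDegree_le (f := F) (df := k + 1) (dg := k + 1), coeff_conjPoly,
    coeff_conjPoly,
    Complex.mul_conj, Complex.mul_conj] at h1
  · have h2 : (1 - X ^ 2 : ℂ[X]).coeff 2 = -1 := by
      simp [coeff_one, coeff_X_pow]
    have h3 : (1 : ℂ[X]).coeff (k + 1 + (k + 1)) = 0 := by
      rw [coeff_one, if_neg (by omega)]
    rw [h2, h3, neg_one_mul, ← sub_eq_add_neg, ← Complex.ofReal_sub, Complex.ofReal_eq_zero,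
      sub_eq_zero] at h1
    rw [Complex.norm_def, Complex.norm_def, h1]
  · exact hF.natDegree_le
  · exact (conjPoly_natDegree_le F).trans hF.natDegree_le
  · exact hG.natDegree_le
  · exact (conjPoly_natDegree_le G).trans hG.natDegree_le
  · refine (natDegree_sub_le _ _).trans ?_
    simp
  · exact (natDegree_mul_le).trans
      (add_le_add hG.natDegree_le ((conjPoly_natDegree_le G).trans hG.natDegree_le))

theorem mul_conj_of_norm_eq_one {w : ℂ} (hw : ‖w‖ = 1) : w * (starRingEnd ℂ) w = 1 := by
  rw [Complex.mul_conj, Complex.normSq_eq_norm_sq, hw]; simp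

/-- Inverts the last step of the recursion. With A = w̄F, the previous pair is (XA + (1 − X²)G, A −
XG); it satisfies the same norm identity for every unit w, and the right w cancels the leading
coefficients, so that the degrees drop. At k = 0 only a unit constant is left. -/
theorem exists_qspPair_eq (k : ℕ) : ∀ F G : ℂ[X], HasParity F k → (∀ j, k = j + 1 → HasParity G j) →
    (k = 0 → G = 0) → F * conjPoly F + (1 - X ^ 2) * (G * conjPoly G) = 1 →
    ∃ (c : ℂ) (ω : ℕ → ℂ), ‖c‖ = 1 ∧ (∀ j, ‖ω j‖ = 1) ∧ qspPair c ω k = (F, G) := by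
  induction k with
  | zero =>
    intro F G hF _ hG h
    have hG := hG rfl
    subst hG
    have hFC := hF.eq_C
    refine ⟨F.coeff 0, fun _ => 1, ?_, by simp, by rw [qspPair, ← hFC]⟩
    have h0 := congrArg (fun p => p.coeff 0) h
    simp only [zero_mul, mul_zero, add_zero, mul_coeff_zero, coeff_conjPoly, coeff_one_zero,
      Complex.mul_conj, Complex.normSq_eq_norm_sq] at h0
    have : ‖F.coeff 0‖ ^ 2 = 1 := by exact_mod_cast h0
    nlinarith [norm_nonneg (F.coeff 0)]
  | succ k ih =>
    intro F G hF hG _ h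
    have hG := hG k rfl
    have hn := norm_coeff_eq_of_complementary hF hG h
    -- The phase has to turn the leading coefficient of F into that of G. Their moduli agree, so w
    -- is their quotient; if both vanish, any unit will do.
    obtain ⟨w, hw, hwf⟩ : ∃ w : ℂ, ‖w‖ = 1 ∧ (starRingEnd ℂ) w * F.coeff (k + 1) = G.coeff k := by
      by_cases hg : G.coeff k = 0
      · refine ⟨1, by simp, ?_⟩
        rw [hg, norm_zero, norm_eq_zero] at hn
        rw [hn, hg, mul_zero]
      · have hf : F.coeff (k + 1) ≠ 0 := by
          intro h0
          rw [h0, norm_zero] at hn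
          exact hg (norm_eq_zero.mp hn.symm)
        have hw1 : ‖F.coeff (k + 1) / G.coeff k‖ = 1 := by
          rw [norm_div, hn, div_self (norm_ne_zero_iff.mpr hg)]
        refine ⟨F.coeff (k + 1) / G.coeff k, hw1, ?_⟩
        have h1 := mul_conj_of_norm_eq_one hw1
        have h2 : F.coeff (k + 1) = F.coeff (k + 1) / G.coeff k * G.coeff k := by
          field_simp
        generalize F.coeff (k + 1) / G.coeff k = r at *
        rw [h2]
        linear_combination (G.coeff k) * h1
    have hww := mul_conj_of_norm_eq_one hw
    have hwC : C w * C ((starRingEnd ℂ) w) = 1 := by rw [← C_mul, hww, C_1]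
    set A : ℂ[X] := C ((starRingEnd ℂ) w) * F with hA
    have hAconj : conjPoly A = C w * conjPoly F := by simp [hA, conjPoly]
    have hAA : A * conjPoly A = F * conjPoly F := by
      rw [hAconj, hA]; linear_combination (F * conjPoly F) * hwC
    have hApar : HasParity A (k + 1) := by
      have := (hasParity_C ((starRingEnd ℂ) w)).mul hF
      rwa [zero_add] at this
    have hAtop : A.coeff (k + 1) = G.coeff k := by rw [hA, coeff_C_mul, hwf]
    have hwA : C w * A = F := by rw [hA]; linear_combination F * hwC
    -- A priori the degree is at most k + 2. The coefficient there is the difference of the leading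
    -- coefficients of A and G, which is zero, and parity then excludes k + 1.
    have p1 : HasParity (X * A + (1 - X ^ 2) * G) k := by
      have h1 : HasParity (X * A + (1 - X ^ 2) * G) (k + 2) := by
        have e : X * A + (1 - X ^ 2) * G = X * A + (G - X ^ 2 * G) := by ring
        rw [e]
        have e1 := hasParity_X.mul hApar
        have e2 := (hasParity_X_pow 2).mul hG
        rw [show 1 + (k + 1) = k + 2 by ring] at e1
        rw [add_comm 2 k] at e2
        exact e1.add (hG.add_two.sub e2)
      intro n hn
      obtain ⟨h2, b, hb⟩ := h1 n hn
      have hne : n ≠ k + 2 := by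
        rintro rfl
        apply hn
        have hGtop : G.coeff (k + 2) = 0 := by
          by_contra h0
          have := (hG _ h0).1
          omega
        rw [show X * A + (1 - X ^ 2) * G = X * A + (G - X ^ 2 * G) by ring, coeff_add, coeff_sub,
          coeff_X_mul, coeff_X_pow_mul, hAtop, hGtop]
        ring
      exact ⟨by omega, ⟨b - 1, by omega⟩⟩
    have p2 : ∀ j, k = j + 1 → HasParity (A - X * G) j := by
      rintro j rfl
      have h1 : HasParity (A - X * G) (j + 2) := by
        have e2 := hasParity_X.mul hG
        rw [show 1 + (j + 1) = j + 2 by ring] at e2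
        exact hApar.sub e2
      intro n hn
      obtain ⟨h2, b, hb⟩ := h1 n hn
      have hne : n ≠ j + 2 := by
        rintro rfl
        apply hn
        rw [coeff_sub, coeff_X_mul, hAtop, sub_self]
      exact ⟨by omega, ⟨b - 1, by omega⟩⟩
    -- By parity only a linear term could occur, and its coefficient is the same difference of
    -- leading coefficients.
    have p3 : k = 0 → A - X * G = 0 := by
      rintro rfl
      have h1 : HasParity (A - X * G) 1 := by
        have e2 := hasParity_X.mul hG
        exact hApar.sub e2
      ext n
      by_contra hn
      rw [coeff_zero] at hn
      obtain ⟨h2, b, hb⟩ := h1 n hn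
      obtain rfl : n = 1 := by omega
      apply hn
      rw [coeff_sub, coeff_X_mul, hAtop, sub_self]
    have p4 : (X * A + (1 - X ^ 2) * G) * conjPoly (X * A + (1 - X ^ 2) * G)
        + (1 - X ^ 2) * ((A - X * G) * conjPoly (A - X * G)) = 1 := by
      have hc1 : conjPoly (X * A + (1 - X ^ 2) * G)
          = X * conjPoly A + (1 - X ^ 2) * conjPoly G := by simp [conjPoly]
      have hc2 : conjPoly (A - X * G) = conjPoly A - X * conjPoly G := by simp [conjPoly]
      rw [hc1, hc2]
      linear_combination h + hAA
    obtain ⟨c, ω, hc, hω, hq⟩ := ih (X * A + (1 - X ^ 2) * G) (A - X * G) p1 p2 p3 p4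
    refine ⟨c, Function.update ω k w, hc, ?_, ?_⟩
    · intro j
      by_cases hj : j = k
      · subst hj; simpa using hw
      · rw [Function.update_of_ne hj]; exact hω j
    · rw [qspPair, qspPair_congr (ω' := ω), hq, Function.update_self]
      · refine Prod.ext ?_ ?_
        · rw [← hwA]; ring
        · ring
      · intro j hj
        rw [Function.update_of_ne (by omega)]

/-- The phases of signal processing, for a complementary pair of polynomials. -/
theorem exists_phases {k : ℕ} {F G : ℂ[X]} (hF : HasParity F (k + 1)) (hG : HasParity G k)
    (h : F * conjPoly F + (1 - X ^ 2) * (G * conjPoly G) = 1) :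
    ∃ ω : ℕ → ℂ, (∀ j, ‖ω j‖ = 1) ∧ (qspPair 1 ω (k + 1)).1 = F := by
  obtain ⟨c, ω, hc, hω, hq⟩ := exists_qspPair_eq (k + 1) F G hF
    (by rintro j hj; obtain rfl : k = j := by omega
        exact hG) (by simp) h
  -- The constant c multiplies both components. Moved into the last phase it is still present in the
  -- first component, the only one that enters an amplitude.
  refine ⟨Function.update ω k (c * ω k), ?_, ?_⟩
  · intro j
    by_cases hj : j = k
    · subst hj; simp [hc, hω]
    · rw [Function.update_of_ne hj]; exact hω j
  · rw [qspPair_const] at hq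
    have h1 := (Prod.ext_iff.mp hq).1
    simp only [qspPair] at h1 ⊢
    rw [qspPair_congr (ω := Function.update ω k (c * ω k)) (ω' := ω), Function.update_self, ← h1,
      C_mul, mul_assoc]
    intro j hj
    rw [Function.update_of_ne (by omega)]

/-- The nonreal roots of unity come in conjugate pairs. -/
theorem exists_conj_factor (k : ℕ) (hk : 0 < k) : ∃ S : Finset ℂ, (∀ z ∈ S, ‖z‖ = 1) ∧
    (X ^ k - 1 : ℂ[X]) = (if Even k then (X - 1) * (X + 1) else X - 1) *
      ((∏ z ∈ S, (X - C z)) * ∏ z ∈ S, (X - C ((starRingEnd ℂ) z))) ∧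
    k = (if Even k then 2 else 1) + 2 * S.card := by
  classical
  have hζ := Complex.isPrimitiveRoot_exp k hk.ne'
  set R := Polynomial.nthRootsFinset k (1 : ℂ) with hR
  have hmem : ∀ z, z ∈ R ↔ z ^ k = 1 := fun z => mem_nthRootsFinset hk 1
  have hfac : (X ^ k - 1 : ℂ[X]) = ∏ z ∈ R, (X - C z) := X_pow_sub_one_eq_prod hk hζ
  have hnorm : ∀ z ∈ R, ‖z‖ = 1 := by
    intro z hz
    exact Complex.norm_eq_one_of_pow_eq_one ((hmem z).mp hz) hk.ne'
  -- Complex conjugation permutes the roots of unity and exchanges the upper and the lower half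
  -- plane; the real roots are 1 and, for even k, −1.
  set S := R.filter fun z => 0 < z.im with hS
  set S' := R.filter fun z => z.im < 0 with hS'
  set T := R.filter fun z => z.im = 0 with hT
  have hconj : S' = S.image (starRingEnd ℂ) := by
    ext z
    simp only [hS, hS', Finset.mem_filter, Finset.mem_image, hmem]
    constructor
    · rintro ⟨h1, h2⟩
      refine ⟨(starRingEnd ℂ) z, ⟨?_, ?_⟩, ?_⟩
      · rw [← map_pow, h1, map_one]
      · simpa using h2
      · simp
    · rintro ⟨y, ⟨h1, h2⟩, rfl⟩
      refine ⟨?_, ?_⟩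
      · rw [← map_pow, h1, map_one]
      · simpa using h2
  have hTeq : T = if Even k then {1, -1} else {1} := by
    ext z
    have hre : z ∈ T → z = 1 ∨ z = -1 := by
      intro hz
      rw [hT, Finset.mem_filter] at hz
      have h1 := hnorm z hz.1
      have hzr : z = (z.re : ℂ) := Complex.ext (by simp) (by simp [hz.2])
      rw [hzr, Complex.norm_real, Real.norm_eq_abs] at h1
      rcases (abs_eq zero_le_one).mp h1 with h | h
      · left; rw [hzr, h]; simp
      · right; rw [hzr, h]; simp
    split_ifs with hev
    · simp only [Finset.mem_insert, Finset.mem_singleton]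
      refine ⟨hre, ?_⟩
      rintro (rfl | rfl)
      · simp [hT, hmem]
      · simp [hT, hmem, hev.neg_one_pow]
    · rw [Finset.mem_singleton]
      constructor
      · intro hz
        rcases hre hz with h | h
        · exact h
        · exfalso
          rw [hT, Finset.mem_filter, hmem, h, (Nat.not_even_iff_odd.mp hev).neg_one_pow] at hz
          norm_num at hz
      · rintro rfl
        simp [hT, hmem]
  have hprod : (X ^ k - 1 : ℂ[X]) = (if Even k then (X - 1) * (X + 1) else X - 1) *
      ((∏ z ∈ S, (X - C z)) * ∏ z ∈ S, (X - C ((starRingEnd ℂ) z))) := by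
    have h1 : ∏ z ∈ R, (X - C z) = (∏ z ∈ T, (X - C z)) *
        ((∏ z ∈ S, (X - C z)) * ∏ z ∈ S', (X - C z)) := by
      rw [← Finset.prod_filter_mul_prod_filter_not R fun z => z.im = 0]
      congr 1
      rw [← Finset.prod_filter_mul_prod_filter_not (R.filter fun z => ¬ z.im = 0)
        fun z => 0 < z.im, Finset.filter_filter, Finset.filter_filter]
      congr 1
      · refine Finset.prod_congr (Finset.filter_congr fun z _ => ?_) fun _ _ => rfl
        constructor
        · exact fun h => h.2
        · exact fun h => ⟨h.ne', h⟩
      · refine Finset.prod_congr (Finset.filter_congr fun z _ => ?_) fun _ _ => rfl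
        constructor
        · exact fun h => lt_of_le_of_ne (not_lt.mp h.2) h.1
        · exact fun h => ⟨h.ne, not_lt.mpr h.le⟩
    rw [hfac, h1, hconj, Finset.prod_image fun x _ y _ h => (starRingEnd ℂ).injective h, hTeq]
    congr 1
    split_ifs
    · rw [Finset.prod_pair (by norm_num)]; simp
    · simp
  refine ⟨S, fun z hz => hnorm z (Finset.mem_filter.mp hz).1, hprod, ?_⟩
  have hcard : R.card = k := hζ.card_nthRootsFinset
  have h2 : R.card = T.card + (S.card + S'.card) := by
    rw [← Finset.card_filter_add_card_filter_not (s := R) fun z => z.im = 0]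
    congr 1
    rw [← Finset.card_filter_add_card_filter_not (s := R.filter fun z => ¬ z.im = 0)
        fun z => 0 < z.im, Finset.filter_filter, Finset.filter_filter]
    congr 1
    · refine congrArg Finset.card (Finset.filter_congr fun z _ => ?_)
      constructor
      · exact fun h => h.2
      · exact fun h => ⟨h.ne', h⟩
    · refine congrArg Finset.card (Finset.filter_congr fun z _ => ?_)
      constructor
      · exact fun h => lt_of_le_of_ne (not_lt.mp h.2) h.1
      · exact fun h => ⟨h.ne, not_lt.mpr h.le⟩
  have h3 : S'.card = S.card := by
    rw [hconj, Finset.card_image_of_injective _ (starRingEnd ℂ).injective]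
  have h4 : T.card = if Even k then 2 else 1 := by
    rw [hTeq]
    split_ifs
    · rw [Finset.card_pair (by norm_num)]
    · simp
  omega

theorem expand_two (p : ℂ[X]) (n : ℕ) (h : p.natDegree ≤ n) : HasParity (expand ℂ 2 p) (2 * n) := by
  intro j hj
  rw [coeff_expand (by norm_num)] at hj
  by_cases hd : 2 ∣ j
  · rw [if_pos hd] at hj
    have := le_natDegree_of_ne_zero hj
    exact ⟨by omega, (even_iff_two_dvd.mpr hd).add (even_two_mul n)⟩
  · simp [hd] at hj

/-- Substituting X² into the factorisation of X^k − 1 gives 1 − X^{2k} = (1 − X²) W(X²) W̄(X²), with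
W the product over the roots in the upper half plane. So G = W(X²) complements F = X^k, and it is
even of degree k − 1, as required. -/
theorem exists_phases_odd (k : ℕ) (hk : Odd k) :
    ∃ ω : ℕ → ℂ, (∀ j, ‖ω j‖ = 1) ∧ (qspPair 1 ω k).1 = X ^ k := by
  obtain ⟨S, hS, hfac, hcard⟩ := exists_conj_factor k hk.pos
  rw [if_neg (Nat.not_even_iff_odd.mpr hk)] at hfac hcard
  set W : ℂ[X] := ∏ z ∈ S, (X - C z) with hW
  have hW' : conjPoly W = ∏ z ∈ S, (X - C ((starRingEnd ℂ) z)) := by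
    simp [hW, conjPoly, Polynomial.map_prod]
  have hdeg : W.natDegree ≤ S.card := by
    rw [hW, natDegree_finsetProd_X_sub_C_eq_card]
  obtain rfl : k = 2 * S.card + 1 := by omega
  refine exists_phases (G := expand ℂ 2 W) (hasParity_X_pow _) (expand_two W _ hdeg) ?_
  have h1 := congrArg (expand ℂ 2) hfac
  rw [← hW', map_mul, map_mul, map_sub, map_sub, map_pow, map_one, expand_X] at h1
  have h2 : conjPoly (expand ℂ 2 W) = expand ℂ 2 (conjPoly W) := by
    simp [conjPoly, Polynomial.map_expand]
  have h3 : conjPoly (X ^ (2 * S.card + 1)) = X ^ (2 * S.card + 1) := by simp [conjPoly]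
  rw [h2, h3]
  linear_combination h1

/-- Polynomials of the form `B² + (1 - x²) C²` with `B` even and `C` odd. -/
def IsEvenSquareSum (p : ℂ[X]) (d : ℕ) : Prop :=
  ∃ B D : ℂ[X], conjPoly B = B ∧ conjPoly D = D ∧ HasParity B (d + 1) ∧ HasParity D d ∧
    p = B ^ 2 + (1 - X ^ 2) * D ^ 2

/-- The quadratic in X² has itself the form B₂² + (1 − X²)D₂², and such forms multiply by the
Brahmagupta identity. -/
theorem IsEvenSquareSum.mul_quadratic {p : ℂ[X]} {d : ℕ} (h : IsEvenSquareSum p d) {c : ℝ}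
    (hc : c ≤ 1) :
    IsEvenSquareSum (p * (X ^ 4 - C ((2 * c : ℝ) : ℂ) * X ^ 2 + 1)) (d + 2) := by
  obtain ⟨B, D, hB, hD, hBp, hDp, rfl⟩ := h
  -- Matching coefficients in X⁴ − 2cX² + 1 = (αX² + 1)² + (1 − X²)γ²X² gives γ² = α² − 1 and (α +
  -- 1)² = 2 − 2c. The negative root makes α ≤ −1, so that γ is real.
  set α : ℝ := -1 - √(2 - 2 * c) with hα
  have h1 : (α + 1) ^ 2 = 2 - 2 * c := by
    rw [hα, show (-1 - √(2 - 2 * c) + 1) ^ 2 = √(2 - 2 * c) ^ 2 by ring, Real.sq_sqrt (by linarith)]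
  have hα1 : 0 ≤ α ^ 2 - 1 := by
    have : 0 ≤ √(2 - 2 * c) := Real.sqrt_nonneg _
    nlinarith
  set γ : ℝ := √(α ^ 2 - 1) with hγ
  have h2 : γ ^ 2 = α ^ 2 - 1 := Real.sq_sqrt hα1
  set B₂ : ℂ[X] := C (α : ℂ) * X ^ 2 + 1
  set D₂ : ℂ[X] := C (γ : ℂ) * X
  have hB₂ : conjPoly B₂ = B₂ := by simp [B₂, conjPoly]
  have hD₂ : conjPoly D₂ = D₂ := by simp [D₂, conjPoly]
  have hB₂p : HasParity B₂ 2 := by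
    have e := (hasParity_C (α : ℂ)).mul (hasParity_X_pow 2)
    rw [zero_add] at e
    exact e.add (hasParity_C 1).add_two
  have hD₂p : HasParity D₂ 1 := (hasParity_C (γ : ℂ)).mul hasParity_X
  -- Real part and imaginary part (the latter without its root) of the product of B + i√(1 − X²) D
  -- and B₂ + i√(1 − X²) D₂.
  refine ⟨B * B₂ - (1 - X ^ 2) * (D * D₂), B * D₂ + B₂ * D, ?_, ?_, ?_, ?_, ?_⟩
  · have : conjPoly (B * B₂ - (1 - X ^ 2) * (D * D₂)) = conjPoly B * conjPoly B₂
      - (1 - X ^ 2) * (conjPoly D * conjPoly D₂) := by simp [conjPoly]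
    rw [this, hB, hB₂, hD, hD₂]
  · have : conjPoly (B * D₂ + B₂ * D) = conjPoly B * conjPoly D₂
      + conjPoly B₂ * conjPoly D := by simp [conjPoly]
    rw [this, hB, hB₂, hD, hD₂]
  · have e1 := hBp.mul hB₂p
    have e2 := hDp.mul hD₂p
    have e3 := (hasParity_X_pow 2).mul e2
    rw [show B * B₂ - (1 - X ^ 2) * (D * D₂) = B * B₂ - (D * D₂ - X ^ 2 * (D * D₂)) by ring]
    rw [show d + 1 + 2 = d + 2 + 1 by ring] at e1
    rw [show 2 + (d + 1) = d + 1 + 2 by ring] at e3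
    exact e1.sub (e2.add_two.sub e3)
  · have e1 := hBp.mul hD₂p
    have e2 := hB₂p.mul hDp
    rw [add_comm 2 d] at e2
    exact e1.add e2
  · have h1' : (α : ℂ) ^ 2 + 2 * α + 1 = 2 - 2 * c := by
      have : α ^ 2 + 2 * α + 1 = 2 - 2 * c := by linarith
      exact_mod_cast this
    have h2' : (γ : ℂ) ^ 2 = α ^ 2 - 1 := by exact_mod_cast h2
    have hquad : X ^ 4 - C ((2 * c : ℝ) : ℂ) * X ^ 2 + 1 = B₂ ^ 2 + (1 - X ^ 2) * D₂ ^ 2 := by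
      have e1 : C (γ : ℂ) ^ 2 = C (α : ℂ) ^ 2 - 1 := by
        rw [← C_pow, h2']; simp
      have e2 : C ((2 * c : ℝ) : ℂ) = 1 - 2 * C (α : ℂ) - C (α : ℂ) ^ 2 := by
        have : ((2 * c : ℝ) : ℂ) = 1 - 2 * α - α ^ 2 := by
          push_cast; linear_combination h1'
        rw [this]; simp [map_ofNat]
      simp only [B₂, D₂, e2]
      linear_combination (-(1 - X ^ 2) * X ^ 2 : ℂ[X]) * e1
    rw [hquad]
    ring

/-- Here X^k alone has no complement of odd parity, so it is realised as the real part of F = X^k +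
iB. The complement D comes from 1 − X^{2k} = B² + (1 − X²)D², assembled from 1 − X⁴ and one factor
X⁴ − 2 Re(z) X² + 1 for each conjugate pair of nonreal roots z. -/
theorem exists_phases_even (k : ℕ) (hk : Even k) (hk0 : 0 < k) :
    ∃ ω : ℕ → ℂ, (∀ j, ‖ω j‖ = 1) ∧
      (qspPair 1 ω k).1 + conjPoly (qspPair 1 ω k).1 = 2 * X ^ k := by
  obtain ⟨S, hS, hfac, hcard⟩ := exists_conj_factor k hk0
  rw [if_pos hk] at hfac hcard
  have hprod : ∀ T : Finset ℂ, T ⊆ S → IsEvenSquareSum ((1 - X ^ 2) * (1 + X ^ 2) *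
      ∏ z ∈ T, (X ^ 4 - C ((2 * z.re : ℝ) : ℂ) * X ^ 2 + 1)) (2 * T.card + 1) := by
    classical
    intro T hT
    induction T using Finset.induction_on with
    | empty =>
      -- 1 − X⁴ = (X² − 1)² + (1 − X²)(√2 X)².
      refine ⟨X ^ 2 - 1, C ((√2 : ℝ) : ℂ) * X, ?_, ?_, ?_, ?_, ?_⟩
      · simp [conjPoly]
      · simp [conjPoly]
      · exact (hasParity_X_pow 2).sub (hasParity_C 1).add_two
      · exact (hasParity_C _).mul hasParity_X
      · have : C ((√2 : ℝ) : ℂ) ^ 2 = 2 := by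
          rw [← C_pow, ← Complex.ofReal_pow, Real.sq_sqrt (by norm_num)]; exact map_ofNat C 2
        rw [Finset.prod_empty]
        linear_combination (-(1 - X ^ 2) * X ^ 2 : ℂ[X]) * this
    | insert z T hz ih =>
      rw [Finset.prod_insert hz, Finset.card_insert_of_notMem hz,
        show 2 * (T.card + 1) + 1 = 2 * T.card + 1 + 2 by ring,
        mul_comm (X ^ 4 - _ + 1), ← mul_assoc]
      have hzn := hS z (hT (by simp))
      have := abs_le.mp ((Complex.abs_re_le_norm z).trans hzn.le)
      exact (ih fun y hy => hT (by simp [hy])).mul_quadratic this.2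
  obtain ⟨B, D, hB, hD, hBp, hDp, hsum⟩ := hprod S subset_rfl
  have h1 := congrArg (expand ℂ 2) hfac
  have hquad : expand ℂ 2 ((∏ z ∈ S, (X - C z)) * ∏ z ∈ S, (X - C ((starRingEnd ℂ) z)))
      = ∏ z ∈ S, (X ^ 4 - C ((2 * z.re : ℝ) : ℂ) * X ^ 2 + 1) := by
    rw [← Finset.prod_mul_distrib, map_prod]
    refine Finset.prod_congr rfl fun z hz => ?_
    have e1 : C z * C ((starRingEnd ℂ) z) = 1 := by
      rw [← C_mul, mul_conj_of_norm_eq_one (hS z hz), C_1]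
    have e2 : C z + C ((starRingEnd ℂ) z) = C ((2 * z.re : ℝ) : ℂ) := by
      rw [← C_add, Complex.add_conj]
    rw [map_mul, map_sub, map_sub, expand_X, expand_C, expand_C, ← e2]
    linear_combination e1
  rw [map_mul, hquad, map_mul, map_sub, map_sub, map_add, map_pow, map_one, expand_X] at h1
  obtain ⟨j, rfl⟩ : ∃ j, k = j + 1 := ⟨k - 1, by omega⟩
  obtain rfl : j = 2 * S.card + 1 := by omega
  -- Since B has real coefficients, F times its conjugate is X^{2k} + B², and D is complementary to
  -- F.
  set F : ℂ[X] := X ^ (2 * S.card + 1 + 1) + C Complex.I * B with hF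
  have hFc : conjPoly F = X ^ (2 * S.card + 1 + 1) - C Complex.I * B := by
    have : conjPoly F = X ^ (2 * S.card + 1 + 1) + C (-Complex.I) * conjPoly B := by
      simp [hF, conjPoly]
    rw [this, hB, C_neg]; ring
  have hI : C Complex.I * C Complex.I = (-1 : ℂ[X]) := by
    rw [← C_mul, Complex.I_mul_I]; simp
  have p1 : HasParity F (2 * S.card + 1 + 1) := by
    have e := (hasParity_C Complex.I).mul hBp
    rw [zero_add] at e
    exact (hasParity_X_pow _).add e
  have p2 : F * conjPoly F + (1 - X ^ 2) * (D * conjPoly D) = 1 := by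
    rw [hFc, hD, hF]
    linear_combination (-(B ^ 2)) * hI - hsum + h1
  obtain ⟨ω, hω, h⟩ := exists_phases p1 hDp p2
  refine ⟨ω, hω, ?_⟩
  rw [h, hFc, hF]
  ring

end SignalProcessing

/-! ### Registers -/

section Registers

variable {N m w : ℕ}

/-- The basis configuration of all wires with given contents of the registers. -/
def cfg (s x z : Conf N m) (A : Fin w → Bool) (b : Bool) : Wire N m w → Bool :=
  Sum.elim s (Sum.elim x (Sum.elim z (Sum.elim A fun _ => b)))

theorem cfg_eta (c : Wire N m w → Bool) :
    c = cfg (fun q => c (Sum.inl q)) (fun q => c (Sum.inr (Sum.inl q)))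
      (fun q => c (Sum.inr (Sum.inr (Sum.inl q))))
      (fun q => c (Sum.inr (Sum.inr (Sum.inr (Sum.inl q))))) (c (rotWire N m w)) := by
  funext q
  rcases q with q | q | q | q | q <;> rfl

theorem embed_cfg (b b' : Bool) (Ψ : Conf N m × Aux N m → ℂ) (s x z : Conf N m)
    (A : Fin w → Bool) : embed b Ψ (cfg s x z A b') =
      if A = (fun _ => false) ∧ b' = b then Ψ (s, (x, z)) else 0 := by
  simp only [embed, cfg, rotWire, Sum.elim_inl, Sum.elim_inr, funext_iff]
  rfl

theorem cfg_inj {s x z s' x' z' : Conf N m} {A A' : Fin w → Bool} {b b' : Bool} :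
    cfg s x z A b = cfg s' x' z' A' b' ↔ s = s' ∧ x = x' ∧ z = z' ∧ A = A' ∧ b = b' := by
  constructor
  · intro h
    refine ⟨?_, ?_, ?_, ?_, congrFun h (rotWire N m w)⟩
    · funext q; exact congrFun h (Sum.inl q)
    · funext q; exact congrFun h (Sum.inr (Sum.inl q))
    · funext q; exact congrFun h (Sum.inr (Sum.inr (Sum.inl q)))
    · funext q; exact congrFun h (Sum.inr (Sum.inr (Sum.inr (Sum.inl q))))
  · rintro ⟨rfl, rfl, rfl, rfl, rfl⟩; rfl

theorem embed_add (b : Bool) (Ψ Φ : Conf N m × Aux N m → ℂ) :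
    embed (w := w) b (Ψ + Φ) = embed b Ψ + embed b Φ := by
  funext c
  simp only [embed, Pi.add_apply]
  split_ifs <;> simp

theorem embed_smul (b : Bool) (r : ℂ) (Ψ : Conf N m × Aux N m → ℂ) :
    embed (w := w) b (r • Ψ) = r • embed b Ψ := by
  funext c
  simp only [embed, Pi.smul_apply]
  split_ifs <;> simp

theorem embed_zero (b : Bool) : embed (w := w) b (0 : Conf N m × Aux N m → ℂ) = 0 := by
  funext c
  simp [embed]

theorem embed_sum {α : Type*} (b : Bool) (S : Finset α) (Ψ : α → Conf N m × Aux N m → ℂ) :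
    embed (w := w) b (∑ a ∈ S, Ψ a) = ∑ a ∈ S, embed b (Ψ a) := by
  classical
  induction S using Finset.induction_on with
  | empty => simp [embed_zero]
  | insert a S ha ih => rw [Finset.sum_insert ha, Finset.sum_insert ha, embed_add, ih]

theorem embed_single (b : Bool) (a : Conf N m × Aux N m) :
    embed (w := w) b (Pi.single a 1) = ket (cfg a.1 a.2.1 a.2.2 (fun _ => false) b) := by
  obtain ⟨s, x, z⟩ := a
  funext c
  rw [ket_apply, cfg_eta c, embed_cfg]
  simp only [cfg_inj, Pi.single_apply, Prod.mk.injEq]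
  split_ifs <;> first | rfl | (exfalso; tauto)

theorem embed_eq_sum (b : Bool) (Ψ : Conf N m × Aux N m → ℂ) : embed (w := w) b Ψ
    = ∑ a, Ψ a • ket (cfg a.1 a.2.1 a.2.2 (fun _ => false) b) := by
  have h : Ψ = ∑ a, Ψ a • Pi.single a (1 : ℂ) := by
    funext a
    simp [Finset.sum_apply, Pi.single_apply]
  conv_lhs => rw [h]
  rw [embed_sum]
  refine Finset.sum_congr rfl fun a _ => ?_
  rw [embed_smul, embed_single]

theorem star_ket_dotProduct {ι : Type} [Fintype ι] [DecidableEq ι] (c : ι → Bool)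
    (Φ : (ι → Bool) → ℂ) : star (ket c) ⬝ᵥ Φ = Φ c := by
  simp only [dotProduct, Pi.star_apply, ket_apply]
  rw [Finset.sum_eq_single c]
  · simp
  · intro d _ hd; simp [hd]
  · simp

theorem star_embed_dotProduct (b : Bool) (Ψ : Conf N m × Aux N m → ℂ)
    (Φ : (Wire N m w → Bool) → ℂ) : star (embed b Ψ) ⬝ᵥ Φ
      = ∑ a, star (Ψ a) * Φ (cfg a.1 a.2.1 a.2.2 (fun _ => false) b) := by
  rw [embed_eq_sum, star_sum, sum_dotProduct]
  refine Finset.sum_congr rfl fun a _ => ?_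
  rw [star_smul, smul_dotProduct, star_ket_dotProduct, smul_eq_mul]

theorem star_embed_dotProduct_embed (b b' : Bool) (Ψ Φ : Conf N m × Aux N m → ℂ) :
    star (embed (w := w) b Ψ) ⬝ᵥ embed b' Φ = if b = b' then star Ψ ⬝ᵥ Φ else 0 := by
  rw [star_embed_dotProduct]
  simp only [embed_cfg, true_and]
  split_ifs <;> simp [dotProduct]

theorem h_run_embed (Ψ : Conf N m × Aux N m → ℂ) :
    (Gate.h (rotWire N m w)).run (embed false Ψ)
      = ((1 / Real.sqrt 2 : ℝ) : ℂ) • (embed false Ψ + embed true Ψ) := by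
  rw [h_run]
  have hu : ∀ (s x z : Conf N m) (A : Fin w → Bool) (b t : Bool),
      Function.update (cfg s x z A b) (rotWire N m w) t = cfg s x z A t := by
    intro s x z A b t
    funext q
    rcases q with q | q | q | q | q <;> simp [cfg, rotWire]
  funext c
  rw [cfg_eta c]
  generalize c (rotWire N m w) = b
  simp only [hu, embed_cfg, Pi.smul_apply, Pi.add_apply, smul_eq_mul]
  cases b <;> simp

end Registers

/-! ### The block encoding -/

section BlockEncoding

variable {N m : ℕ}

theorem tensor_add (ψ ψ' : Conf N m → ℂ) (v : Aux N m → ℂ) :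
    tensor (ψ + ψ') v = tensor ψ v + tensor ψ' v := by
  funext a; simp [tensor, add_mul]

theorem tensor_smul (r : ℂ) (ψ : Conf N m → ℂ) (v : Aux N m → ℂ) :
    tensor (r • ψ) v = r • tensor ψ v := by
  funext a; simp [tensor, mul_assoc]

/-- The partial inner product with a state of the auxiliary register. -/
def auxContract (v : Aux N m → ℂ) (Ψ : Conf N m × Aux N m → ℂ) : Conf N m → ℂ :=
  fun s => ∑ p, star (v p) * Ψ (s, p)

theorem auxContract_add (v : Aux N m → ℂ) (Ψ Φ : Conf N m × Aux N m → ℂ) :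
    auxContract v (Ψ + Φ) = auxContract v Ψ + auxContract v Φ := by
  funext s; simp [auxContract, mul_add, Finset.sum_add_distrib]

theorem auxContract_tensor {v : Aux N m → ℂ} (hv : star v ⬝ᵥ v = 1) (ψ : Conf N m → ℂ) :
    auxContract v (tensor ψ v) = ψ := by
  funext s
  have : ∑ p, star (v p) * v p = 1 := by simpa [dotProduct] using hv
  simp only [auxContract, tensor]
  calc ∑ p, star (v p) * (ψ s * v p) = ψ s * ∑ p, star (v p) * v p := by
        rw [Finset.mul_sum]; exact Finset.sum_congr rfl fun p _ => by ring
    _ = ψ s := by rw [this, mul_one]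

theorem star_tensor_dotProduct (ψ : Conf N m → ℂ) (v : Aux N m → ℂ)
    (Ψ : Conf N m × Aux N m → ℂ) : star (tensor ψ v) ⬝ᵥ Ψ = star ψ ⬝ᵥ auxContract v Ψ := by
  rw [dotProduct, Fintype.sum_prod_type]
  simp only [dotProduct, auxContract, tensor, Pi.star_apply, star_mul', Finset.mul_sum, mul_assoc]

theorem Matrix.exp_smul_of_isIdempotentElem {n : Type*} [Fintype n] [DecidableEq n]
    {P : Matrix n n ℂ} (hP : IsIdempotentElem P) (t : ℂ) :
    NormedSpace.exp (t • P) = 1 + (Complex.exp t - 1) • P := by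
  have h1 : HasSum (fun k : ℕ => (t ^ k / (k.factorial : ℂ)) • P) (Complex.exp t • P) := by
    have := NormedSpace.expSeries_div_hasSum_exp (𝔸 := ℂ) t
    rw [← Complex.exp_eq_exp_ℂ] at this
    exact this.smul_const P
  -- The term of index 0 in the exponential series is 1 and not P; this series makes the correction.
  have h2 : HasSum (fun k : ℕ => if k = 0 then 1 - P else 0) (1 - P) := hasSum_ite_eq 0 _
  have h3 := h1.add h2
  have h4 : (fun k : ℕ => (t ^ k / (k.factorial : ℂ)) • P + if k = 0 then 1 - P else 0)
      = fun k : ℕ => ((k.factorial : ℂ)⁻¹) • (t • P) ^ k := by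
    funext k
    rcases Nat.eq_zero_or_pos k with rfl | hk
    · simp
    · rw [if_neg hk.ne', add_zero, smul_pow, hP.pow_eq hk.ne', smul_smul]
      congr 1
      rw [div_eq_inv_mul]
  rw [h4] at h3
  have h5 := congrFun (NormedSpace.exp_eq_tsum ℂ (𝔸 := Matrix n n ℂ)) (t • P)
  rw [h5.trans h3.tsum_eq, sub_smul, one_smul]
  abel

theorem kronecker_one_vecMulVec_mulVec (v : Aux N m → ℂ) (Ψ : Conf N m × Aux N m → ℂ) :
    ((1 : Matrix (Conf N m) (Conf N m) ℂ) ⊗ₖ Matrix.vecMulVec v (star v)) *ᵥ Ψ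
      = tensor (auxContract v Ψ) v := by
  funext ⟨s, p⟩
  rw [Matrix.mulVec, dotProduct, Fintype.sum_prod_type]
  simp only [Matrix.kroneckerMap_apply, Matrix.one_apply, tensor, auxContract,
    Matrix.vecMulVec_apply, Pi.star_apply]
  rw [Finset.sum_eq_single s]
  · simp only [if_true, one_mul, Finset.sum_mul]
    exact Finset.sum_congr rfl fun p _ => by ring
  · intro s' _ hs'
    simp [Ne.symm hs']
  · simp

theorem auxRotation_mulVec {v : Aux N m → ℂ} (hv : star v ⬝ᵥ v = 1) (φ : ℝ)
    (Ψ : Conf N m × Aux N m → ℂ) : auxRotation v φ *ᵥ Ψ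
      = Ψ + (Complex.exp (2 * Complex.I * φ) - 1) • tensor (auxContract v Ψ) v := by
  have hP : IsIdempotentElem (Matrix.vecMulVec v (star v)) := by
    rw [IsIdempotentElem, Matrix.vecMulVec_mul_vecMulVec, hv]
    simp
  rw [auxRotation, Matrix.exp_smul_of_isIdempotentElem hP, Matrix.kronecker_add,
    Matrix.kronecker_smul, Matrix.one_kronecker_one, Matrix.add_mulVec, Matrix.one_mulVec,
    Matrix.smul_mulVec, kronecker_one_vecMulVec_mulVec]

theorem blockU_mulVec (Ψ : Conf N m × Aux N m → ℂ) (s : Conf N m) (p : Aux N m) :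
    (blockU N m *ᵥ Ψ) (s, p) = ∑ t, pauli p s t * Ψ (t, p) := by
  simp only [Matrix.mulVec, dotProduct, blockU, Matrix.of_apply]
  rw [Fintype.sum_prod_type]
  refine Finset.sum_congr rfl fun t _ => ?_
  rw [Finset.sum_eq_single p]
  · simp
  · intro p' _ hp'
    simp [Ne.symm hp']
  · simp

end BlockEncoding

/-! ### The polynomial transformation -/

section Transformation

open Polynomial

variable {N m w : ℕ}

/-- The block encoding state on which the state of the QSVT sequence is supported after `k` steps,
for the pair of block encoding states `g`, `g'`. -/
def activeState {α : Type*} (g g' : α) (k : ℕ) : α := if Even k then g else g'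

theorem activeState_succ {α : Type*} (g g' : α) (k : ℕ) :
    activeState g g' (k + 1) = activeState g' g k := by
  unfold activeState
  by_cases h : Even k
  · rw [if_pos h, if_neg (by simpa [Nat.even_add_one] using h)]
  · rw [if_neg h, if_pos (by simpa [Nat.even_add_one] using h)]

theorem aeval_mulVec_X_mul {n : Type*} [Fintype n] [DecidableEq n] (H : Matrix n n ℂ) (p : ℂ[X])
    (ψ : n → ℂ) : H *ᵥ (aeval H p *ᵥ ψ) = aeval H (X * p) *ᵥ ψ := by
  rw [map_mul, aeval_X, Matrix.mulVec_mulVec]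

variable {H : Matrix (Conf N m) (Conf N m) ℂ} {g g' : Aux N m → ℂ}

theorem Implements.run {C : Circuit (Wire N m w)}
    {A : Bool → Matrix (Conf N m × Aux N m) (Conf N m × Aux N m) ℂ} (h : Implements C A) (b : Bool)
    (Ψ : Conf N m × Aux N m → ℂ) : C.run (embed b Ψ) = embed b (A b *ᵥ Ψ) := h b Ψ

/-- The state after `k` steps of the QSVT sequence. -/
theorem qsvtSteps_run (hU2 : blockU N m * blockU N m = 1)
    (hg : star g ⬝ᵥ g = 1) (hg' : star g' ⬝ᵥ g' = 1)
    (hH : ∀ ψ, auxContract g' (blockU N m *ᵥ tensor ψ g) = H *ᵥ ψ)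
    (hH' : ∀ ψ, auxContract g (blockU N m *ᵥ tensor ψ g') = H *ᵥ ψ)
    {U : Circuit (Wire N m w)} {R Rt : ℝ → Circuit (Wire N m w)}
    (hU : Implements U fun _ => blockU N m)
    (hR : ∀ φ, Implements (R φ) fun b => auxRotation g (if b then -φ else φ))
    (hRt : ∀ φ, Implements (Rt φ) fun b => auxRotation g' (if b then -φ else φ))
    (φ : ℕ → ℝ) (b : Bool) (ψ : Conf N m → ℂ) (ω : ℕ → ℂ)
    (hω : ∀ j, ω j = Complex.exp (2 * Complex.I * ((if b then -φ j else φ j : ℝ) : ℂ))) (k : ℕ) :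
    Circuit.run (qsvtSteps U R Rt φ k) (embed b (tensor ψ g))
      = embed b (blockU N m *ᵥ tensor (aeval H (qspPair 1 ω k).2 *ᵥ ψ) (activeState g' g k)
        + tensor (aeval H ((qspPair 1 ω k).1 - X * (qspPair 1 ω k).2) *ᵥ ψ)
          (activeState g g' k)) := by
  -- As `blockU` is an involution, steps with U and with its inverse act alike; only the state of
  -- the rotation alternates.
  have hUinv : Implements U.inv fun _ => blockU N m := by
    intro b Ψ
    have h := hU b (blockU N m *ᵥ Ψ)
    rw [Matrix.mulVec_mulVec, hU2, Matrix.one_mulVec] at h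
    rw [← h, ← Circuit.run_apply, ← Circuit.run_apply, Circuit.run_inv_run]
  induction k with
  | zero =>
    have h0 : tensor (0 : Conf N m → ℂ) g' = 0 := by
      funext a; simp [tensor]
    simp [qsvtSteps, qspPair, activeState, h0]
  | succ k ih =>
    set F := (qspPair 1 ω k).1 with hF
    set G := (qspPair 1 ω k).2 with hG
    have hG1 : (qspPair 1 ω (k + 1)).2 = F - X * G := rfl
    -- The right-hand side is what a rotation does to a component with polynomial G, when the
    -- overlap with the rotated state is G + X(F − XG).
    have hF1 : (qspPair 1 ω (k + 1)).1 - X * (qspPair 1 ω (k + 1)).2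
        = G + C (ω k - 1) * (G + X * (F - X * G)) := by
      simp only [qspPair, C_sub, C_1, ← hF, ← hG]; ring
    have hnorm : star (activeState g' g k) ⬝ᵥ activeState g' g k = 1 := by
      unfold activeState; split_ifs <;> assumption
    have hcon : ∀ χ, auxContract (activeState g' g k) (blockU N m *ᵥ tensor χ (activeState g g' k))
        = H *ᵥ χ := by
      intro χ; unfold activeState; split_ifs
      · exact hH χ
      · exact hH' χ
    have hstep : ∀ Φ : Conf N m × Aux N m → ℂ,
        Circuit.run (if Even k then U ++ Rt (φ k) else U.inv ++ R (φ k)) (embed b Φ)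
        = embed b (auxRotation (activeState g' g k) (if b then -φ k else φ k) *ᵥ
            (blockU N m *ᵥ Φ)) := by
      intro Φ
      unfold activeState
      split_ifs
      all_goals
        first
        | rw [Circuit.run_append, hU.run, (hRt _).run]; simp_all
        | rw [Circuit.run_append, hUinv.run, (hR _).run]; simp_all
    -- The new `blockU` cancels against the one in the first summand and is put in front of the
    -- second. The rotation then only adds a multiple of the state about which it rotates, and the
    -- two summands exchange their roles.
    rw [qsvtSteps, Circuit.run_append, ih, hstep, auxRotation_mulVec hnorm, ← hω, hF1, hG1,
      activeState_succ, activeState_succ, Matrix.mulVec_add, Matrix.mulVec_mulVec, hU2,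
      Matrix.one_mulVec, auxContract_add, auxContract_tensor hnorm, hcon, aeval_mulVec_X_mul,
      ← Matrix.add_mulVec, ← map_add]
    congr 1
    rw [map_add (aeval H) G (C (ω k - 1) * _), Matrix.add_mulVec, tensor_add, map_mul, aeval_C,
      Algebra.algebraMap_eq_smul_one, Matrix.smul_mul, Matrix.one_mul, Matrix.smul_mulVec,
      tensor_smul]
    abel

end Transformation

/-! ### The measurement circuit -/

section Shot

open Polynomial

variable {N m w : ℕ} {H : Matrix (Conf N m) (Conf N m) ℂ} {g g' : Aux N m → ℂ}

theorem Prepares.run {C : Circuit (Wire N m w)} {v : Aux N m → ℂ} (h : Prepares C v) (b : Bool)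
    (ψ : Conf N m → ℂ) :
    C.run (embed b (tensor ψ (auxZero N m))) = embed b (tensor ψ v) := h b ψ

/-- Contraction with the active state turns `blockU` in the first summand of `qsvtSteps_run` into H,
so the polynomials add up to XG + (F − XG) = F. Different values of the rotation qubit are
orthogonal. -/
theorem qsvtSteps_amplitude (hU2 : blockU N m * blockU N m = 1)
    (hg : star g ⬝ᵥ g = 1) (hg' : star g' ⬝ᵥ g' = 1)
    (hH : ∀ ψ, auxContract g' (blockU N m *ᵥ tensor ψ g) = H *ᵥ ψ)
    (hH' : ∀ ψ, auxContract g (blockU N m *ᵥ tensor ψ g') = H *ᵥ ψ)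
    {U : Circuit (Wire N m w)} {R Rt : ℝ → Circuit (Wire N m w)}
    (hU : Implements U fun _ => blockU N m)
    (hR : ∀ φ, Implements (R φ) fun b => auxRotation g (if b then -φ else φ))
    (hRt : ∀ φ, Implements (Rt φ) fun b => auxRotation g' (if b then -φ else φ))
    (φ : ℕ → ℝ) (b b' : Bool) (ψ : Conf N m → ℂ) (ω : ℕ → ℂ)
    (hω : ∀ j, ω j = Complex.exp (2 * Complex.I * ((if b then -φ j else φ j : ℝ) : ℂ))) (k : ℕ) :
    star (embed b' (tensor ψ (activeState g g' k))) ⬝ᵥ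
        Circuit.run (qsvtSteps U R Rt φ k) (embed b (tensor ψ g))
      = if b' = b then star ψ ⬝ᵥ (aeval H (qspPair 1 ω k).1 *ᵥ ψ) else 0 := by
  have hnorm : star (activeState g g' k) ⬝ᵥ activeState g g' k = 1 := by
    unfold activeState; split_ifs <;> assumption
  have hcon : ∀ χ, auxContract (activeState g g' k) (blockU N m *ᵥ tensor χ (activeState g' g k))
      = H *ᵥ χ := by
    intro χ; unfold activeState; split_ifs
    · exact hH' χ
    · exact hH χ
  rw [qsvtSteps_run hU2 hg hg' hH hH' hU hR hRt φ b ψ ω hω k, star_embed_dotProduct_embed,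
    star_tensor_dotProduct, auxContract_add, hcon, auxContract_tensor hnorm, aeval_mulVec_X_mul,
    ← Matrix.add_mulVec, ← map_add]
  congr 5
  ring

theorem exp_arg_eq {z : ℂ} (hz : ‖z‖ = 1) :
    z = Complex.exp (2 * Complex.I * ((Complex.arg z / 2 : ℝ) : ℂ)) := by
  have := Complex.norm_mul_exp_arg_mul_I z
  rw [hz, Complex.ofReal_one, one_mul] at this
  conv_lhs => rw [← this]
  congr 1
  push_cast
  ring

theorem exp_neg_arg_eq {z : ℂ} (hz : ‖z‖ = 1) :
    (starRingEnd ℂ) z = Complex.exp (2 * Complex.I * ((-(Complex.arg z / 2) : ℝ) : ℂ)) := by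
  conv_lhs => rw [exp_arg_eq hz]
  rw [← Complex.exp_conj]
  congr 1
  simp [map_ofNat]

/-- With suitable angles, the measurement circuit has the moment of `H` as its amplitude. -/
theorem exists_shot_amplitude (hU2 : blockU N m * blockU N m = 1)
    (hg : star g ⬝ᵥ g = 1) (hg' : star g' ⬝ᵥ g' = 1)
    (hH : ∀ ψ, auxContract g' (blockU N m *ᵥ tensor ψ g) = H *ᵥ ψ)
    (hH' : ∀ ψ, auxContract g (blockU N m *ᵥ tensor ψ g') = H *ᵥ ψ)
    {G Gt U : Circuit (Wire N m w)} {R Rt : ℝ → Circuit (Wire N m w)}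
    (hG : Prepares G g) (hGt : Prepares Gt g') (hU : Implements U fun _ => blockU N m)
    (hR : ∀ φ, Implements (R φ) fun b => auxRotation g (if b then -φ else φ))
    (hRt : ∀ φ, Implements (Rt φ) fun b => auxRotation g' (if b then -φ else φ))
    (k : ℕ) (hk : 1 ≤ k) :
    ∃ φ : ℕ → ℝ, ∀ ψ : Conf N m → ℂ,
      star (embed false (tensor ψ (auxZero N m))) ⬝ᵥ
          ((shot (rotWire N m w) G Gt U R Rt φ k).mat *ᵥ embed false (tensor ψ (auxZero N m)))
        = star ψ ⬝ᵥ (H ^ k *ᵥ ψ) := by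
  rcases Nat.even_or_odd k with hev | hodd
  · obtain ⟨ω, hω, hF⟩ := exists_phases_even k hev hk
    -- The rotation by φ has eigenvalue e^{2iφ}, so φ is half the argument of the phase.
    refine ⟨fun j => Complex.arg (ω j) / 2, fun ψ => ?_⟩
    have hT := fun b b' ω' hω' => qsvtSteps_amplitude hU2 hg hg' hH hH' hU hR hRt
      (fun j => Complex.arg (ω j) / 2) b b' ψ ω' hω' k
    have h1 := fun b' => hT false b' ω fun j => by simpa using exp_arg_eq (hω j)
    have h2 := fun b' => hT true b' (fun j => (starRingEnd ℂ) (ω j))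
      fun j => by simpa using exp_neg_arg_eq (hω j)
    simp only [activeState, if_pos hev] at h1 h2
    have hinvh : Circuit.inv [Gate.h (rotWire N m w)] = [Gate.h (rotWire N m w)] := rfl
    have hrun : ∀ v w' : (Wire N m w → Bool) → ℂ,
        star v ⬝ᵥ (Gate.h (rotWire N m w)).run w' = star ((Gate.h (rotWire N m w)).run v) ⬝ᵥ w' := by
      intro v w'
      have := Circuit.dotProduct_run_inv [Gate.h (rotWire N m w)] v w'
      rw [hinvh] at this
      simpa using this
    have hr : ((1 / Real.sqrt 2 : ℝ) : ℂ) * ((1 / Real.sqrt 2 : ℝ) : ℂ) = 1 / 2 := by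
      rw [← Complex.ofReal_mul, div_mul_div_comm, Real.mul_self_sqrt (by norm_num)]; norm_num
    have hstar : star ((1 / Real.sqrt 2 : ℝ) : ℂ) = ((1 / Real.sqrt 2 : ℝ) : ℂ) :=
      Complex.conj_ofReal _
    rw [← Circuit.run_apply, shot, if_pos hev, if_pos hev]
    simp only [Circuit.run_append, Circuit.run_cons, Circuit.run_nil]
    rw [hrun, h_run_embed]
    generalize ((1 / Real.sqrt 2 : ℝ) : ℂ) = r at *
    rw [Circuit.dotProduct_run_inv]
    -- The cross terms between the two values of the rotation qubit vanish. The diagonal ones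
    -- contribute F and its conjugate polynomial, each with the factor 1/2 from the two Hadamard
    -- gates.
    simp only [map_smul, map_add, hG.run, star_smul, star_add, smul_dotProduct, dotProduct_smul,
      add_dotProduct, dotProduct_add, h1, h2, hstar, smul_eq_mul, if_true, Bool.true_eq_false,
      Bool.false_eq_true, if_false, add_zero, zero_add]
    rw [← mul_add, ← mul_assoc, hr, ← dotProduct_add, ← Matrix.add_mulVec, ← map_add, qspPair_conj, hF,
      map_mul, map_pow, aeval_X, map_ofNat, two_mul, Matrix.add_mulVec, dotProduct_add]
    ring
  · have hne : ¬ Even k := Nat.not_even_iff_odd.mpr hodd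
    obtain ⟨ω, hω, hF⟩ := exists_phases_odd k hodd
    refine ⟨fun j => Complex.arg (ω j) / 2, fun ψ => ?_⟩
    have h1 := qsvtSteps_amplitude hU2 hg hg' hH hH' hU hR hRt
      (fun j => Complex.arg (ω j) / 2) false false ψ ω
      (fun j => by simpa using exp_arg_eq (hω j)) k
    simp only [activeState, if_neg hne, if_true] at h1
    rw [← Circuit.run_apply, shot, if_neg hne, if_neg hne, List.nil_append, Circuit.run_append,
      Circuit.run_append, Circuit.dotProduct_run_inv, hG.run, hGt.run, h1, hF, map_pow, aeval_X]

/-- The gate cost of the measurement circuit in terms of the cost of its parts. -/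
theorem shot_length_le {ι : Type} (p : ι) (G Gt U : Circuit ι) (R Rt : ℝ → Circuit ι)
    (φ : ℕ → ℝ) (k D : ℕ) (hG : G.length ≤ D) (hGt : Gt.length ≤ D) (hU : U.length ≤ D)
    (hR : ∀ θ, (R θ).length ≤ D) (hRt : ∀ θ, (Rt θ).length ≤ D) :
    (shot p G Gt U R Rt φ k).length ≤ 2 + 2 * D + k * (2 * D) := by
  have hs : (qsvtSteps U R Rt φ k).length ≤ k * (2 * D) := by
    induction k with
    | zero => simp [qsvtSteps]
    | succ k ih =>
      have h1 := hR (φ k)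
      have h2 := hRt (φ k)
      have h3 : (Circuit.inv U).length = U.length := by simp [Circuit.inv]
      rw [qsvtSteps, List.length_append, Nat.succ_mul]
      split_ifs <;> rw [List.length_append] <;> omega
  have h3 : (Circuit.inv G).length = G.length := by simp [Circuit.inv]
  have h4 : (Circuit.inv Gt).length = Gt.length := by simp [Circuit.inv]
  rw [shot]
  split_ifs <;> simp only [List.length_append, List.length_cons, List.length_nil] <;> omega

end Shot

/-! ### Pauli operators and Pauli expansions -/

section Pauli

variable {N m : ℕ}

/-- The phase with which a one-qubit Pauli operator acts on a basis vector. -/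
noncomputable def pauliPhase (x z b : Bool) : ℂ :=
  (if x && z then Complex.I else 1) * (if z && b then -1 else 1)

theorem pauli_apply (p : Aux N m) (a b : Conf N m) : pauli p a b =
    if a = fun j => xor (b j) (p.1 j) then ∏ j, pauliPhase (p.1 j) (p.2 j) (b j) else 0 := by
  have h : ∀ x z s t : Bool, ((if x && z then Complex.I else 1) •
      ((if x then sigma1 else 1) * (if z then sigma3 else 1)) : Matrix Bool Bool ℂ) s t
      = if s = xor t x then pauliPhase x z t else 0 := by
    intro x z s t
    cases x <;> cases z <;> cases s <;> cases t <;>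
      simp [sigma1, sigma3, pauliPhase, Matrix.mul_apply]
  simp only [pauli, Matrix.of_apply, h]
  rw [Finset.prod_ite_zero]
  simp [funext_iff]

theorem pauliPhase_mul_self (x z b : Bool) :
    pauliPhase x z (xor b x) * pauliPhase x z b = 1 := by
  cases x <;> cases z <;> cases b <;> simp [pauliPhase]

theorem pauli_mul_apply (p q : Aux N m) (a b : Conf N m) : (pauli p * pauli q) a b =
    if a = fun j => xor (xor (b j) (q.1 j)) (p.1 j) then
      ∏ j, (pauliPhase (p.1 j) (p.2 j) (xor (b j) (q.1 j)) * pauliPhase (q.1 j) (q.2 j) (b j))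
    else 0 := by
  rw [Matrix.mul_apply, Finset.sum_eq_single fun j => xor (b j) (q.1 j)]
  · simp only [pauli_apply, if_true, Finset.prod_mul_distrib]
    split_ifs <;> simp
  · intro c _ hc
    rw [pauli_apply q, if_neg hc, mul_zero]
  · simp

theorem pauli_mul_self (p : Aux N m) : pauli p * pauli p = 1 := by
  ext a b
  rw [pauli_mul_apply, Matrix.one_apply]
  simp only [pauliPhase_mul_self, Bool.xor_assoc, Bool.xor_self, Bool.xor_false,
    Finset.prod_const_one]

/-- `blockU` is block diagonal in the label, with Pauli operators as blocks. -/
theorem blockU_mul_self : blockU N m * blockU N m = 1 := by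
  apply Matrix.toLin'.injective
  apply LinearMap.ext
  intro Ψ
  funext ⟨s, p⟩
  simp only [Matrix.toLin'_apply]
  rw [← Matrix.mulVec_mulVec, blockU_mulVec]
  simp only [blockU_mulVec]
  have := congrFun (congrArg (fun A => A *ᵥ fun t => Ψ (t, p)) (pauli_mul_self p)) s
  simp only [← Matrix.mulVec_mulVec, Matrix.one_mulVec] at this
  rw [Matrix.one_mulVec]
  simpa [Matrix.mulVec, dotProduct] using this

/-- Orthogonality of the Pauli basis: different x-parts leave nothing on the diagonal, and for equal
x-parts the trace factorises over the qubits. -/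
theorem trace_pauli_mul (p q : Aux N m) : Matrix.trace (pauli p * pauli q)
    = if p = q then 2 ^ Fintype.card (Qubit N m) else 0 := by
  have hp : ∀ a : Conf N m, (a = fun j => xor (xor (a j) (q.1 j)) (p.1 j)) ↔ p.1 = q.1 := by
    intro a
    simp only [funext_iff]
    refine forall_congr' fun j => ?_
    cases a j <;> cases q.1 j <;> cases p.1 j <;> simp
  simp only [Matrix.trace, Matrix.diag_apply, pauli_mul_apply, hp]
  by_cases hx : p.1 = q.1
  · simp only [hx, if_true]
    rw [← Fintype.piFinset_univ, ← Finset.prod_univ_sum (fun _ => Finset.univ) fun j b =>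
      pauliPhase (q.1 j) (p.2 j) (xor b (q.1 j)) * pauliPhase (q.1 j) (q.2 j) b]
    have h : ∀ x z z' : Bool, ∑ b, pauliPhase x z (xor b x) * pauliPhase x z' b
        = if z = z' then 2 else 0 := by
      intro x z z'
      rw [Fintype.sum_bool]
      cases x <;> cases z <;> cases z' <;> simp [pauliPhase] <;> norm_num
    simp only [h]
    rw [Finset.prod_ite_zero]
    have : (∀ i ∈ Finset.univ, p.2 i = q.2 i) ↔ p = q := by
      rw [Prod.ext_iff, funext_iff (f := p.2)]; simp [hx]
    simp only [this, Finset.prod_const, Finset.card_univ]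
  · have : p ≠ q := fun h => hx (by rw [h])
    simp [hx, this]

theorem pauliCoeff_smul (r : ℝ) (A : Matrix (Conf N m) (Conf N m) ℂ) (p : Aux N m) :
    pauliCoeff ((r : ℂ) • A) p = r * pauliCoeff A p := by
  rw [pauliCoeff, pauliCoeff, Matrix.mul_smul, Matrix.trace_smul, smul_eq_mul,
    Complex.re_ofReal_mul, mul_div_assoc]

theorem pauliCoeff_sum {K : Type*} [Fintype K] (wt : K → ℝ) (l : K → Aux N m) (p : Aux N m) :
    pauliCoeff (∑ k, (wt k : ℂ) • pauli (l k)) p = ∑ k, if l k = p then wt k else 0 := by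
  rw [pauliCoeff, Finset.mul_sum, Matrix.trace_sum, Complex.re_sum, Finset.sum_div]
  refine Finset.sum_congr rfl fun k _ => ?_
  rw [Matrix.mul_smul, Matrix.trace_smul, smul_eq_mul, Complex.re_ofReal_mul, trace_pauli_mul]
  by_cases h : l k = p
  · rw [if_pos h.symm, if_pos h]
    have : ((2 : ℂ) ^ Fintype.card (Qubit N m)).re = 2 ^ Fintype.card (Qubit N m) := by
      rw [← Complex.ofReal_ofNat, ← Complex.ofReal_pow, Complex.ofReal_re]
    rw [this, mul_div_assoc, div_self (by positivity), mul_one]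
  · rw [if_neg (Ne.symm h), if_neg h]; simp

theorem sum_pauliCoeff_smul_pauli {K : Type*} [Fintype K] (wt : K → ℝ) (l : K → Aux N m) :
    ∑ p, (pauliCoeff (∑ k, (wt k : ℂ) • pauli (l k)) p : ℂ) • pauli p
      = ∑ k, (wt k : ℂ) • pauli (l k) := by
  simp only [pauliCoeff_sum]
  push_cast
  simp only [Finset.sum_smul]
  rw [Finset.sum_comm]
  refine Finset.sum_congr rfl fun k _ => ?_
  rw [Finset.sum_eq_single (l k)]
  · simp
  · intro p _ hp; simp [Ne.symm hp]
  · simp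

/-- At most one of the terms with a given label contributes. -/
theorem map_sum_ite_of_injOn {K L β γ : Type*} [Fintype K] [DecidableEq L] [AddCommMonoid β]
    [AddCommMonoid γ] (wt : K → β) (l : K → L)
    (hl : ∀ k k', wt k ≠ 0 → wt k' ≠ 0 → l k = l k' → k = k') (g : β → γ) (hg : g 0 = 0) (p : L) :
    g (∑ k, if l k = p then wt k else 0) = ∑ k, if l k = p then g (wt k) else 0 := by
  classical
  by_cases h : ∃ k, l k = p ∧ wt k ≠ 0
  · obtain ⟨k, hk, hw⟩ := h
    have h0 : ∀ k', k' ≠ k → l k' = p → wt k' = 0 := by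
      intro k' hne hk'
      by_contra hw'
      exact hne (hl k' k hw' hw (hk'.trans hk.symm))
    rw [Finset.sum_eq_single k, Finset.sum_eq_single k, if_pos hk, if_pos hk]
    · intro k' _ hne
      split_ifs with hk'
      · rw [h0 k' hne hk', hg]
      · rfl
    · simp
    · intro k' _ hne
      split_ifs with hk'
      · exact h0 k' hne hk'
      · rfl
    · simp
  · push Not at h
    have h1 : (∑ k, if l k = p then wt k else 0) = 0 :=
      Finset.sum_eq_zero fun k _ => by split_ifs with hk; exacts [h k hk, rfl]
    rw [h1, hg]
    refine (Finset.sum_eq_zero fun k _ => ?_).symm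
    split_ifs with hk
    · rw [h k hk, hg]
    · rfl

/-- The block encoding identity, a linear combination of unitaries. It only sees the products of the
amplitudes, so the sign of a coefficient may sit in either state. -/
theorem blockU_contract {A : Matrix (Conf N m) (Conf N m) ℂ} {α : Aux N m → ℂ} {g g' : Aux N m → ℂ}
    (hA : ∑ p, α p • pauli p = A) (hα : ∀ p, star (g' p) * g p = α p) (ψ : Conf N m → ℂ) :
    auxContract g' (blockU N m *ᵥ tensor ψ g) = A *ᵥ ψ := by
  funext s
  simp only [auxContract, blockU_mulVec]
  simp only [tensor, ← hA, Matrix.mulVec, dotProduct,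
    Matrix.sum_apply, Matrix.smul_apply, smul_eq_mul, ← hα, Finset.mul_sum, Finset.sum_mul]
  rw [Finset.sum_comm]
  refine Finset.sum_congr rfl fun t _ => Finset.sum_congr rfl fun p _ => ?_
  ring

section States

variable {μ x : ℝ}

theorem sum_abs_pauliCoeff (h : pauliNorm N m μ x ≠ 0) :
    ∑ p, |pauliCoeff (normHam N m μ x) p| = 1 := by
  have h0 : 0 ≤ pauliNorm N m μ x := Finset.sum_nonneg fun p _ => abs_nonneg _
  simp only [normHam, pauliCoeff_smul, abs_mul, ← Finset.mul_sum]
  rw [abs_of_nonneg (inv_nonneg.mpr h0)]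
  exact inv_mul_cancel₀ h

theorem stateG_norm (h : pauliNorm N m μ x ≠ 0) :
    star (stateG N m μ x) ⬝ᵥ stateG N m μ x = 1 := by
  simp only [dotProduct, Pi.star_apply, stateG, Complex.star_def, Complex.conj_ofReal,
    ← Complex.ofReal_mul]
  rw [← Complex.ofReal_sum, ← Complex.ofReal_one, ← sum_abs_pauliCoeff h]
  congr 1
  exact Finset.sum_congr rfl fun p _ => Real.mul_self_sqrt (abs_nonneg _)

theorem sign_mul_sign_mul_abs (a : ℝ) : Real.sign a * (Real.sign a * |a|) = |a| := by
  rcases lt_trichotomy a 0 with h | h | h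
  · rw [Real.sign_of_neg h]; ring
  · simp [h]
  · rw [Real.sign_of_pos h]; ring

theorem sign_mul_abs' (a : ℝ) : Real.sign a * |a| = a := by
  rcases lt_trichotomy a 0 with h | h | h
  · rw [Real.sign_of_neg h, abs_of_neg h]; ring
  · simp [h]
  · rw [Real.sign_of_pos h, abs_of_pos h]; ring

theorem stateGt_norm (h : pauliNorm N m μ x ≠ 0) :
    star (stateGt N m μ x) ⬝ᵥ stateGt N m μ x = 1 := by
  simp only [dotProduct, Pi.star_apply, stateGt, Complex.star_def, Complex.conj_ofReal,
    ← Complex.ofReal_mul]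
  rw [← Complex.ofReal_sum, ← Complex.ofReal_one, ← sum_abs_pauliCoeff h]
  congr 1
  refine Finset.sum_congr rfl fun p _ => ?_
  refine Eq.trans ?_ (sign_mul_sign_mul_abs _)
  have := Real.mul_self_sqrt (abs_nonneg (pauliCoeff (normHam N m μ x) p))
  linear_combination (Real.sign (pauliCoeff (normHam N m μ x) p)) ^ 2 * this

theorem stateGt_mul_stateG (p : Aux N m) : star (stateGt N m μ x p) * stateG N m μ x p
    = (pauliCoeff (normHam N m μ x) p : ℂ) := by
  simp only [stateG, stateGt, Complex.star_def, Complex.conj_ofReal, ← Complex.ofReal_mul]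
  congr 1
  rw [mul_assoc, Real.mul_self_sqrt (abs_nonneg _), sign_mul_abs']

theorem stateG_mul_stateGt (p : Aux N m) : star (stateG N m μ x p) * stateGt N m μ x p
    = (pauliCoeff (normHam N m μ x) p : ℂ) := by
  rw [← stateGt_mul_stateG]
  simp only [stateG, stateGt, Complex.star_def, Complex.conj_ofReal]
  ring

end States

end Pauli

/-! ### Binary increment -/

section Binary

/-- The value of a string of binary digits. -/
def binValue {m : ℕ} (β : Fin m → Bool) : ℕ := ∑ j : Fin m, if β j then 2 ^ (j : ℕ) else 0

theorem binValue_succ {m : ℕ} (β : Fin (m + 1) → Bool) :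
    binValue β = binValue (fun j : Fin m => β j.castSucc) + if β (Fin.last m) then 2 ^ m else 0 := by
  simp [binValue, Fin.sum_univ_castSucc]

theorem binValue_lt {m : ℕ} (β : Fin m → Bool) : binValue β < 2 ^ m := by
  induction m with
  | zero => simp [binValue]
  | succ m ih =>
    rw [binValue_succ, pow_succ]
    have := ih fun j => β j.castSucc
    split_ifs <;> omega

theorem binValue_injective {m : ℕ} : Function.Injective (binValue (m := m)) := by
  induction m with
  | zero => intro α β _; exact Subsingleton.elim _ _
  | succ m ih =>
    intro α β h
    rw [binValue_succ, binValue_succ] at h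
    have h1 := binValue_lt fun j : Fin m => α j.castSucc
    have h2 := binValue_lt fun j : Fin m => β j.castSucc
    have h3 : α (Fin.last m) = β (Fin.last m) := by
      rcases ha : α (Fin.last m) <;> rcases hb : β (Fin.last m) <;> simp [ha, hb] at h ⊢ <;> omega
    rw [h3, Nat.add_right_cancel_iff] at h
    have h4 := ih h
    funext j
    induction j using Fin.lastCases with
    | last => exact h3
    | cast j => exact congrFun h4 j

theorem sum_two_pow_lt {m : ℕ} (r : ℕ) (hr : r ≤ m) :
    (∑ j : Fin m, if (j : ℕ) < r then 2 ^ (j : ℕ) else 0) + 1 = 2 ^ r := by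
  induction m generalizing r with
  | zero => obtain rfl : r = 0 := by omega
            simp
  | succ m ih =>
    rw [Fin.sum_univ_castSucc]
    rcases Nat.lt_or_ge m r with h | h
    · obtain rfl : r = m + 1 := by omega
      have h1 := ih m le_rfl
      simp only [Fin.val_castSucc, Fin.val_last, Fin.is_lt, if_true, Nat.lt_succ_self,
        Nat.lt_succ_of_lt] at h1 ⊢
      rw [pow_succ]; omega
    · have h1 := ih r h
      simp only [Fin.val_castSucc, Fin.val_last]
      rw [if_neg (by omega)]; omega

/-- The string `α` arises from `β` by an increment that flips the digits `0, …, r`. -/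
def IncAt {m : ℕ} (α β : Fin m → Bool) (r : Fin m) : Prop :=
  (∀ j, α j = xor (β j) (decide (j ≤ r))) ∧ (∀ j < r, β j = true) ∧
    ((r : ℕ) + 1 < m → β r = false)

theorem IncAt.binValue_eq {m : ℕ} {α β : Fin m → Bool} {r : Fin m} (h : IncAt α β r) :
    binValue α = (binValue β + 1) % 2 ^ m := by
  obtain ⟨h1, h2, h3⟩ := h
  have hs := sum_two_pow_lt (m := m) r r.2.le
  rcases hr : β r
  -- Ordinary carry: the ones below r, with total value 2^r − 1, are replaced by the digit r.
  · have key : binValue α + (∑ j : Fin m, if (j : ℕ) < r then 2 ^ (j : ℕ) else 0)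
        = binValue β + 2 ^ (r : ℕ) := by
      have e : (2 : ℕ) ^ (r : ℕ) = ∑ j : Fin m, if j = r then 2 ^ (j : ℕ) else 0 := by simp
      rw [e, binValue, binValue, ← Finset.sum_add_distrib, ← Finset.sum_add_distrib]
      refine Finset.sum_congr rfl fun j _ => ?_
      rw [h1 j]
      rcases lt_trichotomy j r with hj | hj | hj
      · have hj' : (j : ℕ) < r := hj
        simp [h2 j hj, hj.le, hj.ne, hj']
      · subst hj; simp [hr]
      · have hj' : ¬ (j : ℕ) < r := not_lt.mpr hj.le
        simp [hj.not_ge, hj.ne', hj']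
    rw [Nat.mod_eq_of_lt]
    · omega
    · have := binValue_lt α; omega
  -- A one at r is admitted only at the top digit. Then all digits are one, and the value wraps
  -- around to 0.
  · have hm : (r : ℕ) + 1 = m := by
      by_contra hne
      have := h3 (by omega)
      rw [hr] at this
      cases this
    have hle : ∀ j : Fin m, j ≤ r := fun j => Fin.le_def.mpr (by have := j.2; omega)
    have hb : ∀ j, β j = true := by
      intro j
      rcases (hle j).lt_or_eq with hj | hj
      · exact h2 j hj
      · rw [hj, hr]
    have ha : ∀ j, α j = false := by intro j; rw [h1 j, hb j]; simp [hle j]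
    have e1 : binValue α = 0 := by simp [binValue, ha]
    have e2 : binValue β + 1 = 2 ^ m := by
      have := sum_two_pow_lt (m := m) m le_rfl
      simp only [Fin.is_lt, if_true] at this
      simp only [binValue, hb, if_true]
      exact this
    rw [e1, e2, Nat.mod_self]

/-- The carry stops at the lowest zero digit, or at the top digit if there is none. -/
theorem exists_incAt {m : ℕ} (hm : 0 < m) (β : Fin m → Bool) : ∃ (α : Fin m → Bool) (r : Fin m),
    IncAt α β r := by
  by_cases h : ∃ j, β j = false
  · obtain ⟨r, hr, hmin⟩ := wellFounded_lt.has_min {j | β j = false} h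
    refine ⟨_, r, fun j => rfl, fun j hj => ?_, fun _ => hr⟩
    by_contra hne
    exact hmin j (Bool.eq_false_iff.mpr hne) hj
  · push Not at h
    refine ⟨_, ⟨m - 1, by omega⟩, fun j => rfl, fun j _ => by simpa using h j, fun hlt => ?_⟩
    simp only at hlt
    omega

theorem binValue_eq_iff {m : ℕ} (hm : 0 < m) (α β : Fin m → Bool) :
    binValue α = (binValue β + 1) % 2 ^ m ↔ ∃ r, IncAt α β r := by
  constructor
  · intro h
    obtain ⟨α', r, h'⟩ := exists_incAt hm β
    have : α = α' := binValue_injective (h.trans h'.binValue_eq.symm)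
    exact ⟨r, this ▸ h'⟩
  · rintro ⟨r, h⟩; exact h.binValue_eq

theorem IncAt.unique {m : ℕ} {α β : Fin m → Bool} {r r' : Fin m} (h : IncAt α β r)
    (h' : IncAt α β r') : r = r' := by
  have key : ∀ j, (j ≤ r ↔ j ≤ r') := by
    intro j
    have := (h.1 j).symm.trans (h'.1 j)
    have h2 : decide (j ≤ r) = decide (j ≤ r') := by
      rcases β j <;> simpa using this
    simpa using h2
  exact le_antisymm ((key r).mp le_rfl) ((key r').mpr le_rfl)

end Binary

/-! ### Pauli expansion of the hopping terms -/

section Hopping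

variable {N m : ℕ}

/-- The indicator function of a set of qubits. -/
def ind (S : Finset (Qubit N m)) : Conf N m := fun q => decide (q ∈ S)

/-- The qubits that are flipped when the link `n` is raised with carries up to digit `r`. -/
def hopX (n : Fin (N - 1)) (r : Fin m) : Finset (Qubit N m) :=
  Finset.univ.filter fun q => Sum.elim (fun i => decide (i = leftSite n ∨ i = rightSite n))
    (fun p => decide (p.1 = n ∧ p.2 ≤ r)) q

/-- The qubits on which the hopping term depends. -/
def hopZ (n : Fin (N - 1)) (r : Fin m) : Finset (Qubit N m) :=
  Finset.univ.filter fun q => Sum.elim (fun i => decide (i = leftSite n ∨ i = rightSite n))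
    (fun p => decide (p.1 = n ∧ p.2 ≤ r ∧ (p.2 : ℕ) + 1 < m)) q

/-- The initial values of these qubits. -/
def hopU (n : Fin (N - 1)) (r : Fin m) : Conf N m :=
  Sum.elim (fun i => decide (i = leftSite n)) fun p => decide (p.2 < r)

@[simp] theorem mem_hopX_inl (n : Fin (N - 1)) (r : Fin m) (i : Fin N) :
    Sum.inl i ∈ hopX n r ↔ i = leftSite n ∨ i = rightSite n := by simp [hopX]

@[simp] theorem mem_hopX_inr (n : Fin (N - 1)) (r : Fin m) (p : Fin (N - 1) × Fin m) :
    Sum.inr p ∈ hopX n r ↔ p.1 = n ∧ p.2 ≤ r := by simp [hopX]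

@[simp] theorem mem_hopZ_inl (n : Fin (N - 1)) (r : Fin m) (i : Fin N) :
    Sum.inl i ∈ hopZ n r ↔ i = leftSite n ∨ i = rightSite n := by simp [hopZ]

@[simp] theorem mem_hopZ_inr (n : Fin (N - 1)) (r : Fin m) (p : Fin (N - 1) × Fin m) :
    Sum.inr p ∈ hopZ n r ↔ p.1 = n ∧ p.2 ≤ r ∧ (p.2 : ℕ) + 1 < m := by simp [hopZ]

theorem hopZ_subset_hopX (n : Fin (N - 1)) (r : Fin m) : hopZ n r ⊆ hopX n r := by
  rintro (i | p) h
  · simpa using h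
  · rw [mem_hopZ_inr] at h
    rw [mem_hopX_inr]
    exact ⟨h.1, h.2.1⟩

theorem leftSite_ne_rightSite (n : Fin (N - 1)) : leftSite n ≠ rightSite n := by
  intro h
  have := congrArg Fin.val h
  simp [leftSite, rightSite] at this

theorem onWire_mul_apply {ι : Type} [Fintype ι] [DecidableEq ι] (q : ι) (A : Matrix Bool Bool ℂ)
    (M : Matrix (ι → Bool) (ι → Bool) ℂ) (a b : ι → Bool) : (onWire q A * M) a b
      = A (a q) false * M (Function.update a q false) b
        + A (a q) true * M (Function.update a q true) b :=
  onWire_mulVec q A (fun c => M c b) a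

theorem mul_onWire_apply {ι : Type} [Fintype ι] [DecidableEq ι] (q : ι) (A : Matrix Bool Bool ℂ)
    (M : Matrix (ι → Bool) (ι → Bool) ℂ) (a b : ι → Bool) : (M * onWire q A) a b
      = M a (Function.update b q false) * A false (b q)
        + M a (Function.update b q true) * A true (b q) := by
  have h := congrFun (congrFun (congrArg Matrix.conjTranspose
    (Matrix.conjTranspose_mul M (onWire q A))) a) b
  rw [Matrix.conjTranspose_conjTranspose] at h
  rw [h, Matrix.conjTranspose_apply, onWire_conjTranspose, onWire_mul_apply]
  simp [Matrix.conjTranspose_apply, mul_comm]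

theorem sigmaPlus_apply (a b : Bool) : sigmaPlus a b = if a = false ∧ b = true then 1 else 0 := by
  have := Complex.I_mul_I
  cases a <;> cases b <;> simp [sigmaPlus, sigma1, sigma2]; norm_num

theorem sigmaMinus_apply (a b : Bool) : sigmaMinus a b = if a = true ∧ b = false then 1 else 0 := by
  have := Complex.I_mul_I
  cases a <;> cases b <;> simp [sigmaMinus, sigma1, sigma2]; norm_num

theorem hop_apply_eq_ite (n : Fin (N - 1)) (a b : Conf N m) : hop N m n a b =
    if a (Sum.inl (leftSite n)) = false ∧ b (Sum.inl (rightSite n)) = false ∧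
      (∀ q : Qubit N m, (∀ j : Fin m, q ≠ Sum.inr (n, j)) →
        Function.update a (Sum.inl (leftSite n)) true q
          = Function.update b (Sum.inl (rightSite n)) true q) ∧
      binValue (fun j => a (Sum.inr (n, j))) = (binValue (fun j => b (Sum.inr (n, j))) + 1) % 2 ^ m
    then 1 else 0 := by
  have hl : ∀ (c : Conf N m) (i : Fin N) (t : Bool),
      linkValue (Function.update c (Sum.inl i) t) n = binValue fun j => c (Sum.inr (n, j)) := by
    intro c i t; simp [linkValue, binValue]
  rw [hop, mul_onWire_apply, onWire_mul_apply, onWire_mul_apply]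
  simp only [sigmaPlus_apply, sigmaMinus_apply, raise, Matrix.of_apply, hl]
  by_cases h1 : a (Sum.inl (leftSite n)) = false <;>
    by_cases h2 : b (Sum.inl (rightSite n)) = false <;> simp [h1, h2]

theorem ite_exists_eq_sum {K : Type*} [Fintype K] (P : Prop) (Q : K → Prop)
    (hQ : ∀ r r', Q r → Q r' → r = r') [Decidable (P ∧ ∃ r, Q r)] [∀ r, Decidable (P ∧ Q r)] :
    (if P ∧ ∃ r, Q r then (1 : ℂ) else 0) = ∑ r, if P ∧ Q r then 1 else 0 := by
  by_cases h : P ∧ ∃ r, Q r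
  · obtain ⟨hP, r, hr⟩ := id h
    rw [if_pos h, Finset.sum_eq_single r, if_pos ⟨hP, hr⟩]
    · intro r' _ hne
      exact if_neg fun h' => hne (hQ _ _ h'.2 hr)
    · simp
  · rw [if_neg h]
    exact (Finset.sum_eq_zero fun r _ => if_neg fun h' => h ⟨h'.1, r, h'.2⟩).symm

/-- The increment is a disjoint union over the digit r at which the carry stops. For each r a fixed
set of qubits is flipped, provided that certain qubits have prescribed values. If r is the top
digit, its own value is free because the increment is cyclic; this is why `hopZ` leaves it out. -/
theorem hop_apply (hm : 0 < m) (n : Fin (N - 1)) (a b : Conf N m) : hop N m n a b =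
    ∑ r : Fin m, if (a = fun q => xor (b q) (ind (hopX n r) q)) ∧ ∀ q ∈ hopZ n r, b q = hopU n r q
      then 1 else 0 := by
  classical
  have hlr := leftSite_ne_rightSite n
  have key : ∀ r : Fin m, ((a = fun q => xor (b q) (ind (hopX n r) q)) ∧
      ∀ q ∈ hopZ n r, b q = hopU n r q) ↔
      (a (Sum.inl (leftSite n)) = false ∧ b (Sum.inl (rightSite n)) = false ∧
      (∀ q : Qubit N m, (∀ j : Fin m, q ≠ Sum.inr (n, j)) →
        Function.update a (Sum.inl (leftSite n)) true q
          = Function.update b (Sum.inl (rightSite n)) true q)) ∧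
      IncAt (fun j => a (Sum.inr (n, j))) (fun j => b (Sum.inr (n, j))) r := by
    intro r
    constructor
    · rintro ⟨h1, h2⟩
      have hL := h2 (Sum.inl (leftSite n)) (by simp)
      have hR := h2 (Sum.inl (rightSite n)) (by simp)
      simp only [hopU, Sum.elim_inl, decide_true, hlr.symm, decide_false] at hL hR
      refine ⟨⟨?_, hR, ?_⟩, fun j => ?_, fun j hj => ?_, fun hr => ?_⟩
      · rw [h1]; simp [ind, hL]
      · rintro (i | p) hq
        · by_cases hi : i = leftSite n
          · subst hi
            rw [Function.update_self, Function.update_of_ne (by simpa using hlr), hL]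
          · rw [Function.update_of_ne (by simpa using hi)]
            by_cases hi' : i = rightSite n
            · subst hi'
              rw [Function.update_self, h1]; simp [ind, hR]
            · rw [Function.update_of_ne (by simpa using hi'), h1]
              simp [ind, hi, hi']
        · have hp : p.1 ≠ n := fun e => hq p.2 (by rw [← e])
          rw [Function.update_of_ne (by simp), Function.update_of_ne (by simp), h1]
          simp [ind, hp]
      · rw [h1]; simp [ind]
      · have hj' : (j : ℕ) < r := hj
        have := h2 (Sum.inr (n, j)) (by simp [hj.le]; have := r.2; omega)
        exact this.trans (by simp [hopU, hj])
      · have := h2 (Sum.inr (n, r)) (by simp [hr])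
        exact this.trans (by simp [hopU])
    · rintro ⟨⟨h1, h2, h3⟩, h4, h5, h6⟩
      have hbL : b (Sum.inl (leftSite n)) = true := by
        have := h3 (Sum.inl (leftSite n)) (by simp)
        rw [Function.update_self, Function.update_of_ne (by simpa using hlr)] at this
        exact this.symm
      have haR : a (Sum.inl (rightSite n)) = true := by
        have := h3 (Sum.inl (rightSite n)) (by simp)
        rwa [Function.update_self, Function.update_of_ne (by simpa using hlr.symm)] at this
      constructor
      · funext q
        rcases q with i | p
        · by_cases hi : i = leftSite n
          · subst hi; simp [ind, h1, hbL]
          · by_cases hi' : i = rightSite n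
            · subst hi'; simp [ind, haR, h2]
            · have := h3 (Sum.inl i) (by simp)
              rw [Function.update_of_ne (by simpa using hi),
                Function.update_of_ne (by simpa using hi')] at this
              simp [ind, hi, hi', this]
        · obtain ⟨n', j⟩ := p
          by_cases hp : n' = n
          · subst hp
            have := h4 j
            simp only at this
            simp [ind, this]
          · have := h3 (Sum.inr (n', j)) (by
              intro j' e
              exact hp (congrArg Prod.fst (Sum.inr.inj e)))
            rw [Function.update_of_ne (by simp), Function.update_of_ne (by simp)] at this
            simp [ind, hp, this]
      · rintro (i | ⟨n', j⟩) hq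
        · rw [mem_hopZ_inl] at hq
          rcases hq with rfl | rfl
          · simp [hopU, hbL]
          · simp [hopU, h2, hlr.symm]
        · rw [mem_hopZ_inr] at hq
          simp only at hq
          obtain ⟨rfl, hj, hjm⟩ := hq
          rcases hj.lt_or_eq with hlt | rfl
          · exact (h5 j hlt).trans (by simp [hopU, hlt])
          · exact (h6 hjm).trans (by simp [hopU])
  rw [hop_apply_eq_ite, if_congr ((and_congr_right fun _ => and_congr_right fun _ =>
    and_congr_right fun _ => binValue_eq_iff hm _ _).trans (by rw [← and_assoc, ← and_assoc,
      and_assoc (b := b (Sum.inl (rightSite n)) = false)])) rfl rfl,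
    Finset.sum_congr rfl fun r _ => if_congr (key r) rfl rfl]
  exact ite_exists_eq_sum _ _ fun r r' h h' => h.unique h'

end Hopping

/-! ### Hopping terms as signed sums of Pauli operators -/

section Expansion

variable {N m : ℕ}

/-- The sign `±1` of a binary digit. -/
def digitSign (b : Bool) : ℂ := if b then -1 else 1

/-- The phase with which a Pauli operator `Y` enters a hopping term. -/
noncomputable def hopPhase (n : Fin (N - 1)) (r : Fin m) (q : Qubit N m) : ℂ :=
  if hopU n r q then Complex.I else -Complex.I

/-- The sign of a Pauli operator in a hopping term. -/
noncomputable def hopSign (n : Fin (N - 1)) (r : Fin m) (t : Finset (Qubit N m)) : ℝ :=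
  (∏ q ∈ t, hopPhase n r q).re

/-- An even number of factors ±i gives ±1, so taking the real part in `hopSign` loses nothing. -/
theorem hopSign_eq (n : Fin (N - 1)) (r : Fin m) {t : Finset (Qubit N m)} (ht : Even t.card) :
    ∏ q ∈ t, hopPhase n r q = (hopSign n r t : ℂ) ∧ (hopSign n r t = 1 ∨ hopSign n r t = -1) := by
  have h1 : ∏ q ∈ t, hopPhase n r q = Complex.I ^ t.card * ∏ q ∈ t, (if hopU n r q then 1 else -1) := by
    rw [← Finset.prod_const, ← Finset.prod_mul_distrib]
    refine Finset.prod_congr rfl fun q _ => ?_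
    unfold hopPhase
    split_ifs <;> simp
  have h2 : ∀ S : Finset (Qubit N m), (∏ q ∈ S, (if hopU n r q then (1 : ℂ) else -1)) = 1 ∨
      (∏ q ∈ S, (if hopU n r q then (1 : ℂ) else -1)) = -1 := by
    intro S
    induction S using Finset.induction_on with
    | empty => simp
    | insert q S hq ih =>
      rw [Finset.prod_insert hq]
      split_ifs <;> rcases ih with h | h <;> simp [h]
  obtain ⟨j, hj⟩ := ht
  have h3 : Complex.I ^ t.card = 1 ∨ Complex.I ^ t.card = -1 := by
    rw [hj, ← two_mul, pow_mul, Complex.I_sq]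
    rcases Nat.even_or_odd j with h | h
    · left; exact h.neg_one_pow
    · right; exact h.neg_one_pow
  have h4 : ∏ q ∈ t, hopPhase n r q = 1 ∨ ∏ q ∈ t, hopPhase n r q = -1 := by
    rw [h1]
    rcases h2 t with h | h <;> rcases h3 with h' | h' <;> simp [h, h']
  unfold hopSign
  rcases h4 with h | h <;> rw [h] <;> simp

/-- Changing the sign of f changes the sign of the odd subsets, so the average of the two full
products keeps the even ones. -/
theorem sum_even_powerset {α : Type*} [DecidableEq α] (W : Finset α) (f : α → ℂ) :
    ∑ t ∈ W.powerset, (if Even t.card then ∏ q ∈ t, f q else 0)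
      = (∏ q ∈ W, (1 + f q) + ∏ q ∈ W, (1 - f q)) / 2 := by
  have h1 : ∏ q ∈ W, (1 + f q) = ∑ t ∈ W.powerset, ∏ q ∈ t, f q := Finset.prod_one_add _
  have h2 : ∏ q ∈ W, (1 - f q) = ∑ t ∈ W.powerset, (-1) ^ t.card * ∏ q ∈ t, f q := by
    simp only [sub_eq_add_neg]
    rw [Finset.prod_one_add]
    refine Finset.sum_congr rfl fun t _ => ?_
    rw [Finset.prod_neg]
  rw [h1, h2, ← Finset.sum_add_distrib, Finset.sum_div]
  refine Finset.sum_congr rfl fun t _ => ?_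
  split_ifs with h
  · rw [h.neg_one_pow]; ring
  · rw [(Nat.not_even_iff_odd.mp h).neg_one_pow]; ring

theorem prod_one_add_digitSign {α : Type*} (W : Finset α) (d : α → Bool) :
    ∏ q ∈ W, (1 + digitSign (d q)) = if ∀ q ∈ W, d q = false then 2 ^ W.card else 0 := by
  have : ∀ q, 1 + digitSign (d q) = if d q = false then 2 else 0 := by
    intro q; unfold digitSign; rcases d q <;> norm_num
  simp only [this]
  rw [Finset.prod_ite_zero, Finset.prod_const]

theorem prod_one_sub_digitSign {α : Type*} (W : Finset α) (d : α → Bool) :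
    ∏ q ∈ W, (1 - digitSign (d q)) = if ∀ q ∈ W, d q = true then 2 ^ W.card else 0 := by
  have : ∀ q, 1 - digitSign (d q) = if d q = true then 2 else 0 := by
    intro q; unfold digitSign; rcases d q <;> norm_num
  simp only [this]
  rw [Finset.prod_ite_zero, Finset.prod_const]

theorem prod_ite_mem_eq {α : Type*} [Fintype α] [DecidableEq α] (t : Finset α) (f : α → ℂ) :
    ∏ q, (if q ∈ t then f q else 1) = ∏ q ∈ t, f q := by
  rw [Finset.prod_ite_mem, Finset.univ_inter]

theorem pauli_ind_apply (S t : Finset (Qubit N m)) (h : t ⊆ S) (a b : Conf N m) :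
    pauli (ind S, ind t) a b = if a = fun q => xor (b q) (ind S q) then
      ∏ q ∈ t, (Complex.I * digitSign (b q)) else 0 := by
  rw [pauli_apply, ← prod_ite_mem_eq t]
  congr 1
  refine Finset.prod_congr rfl fun q _ => ?_
  by_cases hq : q ∈ t
  · simp [ind, hq, h hq, pauliPhase, digitSign]
  · simp [ind, hq, pauliPhase]

theorem pauli_empty_ind (t : Finset (Qubit N m)) :
    pauli (ind ∅, ind t) = Matrix.diagonal fun b => ∏ q ∈ t, digitSign (b q) := by
  ext a b
  rw [pauli_apply, Matrix.diagonal_apply]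
  have e : (fun j => xor (b j) (ind (∅ : Finset (Qubit N m)) j)) = b := by
    funext j; simp [ind]
  simp only [e]
  by_cases h : a = b
  · subst h
    rw [if_pos rfl, if_pos rfl, ← prod_ite_mem_eq t]
    refine Finset.prod_congr rfl fun q _ => ?_
    by_cases hq : q ∈ t
    · simp [ind, hq, pauliPhase, digitSign]
    · simp [ind, hq, pauliPhase]
  · rw [if_neg h, if_neg h]

/-- The weight of a Pauli operator in a hopping term. -/
noncomputable def hopWeight (n : Fin (N - 1)) (r : Fin m) (t : Finset (Qubit N m)) : ℝ :=
  if t ⊆ hopZ n r ∧ Even t.card then 2 / 2 ^ (hopZ n r).card * hopSign n r t else 0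

/-- The projector onto prescribed bits is a product of factors (1 ± Z)/2, and the projector onto the
complementary bits has the opposite signs. In their sum the odd products of Z cancel and the even
ones double; with the flips, each such Z becomes a Y up to the phase `hopPhase`. -/
theorem sum_hopWeight_pauli (n : Fin (N - 1)) (r : Fin m) (a b : Conf N m) :
    ∑ t, (hopWeight n r t : ℂ) * pauli (ind (hopX n r), ind t) a b
      = if a = fun q => xor (b q) (ind (hopX n r) q) then
          (if ∀ q ∈ hopZ n r, b q = hopU n r q then 1 else 0)
            + (if ∀ q ∈ hopZ n r, b q = !hopU n r q then 1 else 0) else 0 := by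
  have h1 : ∀ t, (hopWeight n r t : ℂ) * pauli (ind (hopX n r), ind t) a b =
      if t ∈ (hopZ n r).powerset then (if a = fun q => xor (b q) (ind (hopX n r) q) then
        2 / 2 ^ (hopZ n r).card * (if Even t.card then
          ∏ q ∈ t, digitSign (xor (b q) (hopU n r q)) else 0) else 0) else 0 := by
    intro t
    simp only [Finset.mem_powerset]
    unfold hopWeight
    by_cases h : t ⊆ hopZ n r
    · rw [pauli_ind_apply _ _ (h.trans (hopZ_subset_hopX n r))]
      by_cases he : Even t.card
      · rw [if_pos ⟨h, he⟩, if_pos h, if_pos he]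
        split_ifs
        · push_cast
          rw [← (hopSign_eq n r he).1, mul_assoc, ← Finset.prod_mul_distrib]
          congr 1
          refine Finset.prod_congr rfl fun q _ => ?_
          have := Complex.I_mul_I
          unfold hopPhase digitSign
          rcases hopU n r q <;> rcases b q <;> simp
        · simp
      · rw [if_neg (fun h => he h.2), if_neg he]; simp
    · rw [if_neg (fun h' => h h'.1), if_neg h]; simp
  simp only [h1]
  rw [Finset.sum_ite_mem, Finset.univ_inter]
  by_cases ha : a = fun q => xor (b q) (ind (hopX n r) q)
  · simp only [if_pos ha]
    rw [← Finset.mul_sum, sum_even_powerset, prod_one_add_digitSign, prod_one_sub_digitSign]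
    have e1 : (∀ q ∈ hopZ n r, xor (b q) (hopU n r q) = false) ↔
        ∀ q ∈ hopZ n r, b q = hopU n r q := by simp
    have e2 : (∀ q ∈ hopZ n r, xor (b q) (hopU n r q) = true) ↔
        ∀ q ∈ hopZ n r, b q = !hopU n r q := by
      refine forall₂_congr fun q _ => ?_
      rcases b q <;> rcases hopU n r q <;> simp
    simp only [e1, e2]
    have h2 : (2 : ℂ) ^ (hopZ n r).card ≠ 0 := pow_ne_zero _ two_ne_zero
    split_ifs <;> field_simp <;> norm_num
  · simp only [if_neg ha, Finset.sum_const_zero]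

/-- The adjoint flips the same qubits but starts from the flipped configuration, that is from the
complementary bits on `hopZ`. -/
theorem hop_add_conjTranspose (hm : 0 < m) (n : Fin (N - 1)) : hop N m n + (hop N m n)ᴴ
    = ∑ r, ∑ t, (hopWeight n r t : ℂ) • pauli (ind (hopX n r), ind t) := by
  ext a b
  simp only [Matrix.sum_apply, Matrix.smul_apply, smul_eq_mul, sum_hopWeight_pauli,
    Matrix.add_apply, Matrix.conjTranspose_apply, hop_apply hm, star_sum,
    ← Finset.sum_add_distrib]
  refine Finset.sum_congr rfl fun r _ => ?_
  have hab : (b = fun q => xor (a q) (ind (hopX n r) q)) ↔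
      (a = fun q => xor (b q) (ind (hopX n r) q)) := by
    constructor
    · rintro rfl; funext q; simp
    · rintro rfl; funext q; simp
  simp only [hab]
  by_cases ha : a = fun q => xor (b q) (ind (hopX n r) q)
  · have h2 : (∀ q ∈ hopZ n r, a q = hopU n r q) ↔ ∀ q ∈ hopZ n r, b q = !hopU n r q := by
      refine forall₂_congr fun q hq => ?_
      rw [ha]
      simp only [ind, hopZ_subset_hopX n r hq, decide_true]
      rcases b q <;> rcases hopU n r q <;> simp
    simp only [h2]
    rw [if_pos ha]
    simp only [ha, true_and]
    congr 1
    split_ifs <;> simp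
  · simp [ha]

end Expansion

/-! ### Pauli expansion of the Hamiltonian -/

section Hamiltonian

variable {N m : ℕ}

theorem sq_sum_eq {m : ℕ} (c : Fin m → ℂ) : (∑ i, c i) ^ 2
    = ∑ i, c i ^ 2 + 2 * ∑ i, ∑ j, if j < i then c i * c j else 0 := by
  have h : ∀ i j : Fin m, c i * c j = (if j = i then c i ^ 2 else 0)
      + ((if j < i then c i * c j else 0) + if i < j then c i * c j else 0) := by
    intro i j
    rcases lt_trichotomy i j with h | h | h
    · simp [h, h.ne', h.not_gt]
    · subst h; simp [pow_two]
    · simp [h, h.ne, h.not_gt]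
  rw [pow_two, Finset.sum_mul_sum]
  rw [Finset.sum_congr rfl fun i _ => Finset.sum_congr rfl fun j _ => h i j]
  simp only [Finset.sum_add_distrib, Finset.sum_ite_eq', Finset.mem_univ, if_true]
  rw [Finset.sum_comm (f := fun i j => if i < j then c i * c j else 0), two_mul]
  congr 2
  refine Finset.sum_congr rfl fun i _ => Finset.sum_congr rfl fun j _ => ?_
  rw [mul_comm]

theorem linkValue_sub (b : Conf N m) (n : Fin (N - 1)) : (linkValue b n : ℂ) - 2 ^ m / 2
    = -(1 + ∑ j : Fin m, 2 ^ (j : ℕ) * digitSign (b (Sum.inr (n, j)))) / 2 := by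
  have h1 : (∑ j : Fin m, (2 : ℂ) ^ (j : ℕ)) + 1 = 2 ^ m := by
    have := sum_two_pow_lt (m := m) m le_rfl
    simp only [Fin.is_lt, if_true] at this
    exact_mod_cast this
  have h2 : (linkValue b n : ℂ) = ∑ j : Fin m,
      (2 ^ (j : ℕ) - 2 ^ (j : ℕ) * digitSign (b (Sum.inr (n, j)))) / 2 := by
    rw [linkValue]
    push_cast
    refine Finset.sum_congr rfl fun j _ => ?_
    unfold digitSign
    split_ifs <;> simp
  rw [h2, ← h1, ← Finset.sum_div, Finset.sum_sub_distrib]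
  ring

/-- The weight of the identity. -/
noncomputable def oneWeight (N m : ℕ) (μ : ℝ) : ℝ :=
  (N - 1 : ℕ) * ((1 + ∑ j : Fin m, (2 ^ (j : ℕ)) ^ 2) / 4)
    + ∑ n : Fin N, (-1) ^ ((n : ℕ) + 1) * (μ / 2)

/-- With digits written as (1 − Z)/2, the field is −(1 + Σ 2^j Z_j)/2. In its square the Z_j² = 1 go
to the identity, and every unordered pair occurs twice. -/
theorem fieldSq_eq (n : Fin (N - 1)) : fieldSq N m n
    = (((1 + ∑ j : Fin m, (2 ^ (j : ℕ)) ^ 2) / 4 : ℝ) : ℂ) • pauli (ind ∅, ind ∅)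
      + ∑ i : Fin m, ((2 ^ (i : ℕ) / 2 : ℝ) : ℂ) • pauli (ind ∅, ind {Sum.inr (n, i)})
      + ∑ i : Fin m, ∑ j : Fin m, ((if j < i then 2 ^ (i : ℕ) * 2 ^ (j : ℕ) / 2 else 0 : ℝ) : ℂ) •
          pauli (ind ∅, ind {Sum.inr (n, i), Sum.inr (n, j)}) := by
  ext a b
  simp only [fieldSq, pauli_empty_ind, Matrix.add_apply, Matrix.sum_apply, Matrix.smul_apply,
    Matrix.diagonal_apply]
  by_cases h : a = b
  · subst h
    simp only [if_true, smul_eq_mul, Finset.prod_empty, Finset.prod_singleton]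
    rw [linkValue_sub, div_pow, neg_sq, add_sq, sq_sum_eq]
    have e1 : ∀ i j : Fin m, ((if j < i then 2 ^ (i : ℕ) * 2 ^ (j : ℕ) / 2 else 0 : ℝ) : ℂ) *
        ∏ q ∈ ({Sum.inr (n, i), Sum.inr (n, j)} : Finset (Qubit N m)), digitSign (a q)
        = (if j < i then 2 ^ (i : ℕ) * digitSign (a (Sum.inr (n, i))) *
          (2 ^ (j : ℕ) * digitSign (a (Sum.inr (n, j)))) else 0) / 2 := by
      intro i j
      by_cases hij : j < i
      · rw [if_pos hij, if_pos hij, Finset.prod_pair (by simp [hij.ne'])]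
        push_cast; ring
      · simp [hij]
    have e2 : ∀ i : Fin m, (2 ^ (i : ℕ) * digitSign (a (Sum.inr (n, i)))) ^ 2
        = ((2 : ℂ) ^ (i : ℕ)) ^ 2 := by
      intro i
      have : digitSign (a (Sum.inr (n, i))) ^ 2 = 1 := by unfold digitSign; split_ifs <;> norm_num
      rw [mul_pow, this, mul_one]
    have e3 : ∀ i : Fin m, ((2 ^ (i : ℕ) / 2 : ℝ) : ℂ) * digitSign (a (Sum.inr (n, i)))
        = 2 ^ (i : ℕ) * digitSign (a (Sum.inr (n, i))) / 2 := by
      intro i; push_cast; ring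
    simp only [e1, e2, e3, ← Finset.sum_div]
    push_cast
    ring
  · simp [h]

/-- The indices of the terms in the Pauli expansion of the Hamiltonian: the identity, the sites,
single digits and pairs of digits of a link, and the hopping terms. -/
abbrev TermIdx (N m : ℕ) : Type := Unit ⊕ Fin N ⊕ (Fin (N - 1) × Fin m) ⊕
  (Fin (N - 1) × Fin m × Fin m) ⊕ (Fin (N - 1) × Fin m × Finset (Qubit N m))

/-- The label of a term, as a pair of sets of qubits. -/
def termLabel : TermIdx N m → Finset (Qubit N m) × Finset (Qubit N m)
  | .inl _ => (∅, ∅)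
  | .inr (.inl n) => (∅, {Sum.inl n})
  | .inr (.inr (.inl (n, i))) => (∅, {Sum.inr (n, i)})
  | .inr (.inr (.inr (.inl (n, i, j)))) => (∅, {Sum.inr (n, i), Sum.inr (n, j)})
  | .inr (.inr (.inr (.inr (n, r, t)))) => (hopX n r, t)

/-- The coefficient of a term. -/
noncomputable def termWeight (μ x : ℝ) : TermIdx N m → ℝ
  | .inl _ => oneWeight N m μ
  | .inr (.inl n) => (-1) ^ ((n : ℕ) + 1) * (μ / 2)
  | .inr (.inr (.inl (_, i))) => 2 ^ (i : ℕ) / 2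
  | .inr (.inr (.inr (.inl (_, i, j)))) => if j < i then 2 ^ (i : ℕ) * 2 ^ (j : ℕ) / 2 else 0
  | .inr (.inr (.inr (.inr (n, r, t)))) => x * hopWeight n r t

/-- The label of a term in the auxiliary register. -/
def auxLabel (k : TermIdx N m) : Aux N m := (ind (termLabel k).1, ind (termLabel k).2)

theorem schwinger_eq_sum (hm : 0 < m) (μ x : ℝ) :
    schwinger N m μ x = ∑ k, (termWeight μ x k : ℂ) • pauli (auxLabel k) := by
  have hone : pauli (ind ∅, ind ∅) = (1 : Matrix (Conf N m) (Conf N m) ℂ) := by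
    rw [pauli_empty_ind]; simp
  have hsite : ∀ n : Fin N, pauli (ind ∅, ind {Sum.inl n})
      = (onWire (Sum.inl n) sigma3 : Matrix (Conf N m) (Conf N m) ℂ) := by
    intro n
    rw [pauli_empty_ind]
    apply Matrix.toLin'.injective
    apply LinearMap.ext
    intro v
    rw [Matrix.toLin'_apply, Matrix.toLin'_apply, sigma3, onWire_diagonal_mulVec]
    funext b
    simp [Matrix.mulVec_diagonal, digitSign]
  simp only [Fintype.sum_sum_type, Fintype.sum_prod_type, Finset.univ_unique, Finset.sum_singleton,
    termWeight, auxLabel, termLabel, schwinger, fieldSq_eq, hop_add_conjTranspose hm,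
    Finset.sum_add_distrib, Finset.smul_sum, smul_smul, smul_add]
  simp only [hone, hsite, oneWeight]
  push_cast
  simp only [add_smul, Finset.sum_smul, Finset.sum_const, Finset.card_univ, Fintype.card_fin,
    ← Nat.cast_smul_eq_nsmul ℂ, smul_smul]
  abel

theorem ind_injective : Function.Injective (ind : Finset (Qubit N m) → Conf N m) := by
  intro S T h
  ext q
  have := congrFun h q
  simpa [ind] using this

theorem hopX_injective {n n' : Fin (N - 1)} {r r' : Fin m} (h : hopX n r = hopX n' r') :
    n = n' ∧ r = r' := by
  have h1 : Sum.inr (n, r) ∈ hopX n' r' := by rw [← h]; simp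
  have h2 : Sum.inr (n', r') ∈ hopX n r := by rw [h]; simp
  simp only [mem_hopX_inr] at h1 h2
  exact ⟨h1.1, le_antisymm h1.2 h2.2⟩

theorem hopX_ne_empty (n : Fin (N - 1)) (r : Fin m) : hopX n r ≠ ∅ := by
  intro h
  have h1 : Sum.inr (n, r) ∈ hopX n r := by simp
  rw [h] at h1
  simp at h1

/-- Ensures that no two contributing terms share a Pauli operator, so that absolute values and
square roots can be taken term by term. Nonzero weight is needed: pairs (i, j) and (j, i) have the
same label, but only j < i carries weight. -/
theorem auxLabel_injOn (μ x : ℝ) (k k' : TermIdx N m) (hk : termWeight μ x k ≠ 0)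
    (hk' : termWeight μ x k' ≠ 0) (h : auxLabel k = auxLabel k') : k = k' := by
  have h' : termLabel k = termLabel k' := by
    rw [auxLabel, auxLabel, Prod.mk.injEq] at h
    exact Prod.ext (ind_injective h.1) (ind_injective h.2)
  have hpair : ∀ (n : Fin (N - 1)) (i j : Fin m) (q : Qubit N m), j < i →
      ({Sum.inr (n, i), Sum.inr (n, j)} : Finset (Qubit N m)) ≠ {q} := by
    intro n i j q hij e
    have := congrArg Finset.card e
    rw [Finset.card_pair (by simp [hij.ne'])] at this
    simp at this
  rcases k with _ | n | ⟨n, i⟩ | ⟨n, i, j⟩ | ⟨n, r, t⟩ <;>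
    rcases k' with _ | n' | ⟨n', i'⟩ | ⟨n', i', j'⟩ | ⟨n', r', t'⟩ <;>
    simp only [termLabel, termWeight, Prod.mk.injEq, true_and, ne_eq, ite_eq_right_iff,
      Classical.not_imp] at h' hk hk' ⊢
  all_goals first
    | rfl
    | exact absurd h'.1 (hopX_ne_empty _ _)
    | exact absurd h'.1.symm (hopX_ne_empty _ _)
    | exact absurd h' (hpair _ _ _ _ hk.1)
    | exact absurd h'.symm (hpair _ _ _ _ hk'.1)
    | exact absurd h'.symm (Finset.insert_ne_empty _ _)
    | exact absurd h' (Finset.insert_ne_empty _ _)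
    | exact absurd h' (Finset.singleton_ne_empty _)
    | exact absurd h'.symm (Finset.singleton_ne_empty _)
    | (have := Finset.singleton_injective h'; simp_all)
    | skip
  -- Two pairs: equal sets with ordered entries are equal pairs.
  · have h1 : Sum.inr (n, i) ∈ ({Sum.inr (n', i'), Sum.inr (n', j')} : Finset (Qubit N m)) := by
      rw [← h']; simp
    have h2 : Sum.inr (n, j) ∈ ({Sum.inr (n', i'), Sum.inr (n', j')} : Finset (Qubit N m)) := by
      rw [← h']; simp
    have hij := hk.1
    have hij' := hk'.1
    simp only [Finset.mem_insert, Finset.mem_singleton, Sum.inr.injEq, Prod.mk.injEq] at h1 h2 ⊢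
    rcases h1 with ⟨rfl, rfl⟩ | ⟨rfl, rfl⟩ <;> rcases h2 with ⟨_, rfl⟩ | ⟨_, rfl⟩
    · exact absurd hij (lt_irrefl _)
    · exact rfl
    · exact absurd hij hij'.not_gt
    · exact absurd hij (lt_irrefl _)
  · obtain ⟨rfl, rfl⟩ := hopX_injective h'.1
    rw [h'.2]

end Hamiltonian

/-! ### Labels on the wires -/

section Labels

variable {N m v : ℕ}

/-- A wire of the `x`-half of the auxiliary register. -/
abbrev xWire (v : ℕ) (q : Qubit N m) : Wire N m v := Sum.inr (Sum.inl q)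

/-- A wire of the `z`-half of the auxiliary register. -/
abbrev zWire (v : ℕ) (q : Qubit N m) : Wire N m v := Sum.inr (Sum.inr (Sum.inl q))

/-- An ancilla. -/
abbrev ancWire (N m : ℕ) {v : ℕ} (i : Fin v) : Wire N m v := Sum.inr (Sum.inr (Sum.inr (Sum.inl i)))

/-- The ancilla that is used as a flag. -/
abbrev flagWire (N m v : ℕ) : Wire N m (v + 1) := ancWire N m 0

/-- The configuration in which the auxiliary register holds a pair of sets of qubits, and only the
first ancilla may be set. -/
def lab (s : Conf N m) (b fl : Bool) (p : Finset (Qubit N m) × Finset (Qubit N m)) :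
    Wire N m (v + 1) → Bool :=
  cfg s (ind p.1) (ind p.2) (fun i => decide (i = 0) && fl) b

variable (s : Conf N m) (b fl : Bool) (S T : Finset (Qubit N m))
  (p : Finset (Qubit N m) × Finset (Qubit N m))

@[simp] theorem lab_x (q : Qubit N m) : lab s b fl p (xWire (v + 1) q) = decide (q ∈ p.1) := rfl

@[simp] theorem lab_z (q : Qubit N m) : lab s b fl p (zWire (v + 1) q) = decide (q ∈ p.2) := rfl

@[simp] theorem lab_flag : lab s b fl p (flagWire N m v) = fl := by
  simp [lab, cfg, flagWire]

theorem lab_update_flag (fl' : Bool) :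
    Function.update (lab s b fl p) (flagWire N m v) fl' = lab s b fl' p := by
  funext q
  by_cases h : q = flagWire N m v
  · subst h; simp
  · rw [Function.update_of_ne h]
    rcases q with q | q | q | q | q
    · rfl
    · rfl
    · rfl
    · have : q ≠ 0 := fun e => h (by rw [e])
      simp [lab, cfg, this]
    · rfl

theorem lab_update_x (q : Qubit N m) :
    Function.update (lab s b fl (S, T)) (xWire (v + 1) q) true = lab s b fl (insert q S, T) := by
  funext q'
  by_cases h : q' = xWire (v + 1) q
  · subst h; simp
  · rw [Function.update_of_ne h]
    rcases q' with q' | q' | q' | q' | q'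
    · rfl
    · have : q' ≠ q := fun e => h (by rw [e])
      simp [lab, cfg, ind, this]
    · rfl
    · rfl
    · rfl

theorem lab_update_z (q : Qubit N m) :
    Function.update (lab s b fl (S, T)) (zWire (v + 1) q) true = lab s b fl (S, insert q T) := by
  funext q'
  by_cases h : q' = zWire (v + 1) q
  · subst h; simp
  · rw [Function.update_of_ne h]
    rcases q' with q' | q' | q' | q' | q'
    · rfl
    · rfl
    · have : q' ≠ q := fun e => h (by rw [e])
      simp [lab, cfg, ind, this]
    · rfl
    · rfl

end Labels

/-! ### Selection of a term -/

section Selection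

variable {N m v : ℕ}

/-- The selectors of a term: a site, a digit of a link, or a hopping term. -/
abbrev Sel (N m : ℕ) : Type := Fin N ⊕ (Fin (N - 1) × Fin m) ⊕ (Fin (N - 1) × Fin m)

/-- The wire that represents a selector. -/
def selWire (v : ℕ) : Sel N m → Wire N m v
  | .inl n => zWire v (Sum.inl n)
  | .inr (.inl p) => zWire v (Sum.inr p)
  | .inr (.inr p) => xWire v (Sum.inr p)

/-- The label that represents a selector. -/
def selLabel : Sel N m → Finset (Qubit N m) × Finset (Qubit N m)
  | .inl n => (∅, {Sum.inl n})
  | .inr (.inl p) => (∅, {Sum.inr p})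
  | .inr (.inr p) => ({Sum.inr p}, ∅)

theorem selWire_injective : Function.Injective (selWire v : Sel N m → Wire N m v) := by
  rintro (n | p | p) (n' | p' | p') h <;> simp [selWire] at h ⊢ <;> exact h

theorem selWire_ne_flag (k : Sel N m) : selWire (v + 1) k ≠ flagWire N m v := by
  rcases k with n | p | p <;> simp [selWire]

theorem lab_empty_selWire (s : Conf N m) (b fl : Bool) (k : Sel N m) :
    lab s b fl (∅, ∅) (selWire (v + 1) k) = false := by
  rcases k with n | p | p <;> simp [selWire]

theorem lab_empty_update (s : Conf N m) (b fl : Bool) (k : Sel N m) :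
    Function.update (lab s b fl (∅, ∅)) (selWire (v + 1) k) true = lab s b fl (selLabel k) := by
  rcases k with n | p | p
  · exact lab_update_z s b fl ∅ ∅ _
  · exact lab_update_z s b fl ∅ ∅ _
  · exact lab_update_x s b fl ∅ ∅ _

theorem lab_selLabel_selWire (s : Conf N m) (b fl : Bool) (k k' : Sel N m) :
    lab s b fl (selLabel k) (selWire (v + 1) k') = decide (k' = k) := by
  rw [← lab_empty_update]
  by_cases h : k' = k
  · rw [h, Function.update_self]; simp
  · rw [Function.update_of_ne (fun e => h (selWire_injective e)), lab_empty_selWire]; simp [h]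

theorem countP_eq_one_of_nodup {α : Type*} [DecidableEq α] {L : List α} (hL : L.Nodup) {a : α}
    (ha : a ∈ L) : L.countP (fun b => decide (b = a)) = 1 :=
  List.count_eq_one_of_mem hL ha

/-- The circuit that selects a term. -/
noncomputable def selectCirc (N m v : ℕ) (L : List (Wire N m (v + 1) × ℝ)) :
    Circuit (Wire N m (v + 1)) :=
  [Gate.x (flagWire N m v)] ++ chain (flagWire N m v) L
    ++ parityCirc (flagWire N m v) (Finset.univ.toList.map (selWire (v + 1)))
    ++ [Gate.x (flagWire N m v)]

/-- After the chain the flag is 1 exactly when no wire was chosen. Adding the parity of all selector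
wires makes it 1 in every branch, and the last X gate returns it to 0. The factor ρ is the norm of
the target, which is not computed here. -/
theorem exists_selectCirc (hN : 0 < N) (v : ℕ) (a₀ : ℝ) (a : Sel N m → ℝ) :
    ∃ (L : List (Wire N m (v + 1) × ℝ)) (ρ : ℝ), 0 ≤ ρ ∧
      L.map Prod.fst = Finset.univ.toList.map (selWire (v + 1)) ∧
      ∀ (s : Conf N m) (b : Bool),
        (ρ : ℂ) • Circuit.run (selectCirc N m v L) (ket (lab s b false (∅, ∅)))
          = (a₀ : ℂ) • ket (lab s b false (∅, ∅))
            + ∑ k, (a k : ℂ) • ket (lab s b false (selLabel k)) := by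
  obtain ⟨L, ρ, hL, -, hρ, hrun⟩ := exists_chain (Finset.univ.toList.map (selWire (v + 1)))
    (List.Nodup.map selWire_injective (Finset.nodup_toList (Finset.univ : Finset (Sel N m))))
    -- The amplitudes transported from selectors to wires, without ambiguity since `selWire` is
    -- injective; the default 0 is never used.
    (fun q => if h : ∃ k, selWire (v + 1) k = q then a h.choose else 0) a₀
  have ha : ∀ k, (if h : ∃ k', selWire (v + 1) k' = selWire (v + 1) k then a h.choose else 0)
      = a k := by
    intro k
    have h : ∃ k', selWire (v + 1) k' = selWire (v + 1) k := ⟨k, rfl⟩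
    rw [dif_pos h, selWire_injective h.choose_spec]
  refine ⟨L, ρ, hρ ?_, hL, fun s b => ?_⟩
  · intro h
    have := List.map_eq_nil_iff.mp h
    rw [Finset.toList_eq_nil] at this
    have h2 := Finset.mem_univ (Sum.inl ⟨0, hN⟩ : Sel N m)
    rw [this] at h2
    simp at h2
  · have hne : ∀ q ∈ (Finset.univ : Finset (Sel N m)).toList.map (selWire (v + 1)),
        q ≠ flagWire N m v := by
      intro q hq
      obtain ⟨k, -, rfl⟩ := List.mem_map.mp hq
      exact selWire_ne_flag k
    have h1 := hrun (flagWire N m v) (lab s b true (∅, ∅)) (by simp) (by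
      intro q hq
      refine ⟨hne q hq, ?_⟩
      obtain ⟨k, -, rfl⟩ := List.mem_map.mp hq
      exact lab_empty_selWire s b true k)
    have h2 : ∀ (fl : Bool) (p : Finset (Qubit N m) × Finset (Qubit N m)),
        (Gate.x (flagWire N m v)).run (ket (lab s b fl p)) = ket (lab s b (!fl) p) := by
      intro fl p
      rw [x_run_ket, lab_update_flag, lab_flag]
    have h3 : Circuit.run (parityCirc (flagWire N m v)
        (Finset.univ.toList.map (selWire (v + 1)))) (ket (lab s b true (∅, ∅)))
        = ket (lab s b true (∅, ∅)) := by
      rw [parityCirc_run _ _ hne, lab_update_flag, lab_flag, List.countP_map]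
      congr 2
      have : (lab s b true (∅, ∅)) ∘ selWire (v + 1) = fun _ : Sel N m => false := by
        funext k; exact lab_empty_selWire s b true k
      rw [this]
      simp
    have h4 : ∀ k, Circuit.run (parityCirc (flagWire N m v)
        (Finset.univ.toList.map (selWire (v + 1)))) (ket (lab s b false (selLabel k)))
        = ket (lab s b true (selLabel k)) := by
      intro k
      rw [parityCirc_run _ _ hne, lab_update_flag, lab_flag, List.countP_map]
      have : (lab s b false (selLabel k)) ∘ selWire (v + 1)
          = fun k' : Sel N m => decide (k' = k) := by
        funext k'
        rw [Function.comp_apply, lab_selLabel_selWire]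
      rw [this, countP_eq_one_of_nodup (Finset.nodup_toList _) (by simp)]
      simp
    simp only [selectCirc, Circuit.run_append, Circuit.run_cons, Circuit.run_nil]
    rw [h2, ← map_smul, ← map_smul, Bool.not_false, h1, List.map_map,
      Finset.sum_map_toList]
    simp only [Function.comp_apply, ha, lab_empty_update, lab_update_flag, map_add, map_smul,
      map_sum, h3, h4, h2, Bool.not_true]

theorem selectCirc_length (L : List (Wire N m (v + 1) × ℝ))
    (hL : L.map Prod.fst = Finset.univ.toList.map (selWire (v + 1))) :
    (selectCirc N m v L).length ≤ 2 + 14 * (N + 2 * ((N - 1) * m)) := by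
  have hl : L.length = N + 2 * ((N - 1) * m) := by
    rw [← List.length_map (f := Prod.fst), hL, List.length_map, Finset.length_toList,
      Finset.card_univ]
    simp; ring
  have h1 := chain_length (flagWire N m v) L
  have h2 := parityCirc_length (flagWire N m v)
    ((Finset.univ : Finset (Sel N m)).toList.map (selWire (v + 1)))
  rw [← hL, List.length_map] at h2
  simp only [selectCirc, List.length_append, List.length_cons, List.length_nil]
  rw [← hL]
  omega

end Selection

/-! ### The terms of one link -/

section Links

variable {N m v : ℕ}

/-- The wires of the digits of a link, in the `z`-half of the auxiliary register. -/
def zDigit (v : ℕ) (n : Fin (N - 1)) (j : ℕ) : Wire N m (v + 1) :=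
  -- The flag is a dummy value: the circuits below use only digits j < m.
  if h : j < m then zWire (v + 1) (Sum.inr (n, ⟨j, h⟩)) else flagWire N m v

/-- The wires of the digits of a link, in the `x`-half of the auxiliary register. -/
def xDigit (v : ℕ) (n : Fin (N - 1)) (j : ℕ) : Wire N m (v + 1) :=
  if h : j < m then xWire (v + 1) (Sum.inr (n, ⟨j, h⟩)) else flagWire N m v

/-- Branch from a digit of a link to the pairs that contain it as the larger one. -/
noncomputable def pairCirc (m v : ℕ) (n : Fin (N - 1)) : Circuit (Wire N m (v + 1)) :=
  chain (flagWire N m v) (halvingList (zDigit v n) m)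
    ++ parityCirc (flagWire N m v) ((List.range m).map (zDigit v n))

theorem zDigit_of_lt {n : Fin (N - 1)} {j : ℕ} (h : j < m) :
    zDigit v n j = zWire (v + 1) (Sum.inr (n, ⟨j, h⟩)) := dif_pos h

theorem xDigit_of_lt {n : Fin (N - 1)} {j : ℕ} (h : j < m) :
    xDigit v n j = xWire (v + 1) (Sum.inr (n, ⟨j, h⟩)) := dif_pos h

theorem zDigit_ne_flag {n : Fin (N - 1)} {j : ℕ} (h : j < m) :
    zDigit v n j ≠ flagWire N m v := by
  rw [zDigit_of_lt h]; simp

theorem zDigit_inj {n : Fin (N - 1)} {i j : ℕ} (hi : i < m) (hj : j < m)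
    (h : zDigit (m := m) v n i = zDigit v n j) : i = j := by
  rw [zDigit_of_lt hi, zDigit_of_lt hj] at h
  simpa using h

theorem xDigit_inj {n : Fin (N - 1)} {i j : ℕ} (hi : i < m) (hj : j < m)
    (h : xDigit (m := m) v n i = xDigit v n j) : i = j := by
  rw [xDigit_of_lt hi, xDigit_of_lt hj] at h
  simpa using h

theorem countP_finRange {m : ℕ} (P : Fin m → Prop) [DecidablePred P] :
    (List.finRange m).countP (fun j => decide (P j)) = (Finset.univ.filter P).card := by
  rw [List.countP_eq_length_filter, Fin.univ_def]
  rfl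

theorem sum_ite_lt_eq_sum_range {m : ℕ} {β : Type*} [AddCommMonoid β] (g : Fin m → β) (i : Fin m) :
    ∑ j, (if j < i then g j else 0)
      = ∑ j ∈ Finset.range i, if h : j < m then g ⟨j, h⟩ else 0 := by
  rw [Finset.sum_fin_eq_sum_range]
  refine (Finset.sum_subset_zero_on_sdiff
    (Finset.range_subset_range.mpr i.2.le) (fun j hj => ?_) fun j hj => ?_).symm
  · rw [Finset.mem_sdiff, Finset.mem_range, Finset.mem_range] at hj
    rw [dif_pos hj.1, if_neg]
    exact fun h => hj.2 h
  · rw [Finset.mem_range] at hj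
    have hj' := hj.trans i.2
    rw [dif_pos hj', dif_pos hj', if_pos]
    exact hj

theorem parity_zDigit_run (n : Fin (N - 1)) (s : Conf N m) (b fl : Bool)
    (p : Finset (Qubit N m) × Finset (Qubit N m)) :
    Circuit.run (parityCirc (flagWire N m v) ((List.range m).map (zDigit v n)))
        (ket (lab s b fl p))
      = ket (lab s b (xor fl (decide (Odd
        (Finset.univ.filter fun j : Fin m => Sum.inr (n, j) ∈ p.2).card))) p) := by
  rw [parityCirc_run, lab_update_flag, lab_flag, List.countP_map]
  · congr 4
    have h1 : (List.range m).countP (lab s b fl p ∘ zDigit v n)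
        = (List.finRange m).countP (fun j => decide (Sum.inr (n, j) ∈ p.2)) := by
      rw [← List.map_coe_finRange_eq_range, List.countP_map]
      refine List.countP_congr fun j _ => ?_
      simp only [Function.comp_apply, zDigit_of_lt j.2, lab_z]
    rw [h1, countP_finRange]
  · intro q hq
    obtain ⟨j, hj, rfl⟩ := List.mem_map.mp hq
    exact zDigit_ne_flag (List.mem_range.mp hj)

theorem pairCirc_run_of_notMem (n : Fin (N - 1)) (s : Conf N m) (b : Bool)
    (p : Finset (Qubit N m) × Finset (Qubit N m)) (hp : ∀ j, Sum.inr (n, j) ∉ p.2) :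
    Circuit.run (pairCirc m v n) (ket (lab s b false p)) = ket (lab s b false p) := by
  rw [pairCirc, Circuit.run_append, chain_run_of_flag_false _ _ (by simp), parity_zDigit_run]
  · simp [hp]
  · intro q hq
    simp only [halvingList, List.mem_map, List.mem_reverse, List.mem_range] at hq
    obtain ⟨j, hj, rfl⟩ := hq
    refine ⟨zDigit_ne_flag hj, ?_⟩
    simp [zDigit_of_lt hj, hp]

/-- The set digit i raises the flag and the halving chain picks a lower digit or none. A single
digit leaves the flag at 1 and has odd parity, a pair leaves it at 0 and has even parity, so adding
the parity clears the flag in both cases. -/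
theorem pairCirc_run (n : Fin (N - 1)) (i : Fin m) (s : Conf N m) (b : Bool) :
    Circuit.run (pairCirc m v n) (ket (lab s b false (∅, {Sum.inr (n, i)})))
      = ((√2 / 2 : ℝ) : ℂ) ^ (i : ℕ) • ket (lab s b false (∅, {Sum.inr (n, i)}))
        + ∑ j : Fin m, if j < i then ((√2 / 2 : ℝ) : ℂ) ^ ((i : ℕ) - j) •
          ket (lab s b false (∅, {Sum.inr (n, i), Sum.inr (n, j)})) else 0 := by
  have h1 : ∑ j ∈ Finset.range i, ((√2 / 2 : ℝ) : ℂ) ^ ((i : ℕ) - j) •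
      ket (Function.update (lab s b false (∅, {Sum.inr (n, i)})) (zDigit v n j) true)
      = ∑ j : Fin m, if j < i then ((√2 / 2 : ℝ) : ℂ) ^ ((i : ℕ) - j) •
          ket (lab s b false (∅, {Sum.inr (n, i), Sum.inr (n, j)})) else 0 := by
    rw [sum_ite_lt_eq_sum_range]
    refine Finset.sum_congr rfl fun j hj => ?_
    have hj' : j < m := (Finset.mem_range.mp hj).trans i.2
    rw [dif_pos hj', zDigit_of_lt hj', lab_update_z, Finset.pair_comm]
  rw [pairCirc, Circuit.run_append, halving_second_run _ _ m i i.2 (fun j hj => zDigit_ne_flag hj)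
    (fun i hi j hj => zDigit_inj hi hj) (by simp), lab_update_flag, h1, map_add, map_smul, map_sum,
    parity_zDigit_run]
  · congr 1
    · have : (Finset.univ.filter fun j : Fin m => (Sum.inr (n, j) : Qubit N m) ∈
          ({Sum.inr (n, i)} : Finset (Qubit N m))) = {i} := by ext j; simp
      simp only [this, Finset.card_singleton]
      simp
    · refine Finset.sum_congr rfl fun j _ => ?_
      split_ifs with hj
      · have : (Finset.univ.filter fun j' : Fin m => (Sum.inr (n, j') : Qubit N m) ∈
            ({Sum.inr (n, i), Sum.inr (n, j)} : Finset (Qubit N m))) = {i, j} := by ext j; simp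
        rw [map_smul, parity_zDigit_run]
        simp only [this, Finset.card_pair hj.ne']
        simp [Nat.odd_iff]
      · rw [map_zero]
  · intro j hj
    rw [zDigit_of_lt hj, lab_z]
    simp [Fin.ext_iff]

/-- Propagate the carries of a hopping term. -/
def carryCirc (m v : ℕ) (n : Fin (N - 1)) : Circuit (Wire N m (v + 1)) :=
  fillDown (xDigit v n) (m - 1) ++ cx (xDigit v n 0) (xWire (v + 1) (Sum.inl (leftSite n)))
    ++ cx (xDigit v n 0) (xWire (v + 1) (Sum.inl (rightSite n)))

theorem carryCirc_run_of_notMem (hm : 0 < m) (n : Fin (N - 1)) (s : Conf N m) (b fl : Bool)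
    (p : Finset (Qubit N m) × Finset (Qubit N m)) (hp : ∀ j, Sum.inr (n, j) ∉ p.1) :
    Circuit.run (carryCirc m v n) (ket (lab s b fl p)) = ket (lab s b fl p) := by
  rw [carryCirc, Circuit.run_append, Circuit.run_append, fillDown_run_of_false,
    cx_run_ket_of_false, cx_run_ket_of_false]
  · rw [xDigit_of_lt hm]; simp
  · rw [xDigit_of_lt hm]; simp [hp]
  · rw [xDigit_of_lt hm]; simp
  · rw [xDigit_of_lt hm]; simp [hp]
  · intro i hi j hj; exact xDigit_inj (by omega) (by omega)
  · intro j hj; rw [xDigit_of_lt (show j < m by omega)]; simp [hp]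

/-- Digit r is copied down to digit 0, which is set for every r and so serves as control for the two
sites. -/
theorem carryCirc_run (n : Fin (N - 1)) (r : Fin m) (s : Conf N m) (b fl : Bool) :
    Circuit.run (carryCirc m v n) (ket (lab s b fl ({Sum.inr (n, r)}, ∅)))
      = ket (lab s b fl (hopX n r, ∅)) := by
  have hm : 0 < m := r.pos
  have hr : (r : ℕ) ≤ m - 1 := by have := r.2; omega
  have hx : ∀ w : Wire N m (v + 1), (∀ q, w ≠ xWire (v + 1) q) →
      ¬ ∃ j < (r : ℕ), w = xDigit v n j := by
    rintro w hw ⟨j, hj, rfl⟩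
    exact hw _ (xDigit_of_lt (hj.trans r.2))
  have h1 : (fun w => lab s b fl ({Sum.inr (n, r)}, ∅) w ||
      decide (∃ j < (r : ℕ), w = xDigit v n j))
      = lab s b fl ((Finset.univ.filter (· ≤ r)).image fun j => Sum.inr (n, j), ∅) := by
    funext w
    rcases w with q | q | q | q | q
    · rw [decide_eq_false (hx _ fun q' => Sum.inl_ne_inr), Bool.or_false]
      rfl
    · change (decide (q ∈ ({Sum.inr (n, r)} : Finset (Qubit N m))) || _) = decide (_ ∈ _)
      rw [← Bool.decide_or]
      congr 1
      apply propext
      simp only [Finset.mem_singleton, Finset.mem_image, Finset.mem_filter, Finset.mem_univ,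
        true_and]
      constructor
      · rintro (rfl | ⟨j, hj, e⟩)
        · exact ⟨r, le_rfl, rfl⟩
        · rw [xDigit_of_lt (hj.trans r.2)] at e
          exact ⟨⟨j, hj.trans r.2⟩, hj.le, (Sum.inl.inj (Sum.inr.inj e)).symm⟩
      · rintro ⟨j, hj, rfl⟩
        rcases hj.lt_or_eq with hj | rfl
        · exact Or.inr ⟨j, hj, (xDigit_of_lt j.2).symm⟩
        · exact Or.inl rfl
    all_goals
      rw [decide_eq_false (hx _ fun q' => by simp), Bool.or_false]
      rfl
  rw [carryCirc, Circuit.run_append, Circuit.run_append, fillDown_run _ _ _ hr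
    (fun i hi j hj => xDigit_inj (by omega) (by omega)), h1, xDigit_of_lt hm, cx_run_ket,
    lab_x, lab_x]
  · have e1 : (Sum.inr (n, ⟨0, hm⟩) : Qubit N m) ∈
        (Finset.univ.filter (· ≤ r)).image fun j => (Sum.inr (n, j) : Qubit N m) :=
      Finset.mem_image.mpr ⟨⟨0, hm⟩, Finset.mem_filter.mpr ⟨Finset.mem_univ _, Nat.zero_le _⟩, rfl⟩
    have e2 : ∀ i : Fin N, (Sum.inl i : Qubit N m) ∉
        (Finset.univ.filter (· ≤ r)).image fun j => (Sum.inr (n, j) : Qubit N m) := by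
      simp
    rw [decide_eq_true e1, decide_eq_false (e2 _), Bool.false_xor, lab_update_x,
      cx_run_ket (by simp), lab_x, lab_x, decide_eq_true (Finset.mem_insert_of_mem e1),
      decide_eq_false, Bool.false_xor, lab_update_x]
    · congr 3
      ext q
      rcases q with i | ⟨n', j⟩
      · simp [or_comm]
      · simp only [Finset.mem_insert, reduceCtorEq, false_or, Finset.mem_image, Finset.mem_filter,
          Finset.mem_univ, true_and, Sum.inr.injEq, Prod.mk.injEq, mem_hopX_inr]
        constructor
        · rintro ⟨j', h, rfl, rfl⟩; exact ⟨rfl, h⟩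
        · rintro ⟨rfl, h⟩; exact ⟨j, h, rfl, rfl⟩
    · simp [(leftSite_ne_rightSite n).symm]
  · simp
  · intro j hj
    rw [xDigit_of_lt (show j < m by omega), lab_x]
    simp [Fin.ext_iff]

end Links

/-! ### Branching and signs of the hopping terms -/

section Hops

variable {N m v : ℕ}

/-- The controls and targets for the branching of a hopping term. -/
def hopPairs (v : ℕ) (hm : 0 < m) (n : Fin (N - 1)) : List (Wire N m v × Wire N m v) :=
  (xWire v (Sum.inr (n, ⟨0, hm⟩)), zWire v (Sum.inl (leftSite n))) ::
    ((List.finRange m).filter fun j : Fin m => (j : ℕ) + 1 < m).map fun j =>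
      (xWire v (Sum.inr (n, j)), zWire v (Sum.inr (n, j)))

/-- Branch from a hopping term to its Pauli operators. -/
noncomputable def hopCirc (v : ℕ) (hm : 0 < m) (n : Fin (N - 1)) : Circuit (Wire N m (v + 1)) :=
  evenBranch (zWire (v + 1) (Sum.inl (rightSite n))) (hopPairs (v + 1) hm n)

theorem mem_hopPairs {hm : 0 < m} {n : Fin (N - 1)} {p : Wire N m v × Wire N m v} :
    p ∈ hopPairs v hm n ↔
      p = (xWire v (Sum.inr (n, ⟨0, hm⟩)), zWire v (Sum.inl (leftSite n))) ∨
      ∃ j : Fin m, (j : ℕ) + 1 < m ∧ p = (xWire v (Sum.inr (n, j)), zWire v (Sum.inr (n, j))) := by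
  simp [hopPairs, eq_comm]

theorem hopCirc_run_of_notMem (hm : 0 < m) (n : Fin (N - 1)) (s : Conf N m) (b fl : Bool)
    (p : Finset (Qubit N m) × Finset (Qubit N m)) (hp : ∀ j, Sum.inr (n, j) ∉ p.1) :
    Circuit.run (hopCirc v hm n) (ket (lab s b fl p)) = ket (lab s b fl p) := by
  refine evenBranch_run_of_false _ _ fun q hq => ?_
  have hlr := leftSite_ne_rightSite n
  rcases mem_hopPairs.mp hq with rfl | ⟨j, hj, rfl⟩
  · simp [hp, hlr]
  · simp [hp]

/-- The right site is not branched on, since it takes the parity bit. Controlling digit j by the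
x-digit j restricts the branching to j ≤ r, and the top digit has no pair, in agreement with `hopZ`.
-/
theorem hopPairs_targets (hm : 0 < m) (n : Fin (N - 1)) (r : Fin m) (s : Conf N m) (b fl : Bool) :
    (((hopPairs (v + 1) hm n).filter fun p => lab s b fl (hopX n r, ∅) p.1).map
      Prod.snd).toFinset = ((hopZ n r).erase (Sum.inl (rightSite n))).image (zWire (v + 1)) := by
  have hlr := leftSite_ne_rightSite n
  ext q
  simp only [List.mem_toFinset, List.mem_map, List.mem_filter, mem_hopPairs, Finset.mem_image,
    Finset.mem_erase]
  constructor
  · rintro ⟨p, ⟨rfl | ⟨j, hj, rfl⟩, h⟩, rfl⟩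
    · exact ⟨_, ⟨by simpa using hlr, by simp⟩, rfl⟩
    · exact ⟨Sum.inr (n, j), ⟨by simp, by simpa [hj] using h⟩, rfl⟩
  · rintro ⟨i | ⟨n', j⟩, ⟨h1, h2⟩, rfl⟩
    · rw [mem_hopZ_inl] at h2
      rcases h2 with rfl | rfl
      · exact ⟨_, ⟨Or.inl rfl, by simp [Fin.le_def]⟩, rfl⟩
      · exact absurd rfl h1
    · rw [mem_hopZ_inr] at h2
      obtain ⟨rfl, h2, h3⟩ := h2
      exact ⟨_, ⟨Or.inr ⟨j, h3, rfl⟩, by simpa using h2⟩, rfl⟩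

theorem withParity_lab (n : Fin (N - 1)) (s : Conf N m) (b fl : Bool) (X u : Finset (Qubit N m))
    (hu : Sum.inl (rightSite n) ∉ u) :
    withParity (lab s b fl (X, ∅)) (zWire (v + 1) (Sum.inl (rightSite n))) (u.image (zWire (v + 1)))
      = lab s b fl (X, if Odd u.card then insert (Sum.inl (rightSite n)) u else u) := by
  funext w
  have hc : (u.image (zWire (N := N) (m := m) (v + 1))).card = u.card :=
    Finset.card_image_of_injective _ fun a b h => by simpa using h
  unfold withParity
  rw [hc]
  by_cases hw : w = zWire (v + 1) (Sum.inl (rightSite n))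
  · subst hw
    rw [if_pos rfl, lab_z, lab_z]
    by_cases ho : Odd u.card <;> simp [ho, hu]
  · rw [if_neg hw]
    rcases w with q | q | q | q | q
    · have : Sum.inl q ∉ u.image (zWire (N := N) (m := m) (v + 1)) := by simp
      rw [decide_eq_false this, Bool.or_false]; rfl
    · have : Sum.inr (Sum.inl q) ∉ u.image (zWire (N := N) (m := m) (v + 1)) := by simp
      rw [decide_eq_false this, Bool.or_false]; rfl
    · have hq : q ≠ Sum.inl (rightSite n) := fun e => hw (by rw [e])
      have : (Sum.inr (Sum.inr (Sum.inl q)) ∈ u.image (zWire (N := N) (m := m) (v + 1)))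
          ↔ q ∈ u := by simp
      rw [lab_z, lab_z]
      by_cases ho : Odd u.card <;> simp [ho, hq]
    · have : Sum.inr (Sum.inr (Sum.inr (Sum.inl q))) ∉ u.image (zWire (N := N) (m := m) (v + 1)) := by
        simp
      rw [decide_eq_false this, Bool.or_false]; rfl
    · have : Sum.inr (Sum.inr (Sum.inr (Sum.inr q))) ∉ u.image (zWire (N := N) (m := m) (v + 1)) := by
        simp
      rw [decide_eq_false this, Bool.or_false]; rfl

/-- Subsets of W without a correspond to even subsets of W: a is added exactly when the parity is
odd. -/
theorem sum_powerset_erase_parity {α β : Type*} [DecidableEq α] [AddCommMonoid β] (W : Finset α)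
    {a : α} (ha : a ∈ W) (g : Finset α → β) :
    ∑ u ∈ (W.erase a).powerset, g (if Odd u.card then insert a u else u)
      = ∑ t ∈ W.powerset, if Even t.card then g t else 0 := by
  conv_rhs => rw [← Finset.insert_erase ha]
  rw [Finset.sum_powerset_insert (Finset.notMem_erase a W), ← Finset.sum_add_distrib]
  refine Finset.sum_congr rfl fun u hu => ?_
  have hau : a ∉ u := fun h => Finset.notMem_erase a W (Finset.mem_powerset.mp hu h)
  rw [Finset.card_insert_of_notMem hau]
  rcases Nat.even_or_odd u.card with h | h
  · rw [if_neg (Nat.not_odd_iff_even.mpr h), if_pos h, if_neg (by simpa [Nat.even_add_one] using h),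
      add_zero]
  · rw [if_pos h, if_neg (Nat.not_even_iff_odd.mpr h), if_pos h.add_one, zero_add]

theorem hopCirc_run (hm : 0 < m) (n : Fin (N - 1)) (r : Fin m) (s : Conf N m) (b fl : Bool) :
    Circuit.run (hopCirc v hm n) (ket (lab s b fl (hopX n r, ∅)))
      = ((√2 / 2 : ℝ) : ℂ) ^ ((hopZ n r).card - 1) • ∑ t ∈ (hopZ n r).powerset,
          if Even t.card then ket (lab s b fl (hopX n r, t)) else 0 := by
  have hlr := leftSite_ne_rightSite n
  have hinj : Function.Injective (zWire (N := N) (m := m) (v + 1)) := fun a b h => by simpa using h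
  have hR : Sum.inl (rightSite n) ∈ hopZ n r := by simp
  rw [hopCirc, evenBranch_run, hopPairs_targets, Finset.card_image_of_injective _ hinj,
    Finset.card_erase_of_mem hR, Finset.powerset_image,
    Finset.sum_image (Finset.image_injective hinj).injOn, ← sum_powerset_erase_parity _ hR]
  · congr 1
    refine Finset.sum_congr rfl fun u hu => ?_
    rw [withParity_lab]
    exact fun h => Finset.notMem_erase _ _ (Finset.mem_powerset.mp hu h)
  · simp only [hopPairs, List.map_cons, List.map_map, List.nodup_cons]
    constructor
    · simp
    · refine List.Nodup.map (fun i j h => by simpa using h) ?_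
      exact (List.nodup_finRange m).filter _
  · intro p hp p' hp'
    rcases mem_hopPairs.mp hp with rfl | ⟨j, hj, rfl⟩ <;>
      rcases mem_hopPairs.mp hp' with rfl | ⟨j', hj', rfl⟩ <;> simp
  · intro p hp
    rcases mem_hopPairs.mp hp with rfl | ⟨j, hj, rfl⟩
    · simp [hlr]
    · simp
  · intro p hp
    rcases mem_hopPairs.mp hp with rfl | ⟨j, hj, rfl⟩ <;> simp

/-- The signs of the Pauli operators in a hopping term. -/
def signCirc (v : ℕ) (hm : 0 < m) (n : Fin (N - 1)) : Circuit (Wire N m v) :=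
  ((List.finRange m).flatMap fun j : Fin m => if h : (j : ℕ) + 1 < m then
      csdg (xWire v (Sum.inr (n, j))) (zWire v (Sum.inr (n, j)))
        ++ cz (xWire v (Sum.inr (n, ⟨j + 1, h⟩))) (zWire v (Sum.inr (n, j))) else [])
    ++ cs (xWire v (Sum.inr (n, ⟨0, hm⟩))) (zWire v (Sum.inl (leftSite n)))
    ++ csdg (xWire v (Sum.inr (n, ⟨0, hm⟩))) (zWire v (Sum.inl (rightSite n)))

theorem run_flatMap_of_phase {ι α : Type} [Fintype ι] [DecidableEq ι] (L : List α)
    (g : α → Circuit ι) (c : ι → Bool) (ph : α → ℂ)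
    (h : ∀ x ∈ L, Circuit.run (g x) (ket c) = ph x • ket c) :
    Circuit.run (L.flatMap g) (ket c) = (L.map ph).prod • ket c := by
  induction L with
  | nil => simp
  | cons a L ih =>
    rw [List.flatMap_cons, Circuit.run_append, h a (by simp), map_smul,
      ih fun x hx => h x (by simp [hx]), smul_smul, List.map_cons, List.prod_cons]

theorem signCirc_run_ket (hm : 0 < m) (n : Fin (N - 1)) (s : Conf N m) (b fl : Bool)
    (p : Finset (Qubit N m) × Finset (Qubit N m)) :
    Circuit.run (signCirc (v + 1) hm n) (ket (lab s b fl p))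
      = ((∏ j : Fin m, if h : (j : ℕ) + 1 < m then
          (if Sum.inr (n, j) ∈ p.1 ∧ Sum.inr (n, j) ∈ p.2 then -Complex.I else 1) *
          (if Sum.inr (n, ⟨j + 1, h⟩) ∈ p.1 ∧ Sum.inr (n, j) ∈ p.2 then -1 else 1) else 1)
        * (if Sum.inr (n, ⟨0, hm⟩) ∈ p.1 ∧ Sum.inl (leftSite n) ∈ p.2 then Complex.I else 1)
        * (if Sum.inr (n, ⟨0, hm⟩) ∈ p.1 ∧ Sum.inl (rightSite n) ∈ p.2 then -Complex.I else 1)) •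
          ket (lab s b fl p) := by
  rw [signCirc, Circuit.run_append, Circuit.run_append, Fin.prod_univ_def]
  have h0 : ∀ q q' : Qubit N m, xWire (v + 1) q ≠ zWire (v + 1) q' := by simp
  rw [run_flatMap_of_phase _ _ _ (fun j : Fin m => if h : (j : ℕ) + 1 < m then
      (if Sum.inr (n, j) ∈ p.1 ∧ Sum.inr (n, j) ∈ p.2 then -Complex.I else 1) *
      (if Sum.inr (n, ⟨j + 1, h⟩) ∈ p.1 ∧ Sum.inr (n, j) ∈ p.2 then -1 else 1) else 1)]
  · rw [map_smul, map_smul, cs_run (h0 _ _), diag_ket, map_smul, csdg_run (h0 _ _), diag_ket,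
      smul_smul, smul_smul]
    simp only [lab_x, lab_z, Bool.and_eq_true, decide_eq_true_eq]
  · intro j _
    by_cases h : (j : ℕ) + 1 < m
    · simp only [dif_pos h]
      rw [Circuit.run_append, csdg_run (h0 _ _), diag_ket, map_smul, cz_run (h0 _ _), diag_ket,
        smul_smul]
      simp only [lab_x, lab_z, Bool.and_eq_true, decide_eq_true_eq]
    · simp [h]

theorem signCirc_run_of_notMem (hm : 0 < m) (n : Fin (N - 1)) (s : Conf N m) (b fl : Bool)
    (p : Finset (Qubit N m) × Finset (Qubit N m)) (hp : ∀ j, Sum.inr (n, j) ∉ p.1) :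
    Circuit.run (signCirc (v + 1) hm n) (ket (lab s b fl p)) = ket (lab s b fl p) := by
  rw [signCirc_run_ket]
  simp [hp]

theorem prod_hopPhase (n : Fin (N - 1)) (r : Fin m) {t : Finset (Qubit N m)} (ht : t ⊆ hopZ n r) :
    ∏ q ∈ t, hopPhase n r q
      = (∏ j : Fin m, if Sum.inr (n, j) ∈ t then (if j < r then Complex.I else -Complex.I) else 1)
        * (if Sum.inl (leftSite n) ∈ t then Complex.I else 1)
        * (if Sum.inl (rightSite n) ∈ t then -Complex.I else 1) := by
  have hlr := leftSite_ne_rightSite n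
  rw [← prod_ite_mem_eq t, Fintype.prod_sum_type, Fintype.prod_prod_type, mul_comm, mul_assoc]
  congr 1
  · rw [Fintype.prod_eq_single n]
    · simp [hopPhase, hopU]
    · intro n' hn'
      refine Finset.prod_eq_one fun j _ => if_neg fun h => hn' ?_
      exact ((mem_hopZ_inr _ _ _).mp (ht h)).1
  · rw [Fintype.prod_eq_mul (leftSite n) (rightSite n) hlr]
    · simp [hopPhase, hopU, hlr.symm]
    · intro i hi
      refine if_neg fun h => ?_
      rcases (mem_hopZ_inl _ _ _).mp (ht h) with h | h
      · exact hi.1 h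
      · exact hi.2 h

/-- A digit j in t contributes −i, and a further −1 if the x-digit j + 1 is set as well, that is if
j < r; this is `hopPhase`. The left and right site contribute i and −i. -/
theorem signCirc_run (hm : 0 < m) (n : Fin (N - 1)) (r : Fin m) (s : Conf N m) (b fl : Bool)
    {t : Finset (Qubit N m)} (ht : t ⊆ hopZ n r) (he : Even t.card) :
    Circuit.run (signCirc (v + 1) hm n) (ket (lab s b fl (hopX n r, t)))
      = (hopSign n r t : ℂ) • ket (lab s b fl (hopX n r, t)) := by
  rw [signCirc_run_ket, ← (hopSign_eq n r he).1, prod_hopPhase n r ht]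
  congr 3
  · refine Finset.prod_congr rfl fun j _ => ?_
    by_cases hj : Sum.inr (n, j) ∈ t
    · obtain ⟨-, h1, h2⟩ := (mem_hopZ_inr _ _ _).mp (ht hj)
      simp only at h1 h2
      have : (⟨j + 1, h2⟩ : Fin m) ≤ r ↔ j < r := Nat.succ_le_iff
      simp only [dif_pos h2, mem_hopX_inr, hj, h1, this, true_and, and_true, if_true]
      split_ifs <;> simp
    · simp [hj]
  · simp [Fin.le_def]
  · simp [Fin.le_def]

end Hops

/-! ### From selectors to the superposition of all terms -/

section Preparation

variable {N m v : ℕ}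

/-- Branch from the selectors of the link `n` to its terms, optionally with signs. -/
noncomputable def linkCirc (v : ℕ) (hm : 0 < m) (sgn : Bool) (n : Fin (N - 1)) :
    Circuit (Wire N m (v + 1)) :=
  pairCirc m v n ++ carryCirc m v n ++ hopCirc v hm n
    ++ (if sgn then signCirc (v + 1) hm n else [])

/-- Branch from the selectors to the terms. -/
noncomputable def linksCirc (N v : ℕ) (hm : 0 < m) (sgn : Bool) : Circuit (Wire N m (v + 1)) :=
  (List.finRange (N - 1)).flatMap (linkCirc v hm sgn)

/-- Carries, branching and signs are all controlled by the x-digits of the link, so diagonal terms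
and the terms of other links pass unchanged. -/
theorem linkCirc_run_of_notMem_fst (hm : 0 < m) (sgn : Bool) (n : Fin (N - 1)) (s : Conf N m)
    (b : Bool) (p : Finset (Qubit N m) × Finset (Qubit N m)) (hp : ∀ j, Sum.inr (n, j) ∉ p.1) :
    Circuit.run (carryCirc m v n ++ hopCirc v hm n ++ (if sgn then signCirc (v + 1) hm n else []))
      (ket (lab s b false p)) = ket (lab s b false p) := by
  rw [Circuit.run_append, Circuit.run_append, carryCirc_run_of_notMem hm n s b false p hp,
    hopCirc_run_of_notMem hm n s b false p hp]
  cases sgn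
  · simp
  · exact signCirc_run_of_notMem hm n s b false p hp

theorem linkCirc_eq (hm : 0 < m) (sgn : Bool) (n : Fin (N - 1)) :
    linkCirc v hm sgn n = pairCirc m v n ++ (carryCirc m v n ++ hopCirc v hm n
      ++ (if sgn then signCirc (v + 1) hm n else [])) := by
  simp [linkCirc]

theorem linkCirc_run_of_notMem (hm : 0 < m) (sgn : Bool) (n : Fin (N - 1)) (s : Conf N m)
    (b : Bool) (p : Finset (Qubit N m) × Finset (Qubit N m)) (hp : ∀ j, Sum.inr (n, j) ∉ p.1)
    (hp' : ∀ j, Sum.inr (n, j) ∉ p.2) :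
    Circuit.run (linkCirc v hm sgn n) (ket (lab s b false p)) = ket (lab s b false p) := by
  rw [linkCirc_eq, Circuit.run_append, pairCirc_run_of_notMem n s b p hp',
    linkCirc_run_of_notMem_fst hm sgn n s b p hp]

theorem linkCirc_run_digit (hm : 0 < m) (sgn : Bool) (n : Fin (N - 1)) (i : Fin m) (s : Conf N m)
    (b : Bool) : Circuit.run (linkCirc v hm sgn n) (ket (lab s b false (∅, {Sum.inr (n, i)})))
      = ((√2 / 2 : ℝ) : ℂ) ^ (i : ℕ) • ket (lab s b false (∅, {Sum.inr (n, i)}))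
        + ∑ j : Fin m, if j < i then ((√2 / 2 : ℝ) : ℂ) ^ ((i : ℕ) - j) •
          ket (lab s b false (∅, {Sum.inr (n, i), Sum.inr (n, j)})) else 0 := by
  rw [linkCirc_eq, Circuit.run_append, pairCirc_run, map_add, map_smul, map_sum,
    linkCirc_run_of_notMem_fst hm sgn n s b _ (by simp)]
  congr 1
  refine Finset.sum_congr rfl fun j _ => ?_
  by_cases hj : j < i
  · simp only [if_pos hj]
    rw [map_smul, linkCirc_run_of_notMem_fst hm sgn n s b _ (by simp)]
  · simp only [if_neg hj]
    rw [map_zero]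

theorem linkCirc_run_hop (hm : 0 < m) (sgn : Bool) (n : Fin (N - 1)) (r : Fin m) (s : Conf N m)
    (b : Bool) : Circuit.run (linkCirc v hm sgn n) (ket (lab s b false ({Sum.inr (n, r)}, ∅)))
      = ((√2 / 2 : ℝ) : ℂ) ^ ((hopZ n r).card - 1) • ∑ t ∈ (hopZ n r).powerset,
          if Even t.card then ((if sgn then hopSign n r t else 1 : ℝ) : ℂ) •
            ket (lab s b false (hopX n r, t)) else 0 := by
  rw [linkCirc, Circuit.run_append, Circuit.run_append, Circuit.run_append,
    pairCirc_run_of_notMem n s b _ (by simp), carryCirc_run, hopCirc_run]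
  cases sgn
  · simp
  · simp only [if_true]
    rw [map_smul, map_sum]
    congr 1
    refine Finset.sum_congr rfl fun t ht => ?_
    split_ifs with he
    · exact signCirc_run hm n r s b false (Finset.mem_powerset.mp ht) he
    · rw [map_zero]

theorem linksCirc_run_of_notMem (hm : 0 < m) (sgn : Bool) (s : Conf N m)
    (b : Bool) (p : Finset (Qubit N m) × Finset (Qubit N m)) (hp : ∀ q, Sum.inr q ∉ p.1)
    (hp' : ∀ q, Sum.inr q ∉ p.2) :
    Circuit.run (linksCirc N v hm sgn) (ket (lab s b false p)) = ket (lab s b false p) :=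
  run_flatMap_of_fixed _ _ _ fun n _ =>
    linkCirc_run_of_notMem hm sgn n s b p (fun _ => hp _) fun _ => hp' _

theorem linksCirc_run_digit (hm : 0 < m) (sgn : Bool) (n : Fin (N - 1)) (i : Fin m) (s : Conf N m)
    (b : Bool) : Circuit.run (linksCirc N v hm sgn) (ket (lab s b false (∅, {Sum.inr (n, i)})))
      = ((√2 / 2 : ℝ) : ℂ) ^ (i : ℕ) • ket (lab s b false (∅, {Sum.inr (n, i)}))
        + ∑ j : Fin m, if j < i then ((√2 / 2 : ℝ) : ℂ) ^ ((i : ℕ) - j) •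
          ket (lab s b false (∅, {Sum.inr (n, i), Sum.inr (n, j)})) else 0 := by
  rw [linksCirc, run_flatMap_of_mem _ (List.nodup_finRange _) _ _ n (List.mem_finRange n),
    linkCirc_run_digit]
  · intro n' _ hn'
    exact linkCirc_run_of_notMem hm sgn n' s b _ (by simp) (by simp [hn'])
  · intro n' _ hn'
    rw [linkCirc_run_digit, map_add, map_smul, map_sum,
      linkCirc_run_of_notMem hm sgn n' s b _ (by simp) (by simp [hn'])]
    congr 1
    refine Finset.sum_congr rfl fun j _ => ?_
    split_ifs
    · rw [map_smul, linkCirc_run_of_notMem hm sgn n' s b _ (by simp) (by simp [hn'])]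
    · rw [map_zero]

/-- The block of another link stays idle before and after: a hopping term sets no digit outside its
own link, and the shared site wires alone activate nothing. -/
theorem linksCirc_run_hop (hm : 0 < m) (sgn : Bool) (n : Fin (N - 1)) (r : Fin m) (s : Conf N m)
    (b : Bool) : Circuit.run (linksCirc N v hm sgn) (ket (lab s b false ({Sum.inr (n, r)}, ∅)))
      = ((√2 / 2 : ℝ) : ℂ) ^ ((hopZ n r).card - 1) • ∑ t ∈ (hopZ n r).powerset,
          if Even t.card then ((if sgn then hopSign n r t else 1 : ℝ) : ℂ) •
            ket (lab s b false (hopX n r, t)) else 0 := by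
  rw [linksCirc, run_flatMap_of_mem _ (List.nodup_finRange _) _ _ n (List.mem_finRange n),
    linkCirc_run_hop]
  · intro n' _ hn'
    exact linkCirc_run_of_notMem hm sgn n' s b _ (by simp [hn']) (by simp)
  · intro n' _ hn'
    rw [linkCirc_run_hop, map_smul, map_sum]
    congr 1
    refine Finset.sum_congr rfl fun t ht => ?_
    by_cases he : Even t.card
    · simp only [if_pos he]
      rw [map_smul, linkCirc_run_of_notMem hm sgn n' s b _ (by simp [hn'])]
      intro j hj
      exact hn' ((mem_hopZ_inr _ _ _).mp (Finset.mem_powerset.mp ht hj)).1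
    · simp only [if_neg he]
      rw [map_zero]

/-- The amplitudes of the terms in the prepared state. -/
noncomputable def termAmp (sgn : Bool) (a₀ : ℝ) (a : Sel N m → ℝ) : TermIdx N m → ℝ
  | .inl _ => a₀
  | .inr (.inl n) => a (.inl n)
  | .inr (.inr (.inl (n, i))) => a (.inr (.inl (n, i))) * (√2 / 2) ^ (i : ℕ)
  | .inr (.inr (.inr (.inl (n, i, j)))) =>
      if j < i then a (.inr (.inl (n, i))) * (√2 / 2) ^ ((i : ℕ) - j) else 0
  | .inr (.inr (.inr (.inr (n, r, t)))) =>
      if t ⊆ hopZ n r ∧ Even t.card then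
        a (.inr (.inr (n, r))) * ((√2 / 2) ^ ((hopZ n r).card - 1) * if sgn then hopSign n r t else 1)
      else 0

/-- The circuit that prepares a superposition of terms. -/
noncomputable def prepCirc (v : ℕ) (hm : 0 < m) (sgn : Bool) (L : List (Wire N m (v + 1) × ℝ)) :
    Circuit (Wire N m (v + 1)) :=
  selectCirc N m v L ++ linksCirc N v hm sgn

theorem prepCirc_run (hm : 0 < m) (sgn : Bool) {L : List (Wire N m (v + 1) × ℝ)} {ρ a₀ : ℝ}
    {a : Sel N m → ℝ} {s : Conf N m} {b : Bool}
    (hL : (ρ : ℂ) • Circuit.run (selectCirc N m v L) (ket (lab s b false (∅, ∅)))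
          = (a₀ : ℂ) • ket (lab s b false (∅, ∅))
            + ∑ k, (a k : ℂ) • ket (lab s b false (selLabel k))) :
    (ρ : ℂ) • Circuit.run (prepCirc v hm sgn L) (ket (lab s b false (∅, ∅)))
      = ∑ k, (termAmp sgn a₀ a k : ℂ) • ket (lab s b false (termLabel k)) := by
  rw [prepCirc, Circuit.run_append, ← map_smul, hL, map_add, map_smul, map_sum]
  simp only [map_smul]
  rw [linksCirc_run_of_notMem hm sgn s b _ (by simp) (by simp)]
  simp only [Fintype.sum_sum_type, Finset.univ_unique, Finset.sum_singleton, selLabel]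
  have hsite : ∀ n : Fin N, Circuit.run (linksCirc N v hm sgn)
      (ket (lab s b false (∅, {Sum.inl n}))) = ket (lab s b false (∅, {Sum.inl n})) :=
    fun n => linksCirc_run_of_notMem hm sgn s b _ (by simp) (by simp)
  simp only [Fintype.sum_prod_type, hsite, linksCirc_run_digit, linksCirc_run_hop, termAmp,
    termLabel, smul_add, Finset.sum_add_distrib, Finset.smul_sum, add_assoc]
  congr 1
  congr 1
  congr 1
  · refine Finset.sum_congr rfl fun n _ => Finset.sum_congr rfl fun i _ => ?_
    push_cast
    rw [smul_smul]
  congr 1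
  · refine Finset.sum_congr rfl fun n _ => Finset.sum_congr rfl fun i _ =>
      Finset.sum_congr rfl fun j _ => ?_
    split_ifs
    · push_cast
      rw [smul_smul]
    · simp
  · refine Finset.sum_congr rfl fun n _ => Finset.sum_congr rfl fun r _ => ?_
    rw [← Finset.sum_subset (Finset.subset_univ (hopZ n r).powerset)]
    · refine Finset.sum_congr rfl fun t ht => ?_
      rw [Finset.mem_powerset] at ht
      by_cases he : Even t.card
      · rw [if_pos he, if_pos (show t ⊆ hopZ n r ∧ Even t.card from ⟨ht, he⟩), smul_smul, smul_smul]
        congr 1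
        push_cast
        ring
      · rw [if_neg he, if_neg fun h => he h.2]; simp
    · intro t _ ht
      rw [Finset.mem_powerset] at ht
      rw [if_neg fun h => ht h.1]; simp

end Preparation

/-! ### Agreement of the amplitudes with the Pauli coefficients -/

section Amplitudes

variable {N m v : ℕ}

/-- The square root of the absolute value, optionally with the sign of the number. -/
noncomputable def signedSqrt (sgn : Bool) (y : ℝ) : ℝ := (if sgn then Real.sign y else 1) * √|y|

theorem signedSqrt_zero (sgn : Bool) : signedSqrt sgn 0 = 0 := by simp [signedSqrt]

theorem signedSqrt_mul_half_pow (sgn : Bool) (y : ℝ) (k : ℕ) :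
    signedSqrt sgn (y * (1 / 2) ^ k) = signedSqrt sgn y * (√2 / 2) ^ k := by
  have h1 : Real.sign (y * (1 / 2) ^ k) = Real.sign y := by
    have hp : (0 : ℝ) < (1 / 2) ^ k := by positivity
    rcases lt_trichotomy y 0 with h | h | h
    · rw [Real.sign_of_neg h, Real.sign_of_neg (mul_neg_of_neg_of_pos h hp)]
    · simp [h]
    · rw [Real.sign_of_pos h, Real.sign_of_pos (mul_pos h hp)]
  have h2 : √|y * (1 / 2) ^ k| = √|y| * (√2 / 2) ^ k := by
    rw [abs_mul, abs_of_nonneg (by positivity : (0 : ℝ) ≤ (1 / 2) ^ k), Real.sqrt_mul (abs_nonneg _)]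
    congr 1
    rw [Real.sqrt_eq_iff_mul_self_eq (by positivity) (by positivity), ← mul_pow]
    congr 1
    have := Real.mul_self_sqrt (show (0 : ℝ) ≤ 2 by norm_num)
    linarith
  rw [signedSqrt, signedSqrt, h1, h2]
  ring

theorem signedSqrt_mul_sign (sgn : Bool) (y : ℝ) {σ : ℝ} (hσ : σ = 1 ∨ σ = -1) :
    signedSqrt sgn (y * σ) = signedSqrt sgn y * if sgn then σ else 1 := by
  rcases hσ with rfl | rfl
  · simp
  · rw [mul_neg_one, signedSqrt, signedSqrt, abs_neg]
    cases sgn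
    · simp
    · have : Real.sign (-y) = -Real.sign y := Real.sign_neg
      simp [this]

/-- The total weight of the terms with a given selector. -/
noncomputable def selWeight (μ x : ℝ) : Sel N m → ℝ
  | .inl n => (-1) ^ ((n : ℕ) + 1) * (μ / 2)
  | .inr (.inl (_, i)) => (2 ^ (i : ℕ)) ^ 2 / 2
  | .inr (.inr _) => x

/-- The digit selector i has total weight 2^i/2 · (1 + Σ_{j<i} 2^j) = 4^i/2, of which the single
digit takes the fraction 2^{-i} and the pair (i, j) the fraction 2^{-(i-j)}: the probabilities of
the halving chain. A hopping selector has weight x, shared evenly up to sign by the 2^{|W|-1} even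
subsets of W = `hopZ n r`. -/
theorem termAmp_eq (sgn : Bool) (μ x c : ℝ) (k : TermIdx N m) :
    termAmp sgn (signedSqrt sgn (c * oneWeight N m μ))
        (fun k => signedSqrt sgn (c * selWeight μ x k)) k
      = signedSqrt sgn (c * termWeight μ x k) := by
  rcases k with _ | n | ⟨n, i⟩ | ⟨n, i, j⟩ | ⟨n, r, t⟩
  · rfl
  · rfl
  · simp only [termAmp, termWeight, selWeight]
    rw [← signedSqrt_mul_half_pow]
    congr 1
    rw [one_div, inv_pow]
    field_simp
  · simp only [termAmp, termWeight, selWeight]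
    by_cases hij : j < i
    · rw [if_pos hij, if_pos hij, ← signedSqrt_mul_half_pow]
      congr 1
      have : (2 : ℝ) ^ (i : ℕ) = 2 ^ (j : ℕ) * 2 ^ ((i : ℕ) - j) := by
        rw [← pow_add]; congr 1; have : (j : ℕ) < i := hij; omega
      rw [one_div, inv_pow, pow_two]
      nth_rw 2 [this]
      field_simp
    · rw [if_neg hij, if_neg hij, mul_zero, signedSqrt_zero]
  · simp only [termAmp, termWeight, selWeight, hopWeight]
    by_cases h : t ⊆ hopZ n r ∧ Even t.card
    · rw [if_pos h, if_pos h, ← mul_assoc, ← signedSqrt_mul_half_pow,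
        ← signedSqrt_mul_sign _ _ (hopSign_eq n r h.2).2]
      congr 1
      have hc : (hopZ n r).card - 1 + 1 = (hopZ n r).card :=
        Nat.sub_add_cancel (Finset.card_pos.mpr ⟨Sum.inl (leftSite n), by simp⟩)
      rw [← hc, pow_succ, one_div, inv_pow, hc]
      field_simp
    · rw [if_neg h, if_neg h, mul_zero, mul_zero, signedSqrt_zero]

theorem pauliCoeff_schwinger (hm : 0 < m) (μ x : ℝ) (p : Aux N m) :
    pauliCoeff (schwinger N m μ x) p = ∑ k, if auxLabel k = p then termWeight μ x k else 0 := by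
  rw [schwinger_eq_sum hm, pauliCoeff_sum]

/-- The lowest digit of the first link has coefficient 1/2, whatever μ and x are, and no other term
can cancel it. -/
theorem pauliNorm_ne_zero (hN : 2 ≤ N) (hm : 0 < m) (μ x : ℝ) : pauliNorm N m μ x ≠ 0 := by
  intro h0
  have h1 := (Finset.sum_eq_zero_iff_of_nonneg fun p _ => abs_nonneg _).mp h0
  set k : TermIdx N m := .inr (.inr (.inl (⟨0, by omega⟩, ⟨0, hm⟩))) with hk
  have hw : termWeight μ x k = 1 / 2 := by simp [hk, termWeight]
  have h2 := abs_eq_zero.mp (h1 (auxLabel k) (Finset.mem_univ _))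
  rw [pauliCoeff_schwinger hm, Finset.sum_eq_single k] at h2
  · rw [if_pos rfl, hw] at h2
    norm_num at h2
  · intro k' _ hne
    split_ifs with h
    · by_contra hw'
      exact hne (auxLabel_injOn μ x k' k hw' (by rw [hw]; norm_num) h)
    · rfl
  · simp

/-- The two states of the block encoding. -/
noncomputable def stateOf (N m : ℕ) (μ x : ℝ) (sgn : Bool) : Aux N m → ℂ :=
  if sgn then stateGt N m μ x else stateG N m μ x

theorem stateOf_norm (sgn : Bool) {μ x : ℝ} (h : pauliNorm N m μ x ≠ 0) :
    star (stateOf N m μ x sgn) ⬝ᵥ stateOf N m μ x sgn = 1 := by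
  cases sgn
  · exact stateG_norm h
  · exact stateGt_norm h

theorem stateOf_eq (hm : 0 < m) (μ x : ℝ) (sgn : Bool) :
    stateOf N m μ x sgn = ∑ k, (signedSqrt sgn ((pauliNorm N m μ x)⁻¹ * termWeight μ x k) : ℂ) •
      Pi.single (auxLabel k) (1 : ℂ) := by
  have h1 : ∀ p, stateOf N m μ x sgn p = (signedSqrt sgn (pauliCoeff (normHam N m μ x) p) : ℂ) := by
    intro p
    cases sgn <;> simp [stateOf, stateG, stateGt, signedSqrt]
  funext p
  rw [h1, normHam, pauliCoeff_smul, pauliCoeff_schwinger hm, Finset.sum_apply,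
    map_sum_ite_of_injOn (termWeight μ x) auxLabel (auxLabel_injOn μ x)
      (fun y => (signedSqrt sgn ((pauliNorm N m μ x)⁻¹ * y) : ℂ)) (by simp [signedSqrt_zero])]
  refine Finset.sum_congr rfl fun k _ => ?_
  simp [Pi.single_apply, eq_comm]

theorem lab_false (s : Conf N m) (b : Bool) (p : Finset (Qubit N m) × Finset (Qubit N m)) :
    lab (v := v) s b false p = cfg s (ind p.1) (ind p.2) (fun _ => false) b := by
  simp [lab]

theorem embed_single_tensor_single (s : Conf N m) (b : Bool) (p : Aux N m) :
    embed (w := v) b (tensor (Pi.single s 1) (Pi.single p 1))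
      = ket (cfg s p.1 p.2 (fun _ => false) b) := by
  rw [← embed_single b (s, p)]
  congr 1
  funext ⟨s', p'⟩
  simp only [tensor, Pi.single_apply, Prod.mk.injEq]
  by_cases h : s' = s <;> by_cases h' : p' = p <;> simp [h, h']

theorem embed_tensor_sum {K : Type*} [Fintype K] (b : Bool) (ψ : Conf N m → ℂ) (c : K → ℂ)
    (g : K → Aux N m → ℂ) :
    embed (w := v) b (tensor ψ (∑ k, c k • g k)) = ∑ k, c k • embed b (tensor ψ (g k)) := by
  have : tensor ψ (∑ k, c k • g k) = ∑ k, c k • tensor ψ (g k) := by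
    funext a
    simp only [tensor, Finset.sum_apply, Pi.smul_apply, smul_eq_mul, Finset.mul_sum]
    exact Finset.sum_congr rfl fun k _ => by ring
  rw [this, embed_sum]
  simp only [embed_smul]

theorem embed_tensor_eq_sum (b : Bool) (ψ : Conf N m → ℂ) (g : Aux N m → ℂ) :
    embed (w := v) b (tensor ψ g) = ∑ s, ψ s • embed b (tensor (Pi.single s 1) g) := by
  have : tensor ψ g = ∑ s, ψ s • tensor (Pi.single s 1) g := by
    funext a
    simp [tensor, Finset.sum_apply, Pi.single_apply]
  rw [this, embed_sum]
  simp only [embed_smul]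

theorem embed_tensor_auxZero (s : Conf N m) (b : Bool) :
    embed (w := v + 1) b (tensor (Pi.single s 1) (auxZero N m)) = ket (lab s b false (∅, ∅)) := by
  rw [auxZero, embed_single_tensor_single, lab_false]
  have : ind (∅ : Finset (Qubit N m)) = fun _ => false := by funext q; simp [ind]
  simp only [this]

/-- Selector amplitudes are the signed or unsigned roots of the normalised selector weights;
linearity extends the action on basis vectors to all states of the system. -/
theorem exists_prepCirc (hN : 2 ≤ N) (hm : 0 < m) (μ x : ℝ) (sgn : Bool) (v : ℕ) :
    ∃ L : List (Wire N m (v + 1) × ℝ),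
      L.map Prod.fst = Finset.univ.toList.map (selWire (v + 1)) ∧
      Prepares (prepCirc v hm sgn L) (stateOf N m μ x sgn) := by
  obtain ⟨L, ρ, hρ, hL, hrun⟩ := exists_selectCirc (N := N) (m := m) (by omega) v
    (signedSqrt sgn ((pauliNorm N m μ x)⁻¹ * oneWeight N m μ))
    (fun k => signedSqrt sgn ((pauliNorm N m μ x)⁻¹ * selWeight μ x k))
  refine ⟨L, hL, ?_⟩
  have h1 : ∀ (s : Conf N m) (b : Bool),
      (ρ : ℂ) • Circuit.run (prepCirc v hm sgn L) (ket (lab s b false (∅, ∅)))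
        = embed b (tensor (Pi.single s 1) (stateOf N m μ x sgn)) := by
    intro s b
    rw [prepCirc_run hm sgn (hrun s b), stateOf_eq hm, embed_tensor_sum]
    refine Finset.sum_congr rfl fun k _ => ?_
    rw [termAmp_eq, embed_single_tensor_single, lab_false]
    rfl
  -- Circuits preserve the norm and the target state is normalised, so ρ² = 1; the sign follows from
  -- ρ ≥ 0.
  have hρ1 : ρ = 1 := by
    set s : Conf N m := fun _ => false
    have h2 : star ((ρ : ℂ) • Circuit.run (prepCirc v hm sgn L) (ket (lab s false false (∅, ∅))))
        ⬝ᵥ ((ρ : ℂ) • Circuit.run (prepCirc v hm sgn L) (ket (lab s false false (∅, ∅))))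
        = ((ρ * ρ : ℝ) : ℂ) := by
      rw [star_smul, smul_dotProduct, dotProduct_smul, ← Circuit.dotProduct_run_inv,
        Circuit.run_inv_run, star_ket_dotProduct, ket_apply]
      simp
    have h3 : auxContract (stateOf N m μ x sgn) (tensor (Pi.single s 1) (stateOf N m μ x sgn))
        = Pi.single s 1 := auxContract_tensor (stateOf_norm sgn (pauliNorm_ne_zero hN hm μ x)) _
    rw [h1, star_embed_dotProduct_embed, if_pos rfl, star_tensor_dotProduct, h3] at h2
    have h4 : (ρ * ρ : ℝ) = 1 := by
      have : star (Pi.single s 1 : Conf N m → ℂ) ⬝ᵥ Pi.single s 1 = 1 := by simp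
      rw [this] at h2
      exact_mod_cast h2.symm
    nlinarith
  intro b ψ
  rw [← Circuit.run_apply, embed_tensor_eq_sum, embed_tensor_eq_sum b ψ (stateOf N m μ x sgn),
    map_sum]
  refine Finset.sum_congr rfl fun s _ => ?_
  rw [map_smul, embed_tensor_auxZero, ← h1, hρ1, Complex.ofReal_one, one_smul]

end Amplitudes

/-! ### Wires that are not changed by a circuit -/

section Targets

variable {ι : Type}

/-- The wire that a gate may change. -/
def Gate.target : Gate ι → ι
  | .x q => q
  | .h q => q
  | .s q => q
  | .sdg q => q
  | .t q => q
  | .tdg q => q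
  | .rz _ q => q
  | .cnot _ q _ => q

/-- The circuit has no gate with target `q`. -/
def Circuit.Fixes (q : ι) (C : Circuit ι) : Prop := ∀ g ∈ C, g.target ≠ q

theorem Circuit.Fixes.append {q : ι} {C D : Circuit ι} (hC : Circuit.Fixes q C)
    (hD : Circuit.Fixes q D) : Circuit.Fixes q (C ++ D) := by
  intro g hg
  rcases List.mem_append.mp hg with h | h
  exacts [hC g h, hD g h]

theorem Circuit.Fixes.flatMap {α : Type*} {q : ι} {L : List α} {f : α → Circuit ι}
    (h : ∀ a ∈ L, Circuit.Fixes q (f a)) : Circuit.Fixes q (L.flatMap f) := by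
  intro g hg
  obtain ⟨a, ha, hga⟩ := List.mem_flatMap.mp hg
  exact h a ha g hga

theorem Circuit.Fixes.inv {q : ι} {C : Circuit ι} (hC : Circuit.Fixes q C) :
    Circuit.Fixes q (Circuit.inv C) := by
  intro g hg
  rw [Circuit.inv, List.mem_reverse] at hg
  obtain ⟨g', hg', rfl⟩ := List.mem_map.mp hg
  have : g'.dagger.target = g'.target := by cases g' <;> rfl
  rw [this]
  exact hC g' hg'

theorem Circuit.fixes_nil (q : ι) : Circuit.Fixes q [] := by simp [Circuit.Fixes]

theorem Circuit.fixes_singleton {q : ι} {g : Gate ι} (h : g.target ≠ q) :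
    Circuit.Fixes q [g] := by simpa [Circuit.Fixes] using h

variable [DecidableEq ι] {q a b t f : ι}

theorem cx_fixes (h : b ≠ q) : Circuit.Fixes q (cx a b) := by
  unfold cx
  split_ifs
  · exact Circuit.fixes_singleton h
  · exact Circuit.fixes_nil q

theorem cs_fixes (ha : a ≠ q) (hb : b ≠ q) : Circuit.Fixes q (cs a b) := by
  refine ((Circuit.Fixes.append ?_ (cx_fixes hb)).append (Circuit.fixes_singleton (g := .tdg b) hb)).append
    (cx_fixes hb)
  simpa [Circuit.Fixes, Gate.target] using ⟨ha, hb⟩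

theorem csdg_fixes (ha : a ≠ q) (hb : b ≠ q) : Circuit.Fixes q (csdg a b) := by
  refine ((Circuit.Fixes.append ?_ (cx_fixes hb)).append (Circuit.fixes_singleton (g := .t b) hb)).append
    (cx_fixes hb)
  simpa [Circuit.Fixes, Gate.target] using ⟨ha, hb⟩

theorem cz_fixes (ha : a ≠ q) (hb : b ≠ q) : Circuit.Fixes q (cz a b) :=
  (cs_fixes ha hb).append (cs_fixes ha hb)

theorem ccx_fixes (ha : a ≠ q) (hb : b ≠ q) (ht : t ≠ q) : Circuit.Fixes q (ccx a b t) := by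
  refine (Circuit.Fixes.append (Circuit.fixes_singleton (g := .h t) ht) ?_).append
    (Circuit.fixes_singleton (g := .h t) ht)
  exact ((((cs_fixes hb ht).append (cx_fixes hb)).append (csdg_fixes hb ht)).append
    (cx_fixes hb)).append (cs_fixes ha ht)

theorem cry_fixes (θ : ℝ) (h : b ≠ q) : Circuit.Fixes q (cry θ f b) := by
  have h1 : ∀ θ, Circuit.Fixes q (ry θ b) := by
    intro θ; simpa [ry, Circuit.Fixes, Gate.target] using h
  exact (((h1 _).append (cx_fixes h)).append (h1 _)).append (cx_fixes h)

theorem chain_fixes {L : List (ι × ℝ)} (hf : f ≠ q) (hL : ∀ p ∈ L, p.1 ≠ q) :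
    Circuit.Fixes q (chain f L) :=
  Circuit.Fixes.flatMap fun p hp => (cry_fixes _ (hL p hp)).append (cx_fixes hf)

theorem parityCirc_fixes {L : List ι} (hf : f ≠ q) : Circuit.Fixes q (parityCirc f L) :=
  Circuit.Fixes.flatMap fun _ _ => cx_fixes hf

theorem fillDown_fixes {d : ℕ → ι} {n : ℕ} (hd : ∀ j < n, d j ≠ q) :
    Circuit.Fixes q (fillDown d n) := by
  refine Circuit.Fixes.flatMap fun j hj => cx_fixes (hd j ?_)
  simpa using hj

theorem evenBranch_fixes {P : List (ι × ι)} (hb : b ≠ q) (hP : ∀ p ∈ P, p.1 ≠ q ∧ p.2 ≠ q) :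
    Circuit.Fixes q (evenBranch b P) :=
  Circuit.Fixes.flatMap fun p hp =>
    (cry_fixes _ (hP p hp).2).append (ccx_fixes (hP p hp).1 (hP p hp).2 hb)

variable [Fintype ι]

theorem Gate.run_apply_eq_zero {g : Gate ι} (hg : g.target ≠ q) {v : (ι → Bool) → ℂ}
    (hv : ∀ c, c q = true → v c = 0) (c : ι → Bool) (hc : c q = true) : g.run v c = 0 := by
  have h1 : ∀ (t : ι) (A : Matrix Bool Bool ℂ), t ≠ q → (onWire t A *ᵥ v) c = 0 := by
    intro t A ht
    rw [onWire_mulVec, hv _ (by rwa [Function.update_of_ne ht.symm]),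
      hv _ (by rwa [Function.update_of_ne ht.symm])]
    simp
  cases g with
  | cnot a t h =>
    rw [cnot_run]
    have ht : q ≠ t := Ne.symm hg
    exact hv _ (by rwa [Function.update_of_ne ht])
  | _ => exact h1 _ _ hg

/-- `Prepares` only speaks of the zero state, but a rotation applies the inverse preparation to
arbitrary states. This keeps the ancillas of the rotation at 0 meanwhile. -/
theorem Circuit.run_apply_eq_zero {C : Circuit ι} (hC : Circuit.Fixes q C)
    {v : (ι → Bool) → ℂ} (hv : ∀ c, c q = true → v c = 0) (c : ι → Bool) (hc : c q = true) :
    Circuit.run C v c = 0 := by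
  induction C generalizing v with
  | nil => simpa using hv c hc
  | cons g C ih =>
    rw [Circuit.run_cons]
    exact ih (fun g' hg' => hC g' (by simp [hg']))
      (Gate.run_apply_eq_zero (hC g (by simp)) hv)

end Targets

/-! ### Untouched ancillas and gate count of the preparation -/

section PreparationCost

variable {N m v : ℕ}

theorem linkCirc_fixes (hm : 0 < m) (sgn : Bool) (n : Fin (N - 1)) (i : Fin v) :
    Circuit.Fixes (ancWire N m i.succ) (linkCirc v hm sgn n) := by
  have hf : flagWire N m v ≠ ancWire N m i.succ := by simp [(Fin.succ_ne_zero i).symm]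
  have hz : ∀ q : Qubit N m, zWire (v + 1) q ≠ ancWire N m i.succ := by simp
  have hx : ∀ q : Qubit N m, xWire (v + 1) q ≠ ancWire N m i.succ := by simp
  refine ((Circuit.Fixes.append ?_ ?_).append ?_).append ?_
  · refine (chain_fixes hf ?_).append (parityCirc_fixes hf)
    intro p hp
    simp only [halvingList, List.mem_map, List.mem_reverse, List.mem_range] at hp
    obtain ⟨j, hj, rfl⟩ := hp
    rw [zDigit_of_lt hj]
    exact hz _
  · refine ((fillDown_fixes fun j hj => ?_).append (cx_fixes (hx _))).append (cx_fixes (hx _))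
    rw [xDigit_of_lt (show j < m by omega)]
    exact hx _
  · refine evenBranch_fixes (hz _) fun p hp => ?_
    rcases mem_hopPairs.mp hp with rfl | ⟨j, hj, rfl⟩
    · exact ⟨hx _, hz _⟩
    · exact ⟨hx _, hz _⟩
  · cases sgn
    · exact Circuit.fixes_nil _
    · refine (Circuit.Fixes.append (Circuit.Fixes.flatMap fun j _ => ?_)
        (cs_fixes (hx _) (hz _))).append (csdg_fixes (hx _) (hz _))
      split_ifs
      · exact (csdg_fixes (hx _) (hz _)).append (cz_fixes (hx _) (hz _))
      · exact Circuit.fixes_nil _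

theorem prepCirc_fixes (hm : 0 < m) (sgn : Bool) {L : List (Wire N m (v + 1) × ℝ)}
    (hL : L.map Prod.fst = Finset.univ.toList.map (selWire (v + 1))) (i : Fin v) :
    Circuit.Fixes (ancWire N m i.succ) (prepCirc v hm sgn L) := by
  have hf : flagWire N m v ≠ ancWire N m i.succ := by simp [(Fin.succ_ne_zero i).symm]
  refine Circuit.Fixes.append ?_ (Circuit.Fixes.flatMap fun n _ => linkCirc_fixes hm sgn n i)
  refine ((Circuit.Fixes.append (Circuit.fixes_singleton (g := .x _) hf)
    (chain_fixes hf fun p hp => ?_)).append (parityCirc_fixes hf)).append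
      (Circuit.fixes_singleton (g := .x _) hf)
  have : p.1 ∈ L.map Prod.fst := List.mem_map_of_mem hp
  rw [hL] at this
  obtain ⟨k, -, hk⟩ := List.mem_map.mp this
  rw [← hk]
  rcases k with n | q | q <;> simp [selWire]

theorem linkCirc_length (hm : 0 < m) (sgn : Bool) (n : Fin (N - 1)) :
    (linkCirc v hm sgn n).length ≤ 61 * m + 43 := by
  have h1 : (pairCirc m v n).length ≤ 14 * m := by
    have h1 := chain_length (flagWire N m v) (halvingList (zDigit v n) m)
    have h2 := parityCirc_length (flagWire N m v) ((List.range m).map (zDigit v n))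
    simp only [halvingList, List.length_map, List.length_reverse, List.length_range] at h1 h2
    rw [pairCirc, List.length_append]
    simp only [halvingList]
    omega
  have h2 : (carryCirc m v n).length ≤ m + 2 := by
    have h1 := fillDown_length (xDigit (N := N) (m := m) v n) (m - 1)
    have h2 := cx_length (xDigit v n 0) (xWire (v + 1) (Sum.inl (leftSite n) : Qubit N m))
    have h3 := cx_length (xDigit v n 0) (xWire (v + 1) (Sum.inl (rightSite n) : Qubit N m))
    rw [carryCirc, List.length_append, List.length_append]
    omega
  have h3 : (hopCirc v hm n).length ≤ 31 * m + 31 := by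
    have h1 := evenBranch_length (zWire (v + 1) (Sum.inl (rightSite n))) (hopPairs (v + 1) hm n)
    have h2 : (hopPairs (v + 1) hm n).length ≤ m + 1 := by
      rw [hopPairs, List.length_cons, List.length_map]
      have := List.length_filter_le (fun j : Fin m => (j : ℕ) + 1 < m) (List.finRange m)
      rw [List.length_finRange] at this
      omega
    rw [hopCirc]
    omega
  have h4 : (signCirc (v + 1) hm n).length ≤ 15 * m + 10 := by
    have h1 := cs_length (xWire (v + 1) (Sum.inr (n, ⟨0, hm⟩))) (zWire (v + 1) (Sum.inl (leftSite n)))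
    have h2 := csdg_length (xWire (v + 1) (Sum.inr (n, ⟨0, hm⟩)))
      (zWire (v + 1) (Sum.inl (rightSite n)))
    have h3 := length_flatMap_le (List.finRange m) (fun j : Fin m => if h : (j : ℕ) + 1 < m then
      csdg (xWire (v + 1) (Sum.inr (n, j))) (zWire (v + 1) (Sum.inr (n, j)))
        ++ cz (xWire (v + 1) (Sum.inr (n, ⟨j + 1, h⟩))) (zWire (v + 1) (Sum.inr (n, j))) else [])
      15 fun j _ => by
        split_ifs with h
        · have h1 := csdg_length (xWire (v + 1) (Sum.inr (n, j))) (zWire (v + 1) (Sum.inr (n, j)))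
          have h2 := cz_length (xWire (v + 1) (Sum.inr (n, ⟨j + 1, h⟩)))
            (zWire (v + 1) (Sum.inr (n, j)))
          rw [List.length_append]
          omega
        · simp
    rw [List.length_finRange] at h3
    rw [signCirc, List.length_append, List.length_append]
    omega
  rw [linkCirc, List.length_append, List.length_append, List.length_append]
  cases sgn
  · simp only [Bool.false_eq_true, if_false, List.length_nil]
    omega
  · simp only [if_true]
    omega

theorem prepCirc_length (hN : 2 ≤ N) (hm : 0 < m) (sgn : Bool) {L : List (Wire N m (v + 1) × ℝ)}
    (hL : L.map Prod.fst = Finset.univ.toList.map (selWire (v + 1))) :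
    (prepCirc v hm sgn L).length ≤ 148 * (N * m) := by
  have h1 := selectCirc_length L hL
  have h2 := length_flatMap_le (List.finRange (N - 1)) (linkCirc v hm sgn) _
    fun n _ => linkCirc_length hm sgn n
  rw [List.length_finRange] at h2
  rw [prepCirc, linksCirc, List.length_append]
  obtain ⟨M, rfl⟩ : ∃ M, N = M + 1 := ⟨N - 1, by omega⟩
  simp only [Nat.add_sub_cancel] at h1 h2
  have h3 : M ≤ M * m := Nat.le_mul_of_pos_right M hm
  have h4 : M * (61 * m + 43) = 61 * (M * m) + 43 * M := by ring
  have h5 : (M + 1) * m = M * m + m := by ring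
  omega

end PreparationCost

/-! ### The controlled Pauli operators -/

section BlockEncoding

variable {N m w : ℕ}

/-- The Pauli operators on a list of qubits, controlled by the auxiliary register. -/
def pauliCirc (w : ℕ) (L : List (Qubit N m)) : Circuit (Wire N m w) :=
  L.flatMap fun q => cz (zWire w q) (Sum.inl q) ++ cx (xWire w q) (Sum.inl q)
    ++ cs (xWire w q) (zWire w q)

theorem cfg_update_sys (s x z : Conf N m) (A : Fin w → Bool) (b : Bool) (q : Qubit N m) (t : Bool) :
    Function.update (cfg s x z A b) (Sum.inl q) t = cfg (Function.update s q t) x z A b := by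
  funext q'
  rcases q' with q' | q'
  · by_cases h : q' = q
    · subst h; simp [cfg]
    · rw [Function.update_of_ne (by simpa using h)]
      simp [cfg, h]
  · rw [Function.update_of_ne (by simp)]
    rfl

/-- Per qubit, the controlled sign comes before the CNOT, which gives X^x Z^z in this order, and the
controlled phase on the two label wires supplies i^{xz}. -/
theorem pauliCirc_run_ket (L : List (Qubit N m)) (hL : L.Nodup) (s x z : Conf N m)
    (A : Fin w → Bool) (b : Bool) : Circuit.run (pauliCirc w L) (ket (cfg s x z A b))
      = (L.map fun q => pauliPhase (x q) (z q) (s q)).prod •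
        ket (cfg (fun q => if q ∈ L.toFinset then xor (s q) (x q) else s q) x z A b) := by
  induction L generalizing s with
  | nil => simp [pauliCirc]
  | cons q L ih =>
    rw [List.nodup_cons] at hL
    have e : pauliCirc w (q :: L) = (cz (zWire w q) (Sum.inl q) ++ cx (xWire w q) (Sum.inl q)
        ++ cs (xWire w q) (zWire w q)) ++ pauliCirc w L := by simp [pauliCirc]
    have h1 : Circuit.run (cz (zWire w q) (Sum.inl q) ++ cx (xWire w q) (Sum.inl q)
        ++ cs (xWire w q) (zWire w q)) (ket (cfg s x z A b))
        = pauliPhase (x q) (z q) (s q) •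
          ket (cfg (Function.update s q (xor (s q) (x q))) x z A b) := by
      rw [Circuit.run_append, Circuit.run_append, cz_run (by simp), diag_ket, map_smul,
        cx_run_ket (by simp), map_smul, cs_run (by simp), diag_ket, smul_smul]
      change ((if z q && s q then (-1 : ℂ) else 1) *
        (if Function.update (cfg s x z A b) (Sum.inl q) _ (xWire w q) &&
          Function.update (cfg s x z A b) (Sum.inl q) _ (zWire w q) then Complex.I else 1)) •
          ket (Function.update (cfg s x z A b) (Sum.inl q) (xor (s q) (x q))) = _
      rw [Function.update_of_ne (by simp), Function.update_of_ne (by simp), cfg_update_sys,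
        pauliPhase, mul_comm]
      rfl
    rw [e, Circuit.run_append, h1, map_smul, ih hL.2, smul_smul, List.map_cons, List.prod_cons]
    have h2 : (L.map fun q' => pauliPhase (x q') (z q') (Function.update s q (xor (s q) (x q)) q'))
        = L.map fun q' => pauliPhase (x q') (z q') (s q') := by
      refine List.map_congr_left fun q' hq' => ?_
      have : q' ≠ q := by
        rintro rfl
        exact hL.1 hq'
      rw [Function.update_of_ne this]
    rw [h2]
    congr 3
    funext q'
    rw [List.toFinset_cons]
    by_cases h : q' = q
    · subst h
      have : q' ∉ L.toFinset := fun h => hL.1 (List.mem_toFinset.mp h)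
      rw [if_neg this, if_pos (Finset.mem_insert_self _ _), Function.update_self]
    · rw [Function.update_of_ne h]
      refine if_congr ?_ rfl rfl
      rw [Finset.mem_insert, or_iff_right h]

theorem blockU_mulVec_single (s x z : Conf N m) : blockU N m *ᵥ Pi.single (s, (x, z)) 1
    = (∏ q, pauliPhase (x q) (z q) (s q)) •
      Pi.single ((fun q => xor (s q) (x q)), (x, z)) (1 : ℂ) := by
  funext ⟨s', p⟩
  rw [blockU_mulVec]
  by_cases hp : p = (x, z)
  · subst hp
    rw [Finset.sum_eq_single s]
    · rw [pauli_apply]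
      simp [Pi.single_apply]
    · intro t _ ht
      simp [ht]
    · simp
  · simp [hp]

theorem implements_of_single {C : Circuit (Wire N m w)}
    {A : Bool → Matrix (Conf N m × Aux N m) (Conf N m × Aux N m) ℂ}
    (h : ∀ b a, Circuit.run C (embed b (Pi.single a 1)) = embed b (A b *ᵥ Pi.single a 1)) :
    Implements C A := by
  intro b Ψ
  have h1 : Ψ = ∑ a, Ψ a • Pi.single a (1 : ℂ) := by
    funext a
    simp [Finset.sum_apply, Pi.single_apply]
  rw [← Circuit.run_apply, h1, embed_sum, map_sum, Matrix.mulVec_sum, embed_sum]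
  refine Finset.sum_congr rfl fun a _ => ?_
  rw [embed_smul, map_smul, h, Matrix.mulVec_smul, embed_smul]

theorem pauliCirc_implements :
    Implements (pauliCirc w (Finset.univ.toList : List (Qubit N m))) (fun _ => blockU N m) := by
  refine implements_of_single fun b ⟨s, x, z⟩ => ?_
  rw [embed_single, pauliCirc_run_ket _ (Finset.nodup_toList _), blockU_mulVec_single, embed_smul,
    embed_single, Finset.prod_map_toList]
  simp only [Finset.toList_toFinset, Finset.mem_univ, if_true]

theorem pauliCirc_length :
    (pauliCirc w (Finset.univ.toList : List (Qubit N m))).length ≤ 16 * (N + (N - 1) * m) := by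
  have h := length_flatMap_le (Finset.univ.toList : List (Qubit N m))
    (fun q => cz (zWire w q) (Sum.inl q) ++ cx (xWire w q) (Sum.inl q)
      ++ cs (xWire w q) (zWire w q)) 16 fun q _ => by
        have h1 := cz_length (zWire w q) (Sum.inl q)
        have h2 := cx_length (xWire w q) (Sum.inl q)
        have h3 := cs_length (xWire w q) (zWire w q)
        rw [List.length_append, List.length_append]
        omega
  rw [Finset.length_toList, Finset.card_univ] at h
  simp only [Fintype.card_sum, Fintype.card_prod, Fintype.card_fin] at h
  rw [pauliCirc]
  omega

end BlockEncoding

/-! ### Phases on the zero state -/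

section ZeroPhase

variable {ι : Type} [DecidableEq ι]

/-- Multiply by `e^{2iφ}` or `e^{-2iφ}`, according to the wire `p`, if the wire `g` is set. -/
def flagPhase (p g : ι) (φ : ℝ) : Circuit ι :=
  cx p g ++ [Gate.rz (2 * φ) g] ++ cx p g ++ [Gate.rz (-(2 * φ)) p]

/-- Write `g ∧ ¬a` to the wire `g'`. -/
def andNot (g a g' : ι) : Circuit ι := [Gate.x a] ++ ccx a g g' ++ [Gate.x a]

/-- The phase of `flagPhase`, subject to the condition that all first components of the list are 0.
The second components are work space. -/
def zeroPhase (p : ι) (φ : ℝ) : ι → List (ι × ι) → Circuit ι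
  | g, [] => flagPhase p g φ
  | g, (a, g') :: L => andNot g a g' ++ zeroPhase p φ g' L ++ andNot g a g'

theorem zeroPhase_length (p : ι) (φ : ℝ) (g : ι) (L : List (ι × ι)) :
    (zeroPhase p φ g L).length ≤ 4 + 42 * L.length := by
  induction L generalizing g with
  | nil =>
    have := cx_length p g
    simp only [zeroPhase, flagPhase, List.length_append, List.length_cons, List.length_nil]
    omega
  | cons a L ih =>
    have h1 := ccx_length a.1 g a.2
    have h2 := ih a.2
    simp only [zeroPhase, andNot, List.length_append, List.length_cons, List.length_nil]
    omega

variable [Fintype ι]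

/-- The phase of the rotation, with a sign that depends on the rotation qubit. -/
noncomputable def rotPhase (φ : ℝ) (b : Bool) : ℂ :=
  Complex.exp (2 * Complex.I * ((if b then -φ else φ : ℝ) : ℂ))

/-- The first R_z acts on p ⊕ g and the second, with opposite angle, on p. For g = 0 they cancel;
for g = 1 they add up to 2φ or −2φ, according to p. -/
theorem flagPhase_run_ket {p g : ι} (h : p ≠ g) (φ : ℝ) (c : ι → Bool) :
    Circuit.run (flagPhase p g φ) (ket c) = (if c g then rotPhase φ (c p) else 1) • ket c := by
  simp only [flagPhase, Circuit.run_append, Circuit.run_cons, Circuit.run_nil, rz_run]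
  rw [cx_run_ket h, diag_ket, map_smul, cx_run_ket h]
  simp only [Function.update_self, Function.update_of_ne h, Function.update_idem, Bool.xor_assoc,
    Bool.xor_self, Bool.xor_false, Function.update_eq_self]
  have h2 := diag_ket (fun d => if d p then Complex.exp ((-(2 * φ) / 2 : ℝ) * Complex.I)
    else Complex.exp (-(-(2 * φ) / 2 : ℝ) * Complex.I)) c
  funext d
  have h3 := congrFun h2 d
  simp only [Pi.smul_apply, smul_eq_mul] at h3 ⊢
  rw [mul_left_comm, h3, ← mul_assoc]
  congr 1
  unfold rotPhase
  rcases c g <;> rcases c p <;>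
    simp only [Bool.xor_false, Bool.xor_true, Bool.not_false, Bool.not_true, Bool.false_eq_true,
      if_true, if_false, ← Complex.exp_add]
  · rw [← Complex.exp_zero]; congr 1; push_cast; ring
  · rw [← Complex.exp_zero]; congr 1; push_cast; ring
  · congr 1; push_cast; ring
  · congr 1; push_cast; ring

theorem andNot_run_ket {g a g' : ι} (h1 : a ≠ g) (h2 : a ≠ g') (h3 : g ≠ g') (c : ι → Bool) :
    Circuit.run (andNot g a g') (ket c)
      = ket (Function.update c g' (xor (c g') (!c a && c g))) := by
  simp only [andNot, Circuit.run_append, Circuit.run_cons, Circuit.run_nil]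
  rw [x_run_ket, ccx_run_ket h1 h2 h3, x_run_ket]
  congr 1
  rw [Function.update_self, Function.update_of_ne h1.symm, Function.update_of_ne h2.symm,
    Function.update_of_ne h2, Function.update_self, Bool.not_not,
    Function.update_comm h2.symm, Function.update_idem, Function.update_eq_self]

/-- Compute and uncompute: each rung writes the condition so far, together with the next wire being
0, to a fresh ancilla, and the same self-inverse circuit clears it after the phase. -/
theorem zeroPhase_run_ket {p : ι} (φ : ℝ) (g : ι) (L : List (ι × ι))
    (hN : (g :: L.map Prod.snd).Nodup)
    (h1 : ∀ a ∈ L.map Prod.fst, a ∉ g :: L.map Prod.snd) (hp : p ∉ g :: L.map Prod.snd)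
    (c : ι → Bool) (hc : ∀ g' ∈ L.map Prod.snd, c g' = false) :
    Circuit.run (zeroPhase p φ g L) (ket c)
      = (if c g = true ∧ ∀ a ∈ L.map Prod.fst, c a = false then rotPhase φ (c p) else 1) •
        ket c := by
  induction L generalizing g c with
  | nil =>
    rw [zeroPhase, flagPhase_run_ket (fun h => hp (by simp [h]))]
    simp
  | cons q L ih =>
    obtain ⟨a, g'⟩ := q
    simp only [List.map_cons, List.nodup_cons, List.mem_cons, not_or, forall_eq_or_imp] at hN h1 hp hc
    obtain ⟨⟨hgg', hgL⟩, hg'L, hLn⟩ := hN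
    obtain ⟨⟨hag, hag', haL⟩, h1⟩ := h1
    set c' := Function.update c g' (!c a && c g) with hc'
    have e1 : Circuit.run (andNot g a g') (ket c) = ket c' := by
      rw [andNot_run_ket hag hag' hgg', hc.1, Bool.false_xor]
    have e2 : Circuit.run (andNot g a g') (ket c') = ket c := by
      rw [andNot_run_ket hag hag' hgg', hc', Function.update_self, Function.update_of_ne hag',
        Function.update_of_ne hgg', Bool.xor_self, Function.update_idem, ← hc.1,
        Function.update_eq_self]
    have h2 : ∀ a' ∈ L.map Prod.fst, c' a' = c a' := fun a' ha' =>
      Function.update_of_ne (h1 a' ha').2.1 _ _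
    rw [zeroPhase, Circuit.run_append, Circuit.run_append, e1, ih g' (by simp [hg'L, hLn])
      (fun a' ha' => by simpa using (h1 a' ha').2) (by simpa using hp.2), map_smul, e2]
    · have e3 : c' p = c p := Function.update_of_ne hp.2.1 _ _
      have e4 : c' g' = (!c a && c g) := Function.update_self _ _ _
      rw [e3, e4]
      congr 1
      refine if_congr ?_ rfl rfl
      simp only [List.map_cons, List.mem_cons, forall_eq_or_imp, Bool.and_eq_true,
        Bool.not_eq_true']
      constructor
      · rintro ⟨⟨h3, h4⟩, h5⟩
        exact ⟨h4, h3, fun a' ha' => by rw [← h2 a' ha']; exact h5 a' ha'⟩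
      · rintro ⟨h4, h3, h5⟩
        exact ⟨⟨h3, h4⟩, fun a' ha' => by rw [h2 a' ha']; exact h5 a' ha'⟩
    · intro b hb
      rw [hc', Function.update_of_ne (by rintro rfl; exact hg'L hb)]
      exact hc.2 b hb

end ZeroPhase

/-! ### Rotations about the prepared states -/

section Rotation

variable {N m v : ℕ}

/-- The wires that are 0 before the preparation. -/
noncomputable def checkWires (N m v : ℕ) : List (Wire N m (v + 1)) :=
  (Finset.univ : Finset (Qubit N m)).toList.map (xWire (v + 1))
    ++ (Finset.univ : Finset (Qubit N m)).toList.map (zWire (v + 1)) ++ [flagWire N m v]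

theorem checkWires_length : (checkWires N m v).length = 2 * (N + (N - 1) * m) + 1 := by
  simp [checkWires]; ring

/-- The pairs of a wire and a fresh ancilla. -/
noncomputable def ladder (N m ℓ : ℕ) : List (Wire N m (ℓ + 1 + 1) × Wire N m (ℓ + 1 + 1)) :=
  (checkWires N m (ℓ + 1)).zip ((List.finRange ℓ).map fun i => ancWire N m i.succ.succ)

/-- The phase on the zero state of the auxiliary register and of the flag. -/
noncomputable def zeroRotation (N m ℓ : ℕ) (φ : ℝ) : Circuit (Wire N m (ℓ + 1 + 1)) :=
  [Gate.x (ancWire N m (Fin.succ 0))]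
    ++ zeroPhase (rotWire N m (ℓ + 1 + 1)) φ (ancWire N m (Fin.succ 0)) (ladder N m ℓ)
    ++ [Gate.x (ancWire N m (Fin.succ 0))]

theorem mem_checkWires {q : Wire N m (v + 1)} : q ∈ checkWires N m v ↔
    (∃ i, q = xWire (v + 1) i) ∨ (∃ i, q = zWire (v + 1) i) ∨ q = flagWire N m v := by
  simp [checkWires, eq_comm]

theorem zeroRotation_run_ket {ℓ : ℕ} (hℓ : (checkWires N m (ℓ + 1)).length = ℓ) (φ : ℝ)
    (c : Wire N m (ℓ + 1 + 1) → Bool) (hc : ∀ i : Fin (ℓ + 1), c (ancWire N m i.succ) = false) :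
    Circuit.run (zeroRotation N m ℓ φ) (ket c)
      = (if ∀ a ∈ checkWires N m (ℓ + 1), c a = false then
          rotPhase φ (c (rotWire N m (ℓ + 1 + 1))) else 1) • ket c := by
  have hfst : (ladder N m ℓ).map Prod.fst = checkWires N m (ℓ + 1) :=
    List.map_fst_zip (by simp [hℓ])
  have hsnd : (ladder N m ℓ).map Prod.snd
      = (List.finRange ℓ).map fun i => ancWire N m i.succ.succ :=
    List.map_snd_zip (by simp [hℓ])
  have hne : ∀ a ∈ checkWires N m (ℓ + 1), ∀ i : Fin (ℓ + 1), a ≠ ancWire N m i.succ := by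
    intro a ha i
    rcases mem_checkWires.mp ha with ⟨j, rfl⟩ | ⟨j, rfl⟩ | rfl
    · simp
    · simp
    · simp [(Fin.succ_ne_zero i).symm]
  simp only [zeroRotation, Circuit.run_append, Circuit.run_cons, Circuit.run_nil]
  rw [x_run_ket, zeroPhase_run_ket, map_smul, x_run_ket]
  · rw [Function.update_self, Function.update_idem, Bool.not_not, Function.update_eq_self, hfst, hc]
    have key : ∀ a ∈ checkWires N m (ℓ + 1),
        Function.update c (ancWire N m (Fin.succ 0)) (!false) a = c a :=
      fun a ha => Function.update_of_ne (hne a ha 0) _ _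
    rw [Function.update_of_ne (a := rotWire N m (ℓ + 1 + 1)) (by simp [rotWire])]
    congr 1
    split_ifs with h1 h2 h2
    · rfl
    · exact absurd (fun a ha => (key a ha).symm.trans (h1.2 a ha)) h2
    · exact absurd ⟨rfl, fun a ha => (key a ha).trans (h2 a ha)⟩ h1
    · rfl
  · rw [hsnd, List.nodup_cons]
    constructor
    · simp [Fin.ext_iff]
    · refine List.Nodup.map (fun i j h => ?_) (List.nodup_finRange ℓ)
      simpa using h
  · intro a ha
    rw [hfst] at ha
    rw [hsnd, List.mem_cons, not_or]
    refine ⟨hne a ha 0, fun h => ?_⟩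
    obtain ⟨i, -, hi⟩ := List.mem_map.mp h
    exact hne a ha _ hi.symm
  · rw [hsnd]; simp [rotWire]
  · rw [hsnd]
    intro g hg
    obtain ⟨i, -, rfl⟩ := List.mem_map.mp hg
    rw [Function.update_of_ne (by simp [Fin.ext_iff]), hc]

theorem run_eq_of_ket {ι : Type} [Fintype ι] [DecidableEq ι] {C : Circuit ι}
    {ph : (ι → Bool) → ℂ} {Φ : (ι → Bool) → ℂ}
    (h : ∀ c, Φ c ≠ 0 → Circuit.run C (ket c) = ph c • ket c) :
    Circuit.run C Φ = fun c => ph c * Φ c := by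
  have h1 : Φ = ∑ c, Φ c • ket c := by
    funext c
    simp [Finset.sum_apply, ket_apply]
  have h2 : ∀ c, Circuit.run C (Φ c • ket c) = (ph c * Φ c) • ket c := by
    intro c
    by_cases hc : Φ c = 0
    · simp [hc]
    · rw [map_smul, h c hc, smul_smul, mul_comm]
  conv_lhs => rw [h1]
  rw [map_sum]
  simp only [h2]
  funext c
  simp [Finset.sum_apply, ket_apply]

theorem zeroRotation_run {ℓ : ℕ} (hℓ : (checkWires N m (ℓ + 1)).length = ℓ) (φ : ℝ)
    (Φ : (Wire N m (ℓ + 1 + 1) → Bool) → ℂ)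
    (hΦ : ∀ (i : Fin (ℓ + 1)) (c), c (ancWire N m i.succ) = true → Φ c = 0) :
    Circuit.run (zeroRotation N m ℓ φ) Φ = Φ + ∑ b : Bool, ∑ s : Conf N m,
      ((rotPhase φ b - 1) * Φ (lab s b false (∅, ∅))) • ket (lab s b false (∅, ∅)) := by
  rw [run_eq_of_ket (Φ := Φ) fun c hc => zeroRotation_run_ket hℓ φ c fun i => by
    by_contra h
    exact hc (hΦ i c (by simpa using h))]
  have hlab : ∀ (s : Conf N m) (b : Bool), ∀ a ∈ checkWires N m (ℓ + 1),
      lab s b false (∅, ∅) a = false := by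
    intro s b a ha
    rcases mem_checkWires.mp ha with ⟨j, rfl⟩ | ⟨j, rfl⟩ | rfl <;> simp
  funext c
  simp only [Pi.add_apply, Finset.sum_apply, Pi.smul_apply, smul_eq_mul, ket_apply]
  by_cases hc : ∃ s b, c = lab s b false (∅, ∅)
  · obtain ⟨s, b, rfl⟩ := hc
    rw [if_pos (hlab s b), Finset.sum_eq_single b, Finset.sum_eq_single s]
    · have : lab s b false (∅, ∅) (rotWire N m (ℓ + 1 + 1)) = b := rfl
      rw [this]
      simp
      ring
    · intro s' _ hs
      rw [if_neg, mul_zero]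
      intro h
      exact hs (cfg_inj.mp h).1.symm
    · simp
    · intro b' _ hb
      refine Finset.sum_eq_zero fun s' _ => ?_
      rw [if_neg, mul_zero]
      intro h
      exact hb (cfg_inj.mp h).2.2.2.2.symm
    · simp
  · rw [Finset.sum_eq_zero fun b _ => Finset.sum_eq_zero fun s _ => by
      rw [if_neg fun h => hc ⟨s, b, h⟩, mul_zero], add_zero]
    by_cases h0 : Φ c = 0
    · rw [h0, mul_zero]
    · rw [if_neg, one_mul]
      intro h
      apply hc
      refine ⟨fun q => c (Sum.inl q), c (rotWire N m _), ?_⟩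
      funext q
      rcases q with q | q | q | q | q
      · rfl
      · have := h (xWire _ q) (mem_checkWires.mpr (Or.inl ⟨q, rfl⟩))
        rw [this]; rfl
      · have := h (zWire _ q) (mem_checkWires.mpr (Or.inr (Or.inl ⟨q, rfl⟩)))
        rw [this]; rfl
      · have h1 : c (ancWire N m q) = false := by
          refine Fin.cases ?_ (fun i => ?_) q
          · exact h _ (mem_checkWires.mpr (Or.inr (Or.inr rfl)))
          · by_contra h'
            exact h0 (hΦ i c (by simpa using h'))
        rw [h1]
        simp [lab, cfg]
      · rfl

/-- The rotation about a prepared state. -/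
noncomputable def rotCirc (ℓ : ℕ) (G : Circuit (Wire N m (ℓ + 1 + 1))) (φ : ℝ) :
    Circuit (Wire N m (ℓ + 1 + 1)) :=
  Circuit.inv G ++ zeroRotation N m ℓ φ ++ G

/-- Conjugating 1 + (e^{±2iφ} − 1)|0⟩⟨0| by the preparation gives the rotation about the prepared
state. The flag is among the checked wires because the inverse preparation of a general state may
leave it set, where nothing is known about the preparation; the remaining ancillas are never targets
of G and stay 0. -/
theorem rotCirc_implements {ℓ : ℕ} (hℓ : (checkWires N m (ℓ + 1)).length = ℓ)
    {G : Circuit (Wire N m (ℓ + 1 + 1))} {g : Aux N m → ℂ} (hg : star g ⬝ᵥ g = 1)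
    (hG : Prepares G g) (hfix : ∀ i : Fin (ℓ + 1), Circuit.Fixes (ancWire N m i.succ) G) (φ : ℝ) :
    Implements (rotCirc ℓ G φ) fun b => auxRotation g (if b then -φ else φ) := by
  intro b Ψ
  rw [← Circuit.run_apply, rotCirc, Circuit.run_append, Circuit.run_append, zeroRotation_run hℓ,
    map_add, Circuit.run_run_inv, map_sum, auxRotation_mulVec hg, embed_add, embed_smul,
    embed_tensor_eq_sum]
  · congr 1
    have h1 : ∀ (s : Conf N m) (b' : Bool),
        Circuit.run (Circuit.inv G) (embed b Ψ) (lab s b' false (∅, ∅))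
          = if b' = b then auxContract g Ψ s else 0 := by
      intro s b'
      rw [← star_ket_dotProduct (lab s b' false (∅, ∅)) (Circuit.run _ _),
        Circuit.dotProduct_run_inv, ← embed_tensor_auxZero, hG.run,
        star_embed_dotProduct_embed, star_tensor_dotProduct]
      simp
    rw [Finset.sum_eq_single b, map_sum, Finset.smul_sum]
    · refine Finset.sum_congr rfl fun s _ => ?_
      rw [h1, if_pos rfl, map_smul, ← embed_tensor_auxZero, hG.run, smul_smul]
      rfl
    · intro b' _ hb
      rw [Finset.sum_eq_zero fun s _ => by rw [h1, if_neg hb, mul_zero, zero_smul], map_zero]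
    · simp
  · intro i c hc
    refine Circuit.run_apply_eq_zero (hfix i).inv (fun c' hc' => ?_) c hc
    rw [embed, if_neg]
    rintro ⟨h, -⟩
    rw [h i.succ] at hc'
    cases hc'

theorem rotCirc_length {ℓ : ℕ} (hℓ : (checkWires N m (ℓ + 1)).length = ℓ)
    (G : Circuit (Wire N m (ℓ + 1 + 1))) (φ : ℝ) :
    (rotCirc ℓ G φ).length ≤ 2 * G.length + 6 + 42 * ℓ := by
  have h1 := zeroPhase_length (rotWire N m (ℓ + 1 + 1)) φ (ancWire N m (Fin.succ 0)) (ladder N m ℓ)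
  have h2 : (ladder N m ℓ).length = ℓ := by simp [ladder, hℓ]
  rw [h2] at h1
  simp only [rotCirc, zeroRotation, List.length_append, Circuit.length_inv, List.length_cons,
    List.length_nil]
  omega

end Rotation

/-! ### Total cost and assembly -/

/-- Since log₂ N ≥ 1, the additive constant is absorbed: m ≤ (1 + a) log₂ N. For k ≥ 1 and Nm ≥ 1
the constants 2, 1200 and 1200 combine to 2402. -/
theorem gate_cost_bound {a N m k : ℕ} (hN : 2 ≤ N) (hm : (m : ℝ) ≤ Real.logb 2 N + a)
    (hk : 1 ≤ k) (hm1 : 1 ≤ m) {l : ℕ}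
    (hl : l ≤ 2 + 2 * (600 * (N * m)) + k * (2 * (600 * (N * m)))) :
    (l : ℝ) ≤ 2402 * (1 + a) / Real.log 2 * k * N * Real.log N := by
  have hlog2 : 0 < Real.log 2 := Real.log_pos (by norm_num)
  have hN' : (2 : ℝ) ≤ N := by exact_mod_cast hN
  have hlogN : Real.log 2 ≤ Real.log N := Real.log_le_log (by norm_num) hN'
  have h1 : (m : ℝ) ≤ (1 + a) * (Real.log N / Real.log 2) := by
    rw [Real.logb] at hm
    have h2 : 1 ≤ Real.log N / Real.log 2 := by rwa [one_le_div hlog2]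
    have ha : (0 : ℝ) ≤ a := Nat.cast_nonneg a
    nlinarith
  have h2 : l ≤ 2402 * (k * (N * m)) := by
    have h3 : 1 ≤ N * m := Nat.mul_pos (by omega) hm1
    have h4 : N * m ≤ k * (N * m) := Nat.le_mul_of_pos_left _ hk
    have h5 : k * (2 * (600 * (N * m))) = 1200 * (k * (N * m)) := by ring
    omega
  calc (l : ℝ) ≤ 2402 * (k * (N * m)) := by exact_mod_cast h2
    _ ≤ 2402 * (k * (N * ((1 + a) * (Real.log N / Real.log 2)))) := by gcongr
    _ = _ := by ring

theorem mainTheorem3 (a : ℕ) :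
    ∃ C : ℝ, ∀ (N m : ℕ) (μ x : ℝ), 2 ≤ N → 1 ≤ m → (m : ℝ) ≤ Real.logb 2 N + a →
      ∃ (w : ℕ) (G Gt U : Circuit (Wire N m w)) (R Rt : ℝ → Circuit (Wire N m w)),
        Prepares G (stateG N m μ x) ∧
        Prepares Gt (stateGt N m μ x) ∧
        Implements U (fun _ => blockU N m) ∧
        (∀ φ : ℝ, Implements (R φ)
          (fun b => auxRotation (stateG N m μ x) (if b then -φ else φ))) ∧
        (∀ φ : ℝ, Implements (Rt φ)
          (fun b => auxRotation (stateGt N m μ x) (if b then -φ else φ))) ∧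
        ∀ k : ℕ, 1 ≤ k →
          (∃ φ : ℕ → ℝ, ∀ ψ : Conf N m → ℂ,
            star (embed false (tensor ψ (auxZero N m))) ⬝ᵥ
                ((shot (rotWire N m w) G Gt U R Rt φ k).mat *ᵥ
                  embed false (tensor ψ (auxZero N m)))
              = star ψ ⬝ᵥ ((normHam N m μ x) ^ k *ᵥ ψ)) ∧
          ∀ φ : ℕ → ℝ, ((shot (rotWire N m w) G Gt U R Rt φ k).length : ℝ)
            ≤ C * k * N * Real.log N := by
  refine ⟨2402 * (1 + a) / Real.log 2, fun N m μ x hN hm hma => ?_⟩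
  -- One ladder ancilla per checked wire: two label wires for each qubit, and the flag. The flag
  -- itself and the root of the ladder make ℓ + 2 ancillas.
  set ℓ := 2 * (N + (N - 1) * m) + 1 with hℓ'
  have hℓ : (checkWires N m (ℓ + 1)).length = ℓ := checkWires_length
  have hnorm := pauliNorm_ne_zero hN hm μ x
  have hg := stateG_norm hnorm
  have hgt := stateGt_norm hnorm
  obtain ⟨L, hL, hG⟩ := exists_prepCirc hN hm μ x false (ℓ + 1)
  obtain ⟨Lt, hLt, hGt⟩ := exists_prepCirc hN hm μ x true (ℓ + 1)
  change Prepares _ (stateG N m μ x) at hG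
  change Prepares _ (stateGt N m μ x) at hGt
  set G := prepCirc (ℓ + 1) hm false L
  set Gt := prepCirc (ℓ + 1) hm true Lt
  have hU := pauliCirc_implements (N := N) (m := m) (w := ℓ + 1 + 1)
  have hR := rotCirc_implements hℓ hg hG (prepCirc_fixes hm false hL)
  have hRt := rotCirc_implements hℓ hgt hGt (prepCirc_fixes hm true hLt)
  have hsum : ∑ p, (pauliCoeff (normHam N m μ x) p : ℂ) • pauli p = normHam N m μ x := by
    simp only [normHam, pauliCoeff_smul, Complex.ofReal_mul, mul_smul]
    rw [← Finset.smul_sum, schwinger_eq_sum hm, sum_pauliCoeff_smul_pauli]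
  refine ⟨ℓ + 1 + 1, G, Gt, _, rotCirc ℓ G, rotCirc ℓ Gt, hG, hGt, hU, hR, hRt,
    fun k hk => ⟨?_, fun φ => ?_⟩⟩
  · exact exists_shot_amplitude blockU_mul_self hg hgt
      (blockU_contract hsum stateGt_mul_stateG) (blockU_contract hsum stateG_mul_stateGt)
      hG hGt hU hR hRt k hk
  -- The common bound 600Nm is set by the rotations, which cost at most 2 · 148Nm + 6 + 42ℓ.
  · refine gate_cost_bound hN hma hk hm (shot_length_le _ _ _ _ _ _ φ k _ ?_ ?_ ?_ ?_ ?_)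
    all_goals
      have h1 : N - 1 + 1 = N := by omega
      have h2 : (N - 1) * m ≤ N * m := Nat.mul_le_mul_right _ (by omega)
      have h3 : N ≤ N * m := Nat.le_mul_of_pos_right N hm
    · have : G.length ≤ _ := prepCirc_length hN hm false hL
      omega
    · have : Gt.length ≤ _ := prepCirc_length hN hm true hLt
      omega
    · have := pauliCirc_length (N := N) (m := m) (w := ℓ + 1 + 1)
      omega
    · intro θ
      have h4 : G.length ≤ _ := prepCirc_length hN hm false hL
      have h5 := rotCirc_length hℓ G θ
      omega
    · intro θ
      have h4 : Gt.length ≤ _ := prepCirc_length hN hm true hLt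
      have h5 := rotCirc_length hℓ Gt θ
      omega
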